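/- **Setting.** Let $X$ be a compact connected Riemann surface and $(E,\theta)$ a Higgs bundle of rank $r$ on $X$ ($E$ a holomorphic vector bundle, $\theta:E\to E\otimes\Omega^1_X$ holomorphic and $\mathcal O_X$-linear). A point $P\in X$ is *singular* if $\theta$ has at $P$ an eigenform (an element $a\,dz$ of $T_P^*X$ such that $a$ is an eigenvalue of $\theta_P(\partial/\partial z)$) of multiplicity $\ge 2$. Assume that at every singular point $P$ the following hold. (1) $P$ is generic: exactly one eigenform $c\,dz$ at $P$ has multiplicity $\geq 2$, its multiplicity is exactly $2$, and the two eigenforms that come together at $P$ are $c\,dz\pm a z^{1/2}dz+\dots$ (a convergent series in $z^{1/2}$, for a local coordinate $z$ centred at $P$) with $a\ne0$. (2) $P$ is non-parallel: the set of distinct eigenforms at $P$, in the real plane $T^*_PX$, contains no three collinear points and no four points defining two parallel lines. Let $\varphi:Y\to X$ be a ramified covering by a compact connected Riemann surface, étale over the complement of the singular points, such that $\varphi^*\theta$ has a full set of holomorphic eigen-one-forms $\alpha_1,\dots,\alpha_r$ on $Y$, i.e. $\det(\lambda-\varphi^*\theta)=\prod_i(\lambda-\alpha_i)$. Let $\pi:Z\to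 Y$ be the universal covering of $Y$, let $p,q\in Z$, and put $g_i(z)=\int_p^z\alpha_i$ and $g_{ij}=g_i-g_j$ on $Z$. Fix a smooth conformal metric on $Y$, pull it back to $Z$, and for $\mu>0$ let $W_{ij}=-\mu\,\mathbf{grad}\,\mathrm{Re}\,g_{ij}$. Fix a holomorphic coordinate centred at each point of $Y$ over a singular point of $X$; for a point $P\in Z$ over a singular point, $D_\rho(P)$ denotes the closed disc of radius $\rho$ around $P$ in this coordinate. A *furnished tree* $T$ is a binary planar tree (in general with several top vertices) sandwiched between a top and a bottom horizontal line and between two side edges; each top vertex not on a side edge is assigned a point of $Z$ (the side edges are assigned $p$ and $q$); each region of the complement between the side edges is assigned an index in $\{1,\dots,r\}$, so that each non-side edge $e$ has a left index $i_e$ and a right index $j_e$; and each edge $e$ is assigned a length $s(e)\ge0$. A *flowing map* $\Phi:T\to Z$ sends the top vertices to their assigned points, is constant equal to $p$, $q$ on the side edges, and maps each other edge $e$, from its upper to its lower vertex, to the flow curve of $W_{i_ej_e}$ for time $s(e)$. Below, top and bottom vertices are those not on the side edges. If $i_0,\dots,i_k$ are the indices of the regions along the top line and $z_1,\dots,z_k$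 the points assigned to the top vertices, put $g(z^{\rm top})=\sum_{l=1}^k g_{i_{l-1}i_l}(z_l)+\int_p^q\alpha_{i_k}$; define $g(z^{\rm bot})$ in the same way from the bottom line and the images under $\Phi$ of the bottom vertices. *Pruning* $T$ means cutting some edges $e$ at times $s'\in[0,s(e)]$, discarding everything below each cut and letting the cut end on the bottom line; the flowing map of the pruned tree is the restriction of $\Phi$. **Theorem.** There are $w_0>0$ and $C\ge1$ such that for all $0<u<w\le w_0$ and all $F\in\mathbb R$ there is an integer $K$ with the following property. Let $\epsilon>0$ and $\xi=C\epsilon$ with $\xi<u$, let $\mu>0$, and let $T$ be a furnished tree with a flowing map $\Phi:T\to Z$ such that the points assigned to the top vertices lie outside all the discs $D_w(P)$, each bottom vertex is mapped into some $D_\epsilon(P)$, and $$\mathrm{Re}\,g(z^{\rm bot})\ \ge\ \mathrm{Re}\,g(z^{\rm top})-F .$$ Then $T$ can be pruned to a tree $T'$ that has at most $K$ bottom vertices, each of which is mapped by $\Phi$ into some $D_\xi(P)$. In particular $K$ does not depend on $\epsilon$, $\xi$, $\mu$, $T$ or $\Phi$. -/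

import Mathlib

open scoped Manifold ContDiff Topology NNReal

/-! ## Higgs fields on a Riemann surface, their eigenforms and their turning points -/

section Higgs

variable {X : Type*} [TopologicalSpace X] [ChartedSpace ℂ X] [IsManifold 𝓘(ℂ) ω X]
  {F : Type*} [NormedAddCommGroup F] [NormedSpace ℂ F]
  {E : X → Type*} [TopologicalSpace (Bundle.TotalSpace F E)] [∀ P, TopologicalSpace (E P)]
  [∀ P, AddCommGroup (E P)] [∀ P, Module ℂ (E P)] [∀ P, IsTopologicalAddGroup (E P)]
  [∀ P, ContinuousSMul ℂ (E P)] [FiberBundle F E] [VectorBundle ℂ F E]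

/-- `θ`, a section of `Hom (TX, End E)`, is holomorphic; such a `θ` is a Higgs field
`E → E ⊗ Ω¹` on the holomorphic vector bundle `E` over the Riemann surface `X`. -/
def IsHiggsField (θ : ∀ P : X, TangentSpace 𝓘(ℂ) P →L[ℂ] E P →L[ℂ] E P) : Prop :=
  ContMDiff 𝓘(ℂ) (𝓘(ℂ).prod 𝓘(ℂ, ℂ →L[ℂ] F →L[ℂ] F)) ω
    (fun P => Bundle.TotalSpace.mk' (ℂ →L[ℂ] F →L[ℂ] F) P (θ P))

/-- The coordinate vector field `∂/∂z` of the preferred chart `z` at `P`, at the point with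
coordinate `z`. -/
noncomputable def coordVec (P : X) (z : ℂ) : TangentSpace 𝓘(ℂ) ((chartAt ℂ P).symm z) :=
  mfderiv 𝓘(ℂ) 𝓘(ℂ) (chartAt ℂ P).symm z (1 : ℂ)

variable [∀ P, FiniteDimensional ℂ (E P)]

/-- The characteristic polynomial of `θ(∂/∂z)` at the point with coordinate `z` in the preferred
chart at `P`. Its roots `a` are the eigenforms `a dz` of `θ` at that point. -/
noncomputable def eigenPoly (θ : ∀ P : X, TangentSpace 𝓘(ℂ) P →L[ℂ] E P →L[ℂ] E P)
    (P : X) (z : ℂ) : Polynomial ℂ :=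
  (θ ((chartAt ℂ P).symm z) (coordVec P z) :
    E ((chartAt ℂ P).symm z) →ₗ[ℂ] E ((chartAt ℂ P).symm z)).charpoly

/-- `P` is a singular point (turning point) of `θ`: some eigenform has multiplicity at least two
at `P`. -/
def IsTurningPoint (θ : ∀ P : X, TangentSpace 𝓘(ℂ) P →L[ℂ] E P →L[ℂ] E P) (P : X) : Prop :=
  ∃ c : ℂ, 2 ≤ (eigenPoly θ P (chartAt ℂ P P)).rootMultiplicity c

/-- A generic singular point: exactly one eigenform `c dz` has multiplicity at least two, it has
multiplicity exactly two, and the two eigenforms that come together are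
`β(± z^{1/2}) dz = c dz ± a z^{1/2} dz + …` with `a ≠ 0`, for a holomorphic function `β`
(here `z` is the coordinate centred at `P`, and `z = s²`). -/
def IsGenericTurningPoint (θ : ∀ P : X, TangentSpace 𝓘(ℂ) P →L[ℂ] E P →L[ℂ] E P)
    (P : X) : Prop :=
  ∃ c : ℂ, (eigenPoly θ P (chartAt ℂ P P)).rootMultiplicity c = 2 ∧
    (∀ c' : ℂ, 2 ≤ (eigenPoly θ P (chartAt ℂ P P)).rootMultiplicity c' → c' = c) ∧
    ∃ β : ℂ → ℂ, AnalyticAt ℂ β 0 ∧ β 0 = c ∧ deriv β 0 ≠ 0 ∧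
      ∀ᶠ s in 𝓝 (0 : ℂ), (eigenPoly θ P (chartAt ℂ P P + s ^ 2)).IsRoot (β s)

/-- The set of the (distinct) eigenforms at `P`, as complex numbers `a` standing for `a dz`. -/
def eigenformSet (θ : ∀ P : X, TangentSpace 𝓘(ℂ) P →L[ℂ] E P →L[ℂ] E P) (P : X) : Set ℂ :=
  {a | (eigenPoly θ P (chartAt ℂ P P)).IsRoot a}

/-- `P` is non-parallel: in the real plane `T^*_P X`, the set of eigenforms at `P` has no
collinear triple, and no quadruple of points that defines two parallel lines. -/
def IsNonParallel (θ : ∀ P : X, TangentSpace 𝓘(ℂ) P →L[ℂ] E P →L[ℂ] E P) (P : X) : Prop :=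
  (∀ a ∈ eigenformSet θ P, ∀ b ∈ eigenformSet θ P, ∀ c ∈ eigenformSet θ P,
    a ≠ b → a ≠ c → b ≠ c → ¬ Collinear ℝ {a, b, c}) ∧
  (∀ a ∈ eigenformSet θ P, ∀ b ∈ eigenformSet θ P, ∀ c ∈ eigenformSet θ P,
    ∀ d ∈ eigenformSet θ P, a ≠ b → a ≠ c → a ≠ d → b ≠ c → b ≠ d → c ≠ d →
      ¬ (line[ℝ, a, b]).Parallel (line[ℝ, c, d]))

variable (F) in
/-- `(E, θ)` is a Higgs bundle all of whose singular points are generic and non-parallel. -/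
structure IsGeneralHiggsField (θ : ∀ P : X, TangentSpace 𝓘(ℂ) P →L[ℂ] E P →L[ℂ] E P) :
    Prop where
  holomorphic : IsHiggsField (F := F) θ
  generic : ∀ P, IsTurningPoint θ P → IsGenericTurningPoint θ P
  nonParallel : ∀ P, IsTurningPoint θ P → IsNonParallel θ P

variable {Y : Type*} [TopologicalSpace Y] [ChartedSpace ℂ Y] [IsManifold 𝓘(ℂ) ω Y]

/-- `φ : Y → X` is a ramified covering, étale away from the turning points, on which the pulled
back Higgs field `φ^* θ` has the full set `α₁, …, α_r` of holomorphic eigen-one-forms. -/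
structure IsSpectralCover (θ : ∀ P : X, TangentSpace 𝓘(ℂ) P →L[ℂ] E P →L[ℂ] E P)
    (φ : Y → X) {r : ℕ} (α : Fin r → ∀ y : Y, TangentSpace 𝓘(ℂ) y →L[ℂ] ℂ) : Prop where
  holomorphic : ContMDiff 𝓘(ℂ) 𝓘(ℂ) ω φ
  surjective : Function.Surjective φ
  unramified : ∀ y, ¬ IsTurningPoint θ (φ y) → mfderiv 𝓘(ℂ) 𝓘(ℂ) φ y ≠ 0
  holomorphic_form : ∀ i, ContMDiff 𝓘(ℂ) (𝓘(ℂ).prod 𝓘(ℂ, ℂ →L[ℂ] ℂ)) ω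
    (fun y => Bundle.TotalSpace.mk' (ℂ →L[ℂ] ℂ) y (α i y))
  eigenforms : ∀ (y : Y) (v : TangentSpace 𝓘(ℂ) y),
    (θ (φ y) (mfderiv 𝓘(ℂ) 𝓘(ℂ) φ y v) : E (φ y) →ₗ[ℂ] E (φ y)).charpoly =
      ∏ i, (Polynomial.X - Polynomial.C (α i y v))

end Higgs

/-! ## The universal covering, the functions `g_{ij}` and their gradients -/

section Geometry

variable {Y : Type*} [TopologicalSpace Y] [ChartedSpace ℂ Y]
  {Z : Type*} [TopologicalSpace Z] [ChartedSpace ℂ Z]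

/-- `g(z) = ∫_p^z π^* α`: the holomorphic function `g` on `Z` with `dg = π^* α`, `g(p) = 0`. -/
def IsIntegralFrom (π : Z → Y) (α : ∀ y : Y, TangentSpace 𝓘(ℂ) y →L[ℂ] ℂ) (p : Z)
    (g : Z → ℂ) : Prop :=
  g p = 0 ∧ ∀ z, HasMFDerivAt 𝓘(ℂ) 𝓘(ℂ) g z ((α (π z)).comp (mfderiv 𝓘(ℂ) 𝓘(ℂ) π z))

/-- A smooth conformal (that is, Hermitian) metric on a Riemann surface, given by the square
`normSq y v = |v|²` of the length of tangent vectors; smoothness says that `|∂/∂z|²` is a smooth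
function in each chart. -/
structure ConformalMetric (Y : Type*) [TopologicalSpace Y] [ChartedSpace ℂ Y] where
  normSq : ∀ y : Y, TangentSpace 𝓘(ℂ) y → ℝ
  normSq_smul : ∀ (y : Y) (a : ℂ) (v : TangentSpace 𝓘(ℂ) y),
    normSq y (a • v) = ‖a‖ ^ 2 * normSq y v
  normSq_pos : ∀ (y : Y) (v : TangentSpace 𝓘(ℂ) y), v ≠ 0 → 0 < normSq y v
  smooth : ∀ P : Y, ContDiffOn ℝ ∞
    (fun z : ℂ => normSq ((chartAt ℂ P).symm z) (coordVec P z)) (chartAt ℂ P).target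

/-- The square of the length of a tangent vector of `Z` for the pulled back metric `π^* h`. -/
noncomputable def ConformalMetric.pullbackNormSq (h : ConformalMetric Y) (π : Z → Y) (z : Z)
    (v : TangentSpace 𝓘(ℂ) z) : ℝ :=
  h.normSq (π z) (mfderiv 𝓘(ℂ) 𝓘(ℂ) π z v)

/-- The gradient of `Re g`, for a holomorphic function `g`, with respect to a conformal metric
with squared length `N`. In the basis `e = ∂/∂z` of the complex tangent line it is
`conj (dg(e)) / |e|² • e`: for `v = b e` the real inner product
`⟨grad, v⟩ = Re (conj (conj (dg(e)) / |e|²) * b) |e|²` is `Re (b dg(e)) = d(Re g)(v)`. The value is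
regarded as a vector of the real tangent plane. -/
noncomputable def gradRe (N : ∀ z : Z, TangentSpace 𝓘(ℂ) z → ℝ) (g : Z → ℂ) (z : Z) :
    TangentSpace 𝓘(ℝ, ℂ) z :=
  let dg : ℂ := mfderiv 𝓘(ℂ) 𝓘(ℂ) g z (1 : ℂ)
  (starRingEnd ℂ dg / (N z (1 : ℂ) : ℂ) : ℂ)

/-- The defining property of the gradient: `⟨gradRe, v⟩ = d(Re g)(v)` for every tangent vector `v`,
where the real inner product is the polarization of the squared length. -/
theorem gradRe_spec (N : ∀ z : Z, TangentSpace 𝓘(ℂ) z → ℝ) (z : Z)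
    (hN : ∀ (a : ℂ) (v : TangentSpace 𝓘(ℂ) z), N z (a • v) = ‖a‖ ^ 2 * N z v)
    (hpos : 0 < N z (1 : ℂ)) (g : Z → ℂ) (W v : ℂ) (hW : W = gradRe N g z) :
    (N z (W + v : ℂ) - N z W - N z v) / 2 = Complex.re (mfderiv 𝓘(ℂ) 𝓘(ℂ) g z v) := by
  have key : ∀ b : ℂ, N z b = ‖b‖ ^ 2 * N z (1 : ℂ) := by
    intro b
    have h1 : N z (b * 1 : ℂ) = ‖b‖ ^ 2 * N z (1 : ℂ) := hN b (1 : ℂ)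
    rwa [mul_one] at h1
  obtain ⟨d, hd⟩ : ∃ d : ℂ, d = mfderiv 𝓘(ℂ) 𝓘(ℂ) g z (1 : ℂ) := ⟨_, rfl⟩
  have hdv : v * d = mfderiv 𝓘(ℂ) 𝓘(ℂ) g z v := by
    have h1 : mfderiv 𝓘(ℂ) 𝓘(ℂ) g z (v * 1 : ℂ) = v * d := by
      rw [hd]
      exact (mfderiv 𝓘(ℂ) 𝓘(ℂ) g z).map_smul v (1 : ℂ)
    rw [mul_one] at h1
    exact h1.symm
  have hg : W = starRingEnd ℂ d / (N z (1 : ℂ) : ℂ) := by rw [hW, hd]; rfl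
  rw [← hdv, key (W + v : ℂ), key W, key v, hg]
  generalize N z (1 : ℂ) = n at hpos
  simp only [Complex.sq_norm, Complex.normSq_apply, Complex.add_re, Complex.add_im,
    Complex.div_ofReal_re, Complex.div_ofReal_im, Complex.conj_re, Complex.conj_im,
    Complex.mul_re]
  field_simp
  ring

/-- The vector field `W_{ij}`: `μ` times the downward gradient of `Re g_{ij}` on `Z`, where
`g_{ij} = g_i - g_j`, for the metric pulled back from `Y`. -/
noncomputable def flowField (h : ConformalMetric Y) (π : Z → Y) {r : ℕ} (g : Fin r → Z → ℂ)
    (μ : ℝ) (i j : Fin r) (z : Z) : TangentSpace 𝓘(ℝ, ℂ) z :=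
  (-μ) • gradRe (h.pullbackNormSq π) (fun x => g i x - g j x) z

/-- `c` is a holomorphic local coordinate centred at `P`. -/
def IsCoordinateAt [IsManifold 𝓘(ℂ) ω Y] (c : OpenPartialHomeomorph Y ℂ) (P : Y) : Prop :=
  c ∈ IsManifold.maximalAtlas 𝓘(ℂ) ω Y ∧ P ∈ c.source ∧ c P = 0

/-- The union of the closed discs `D_ρ(P) ⊆ Z`, over all points `P` of `Z` that lie above a point
of `S ⊆ Y`; the discs are taken in the coordinates `c`. -/
def discs (π : Z → Y) (S : Set Y) (c : Y → OpenPartialHomeomorph Y ℂ) (ρ : ℝ) : Set Z :=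
  {z | ∃ P ∈ S, π z ∈ (c P).source ∧ ‖c P (π z)‖ ≤ ρ}

end Geometry

/-! ## Furnished trees, flowing maps and pruning -/

/-- An edge of a furnished tree, with left index `i` and right index `j`, together with everything
below it. An edge has a length `s ≥ 0`; it either ends at the bottom line (`bot`), or ends at a
binary vertex (`split`), where a new region with index `m` begins, between the two lower edges
with indices `(i, m)` and `(m, j)`. -/
inductive EdgeTree (ι : Type*) : ι → ι → Type _
  | bot {i j : ι} (s : ℝ≥0) : EdgeTree ι i j
  | split {i j : ι} (s : ℝ≥0) (m : ι) (left : EdgeTree ι i m) (right : EdgeTree ι m j) :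
      EdgeTree ι i j

namespace EdgeTree

variable {ι : Type*} {Z : Type*}

/-- `Φ` is a flowing map on the tree below an edge whose upper vertex is mapped to `z`. An edge is
addressed by the list of left (`false`) and right (`true`) turns leading to it; `Φ a` is the
parametrized curve onto which the edge with address `a` is mapped. It has to be the flow curve of
`W i j` for time `s`, where `i, j` are the indices and `s` the length of the edge. -/
def IsFlowing [TopologicalSpace Z] [ChartedSpace ℂ Z]
    (W : ι → ι → ∀ z : Z, TangentSpace 𝓘(ℝ, ℂ) z) :
    {i j : ι} → EdgeTree ι i j → (List Bool → ℝ → Z) → Z → Prop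
  | i, j, bot s, Φ, z =>
      Φ [] 0 = z ∧ IsMIntegralCurveOn (I := 𝓘(ℝ, ℂ)) (Φ []) (W i j) (Set.Icc 0 (s : ℝ))
  | i, j, split s _ l r, Φ, z =>
      (Φ [] 0 = z ∧ IsMIntegralCurveOn (I := 𝓘(ℝ, ℂ)) (Φ []) (W i j) (Set.Icc 0 (s : ℝ))) ∧
      IsFlowing W l (fun a => Φ (false :: a)) (Φ [] s) ∧
      IsFlowing W r (fun a => Φ (true :: a)) (Φ [] s)

/-- The bottom vertices, from left to right; each one is recorded by the left and right index of
its edge and its image under `Φ`. -/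
def bottoms : {i j : ι} → EdgeTree ι i j → (List Bool → ℝ → Z) → List (ι × ι × Z)
  | i, j, bot s, Φ => [(i, j, Φ [] s)]
  | _, _, split _ _ l r, Φ =>
      bottoms l (fun a => Φ (false :: a)) ++ bottoms r (fun a => Φ (true :: a))

/-- `Prunes t t'`: the tree `t'` is obtained from `t` by cutting some edges `e` at some times
`s' ∈ [0, s(e)]`, removing everything below and sending the cut to the bottom line. -/
inductive Prunes : {i j : ι} → EdgeTree ι i j → EdgeTree ι i j → Prop
  | cutBot {i j : ι} (s s' : ℝ≥0) (h : s' ≤ s) : Prunes (bot s : EdgeTree ι i j) (bot s')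
  | cutSplit {i j : ι} (s s' : ℝ≥0) (h : s' ≤ s) (m : ι) (l : EdgeTree ι i m)
      (r : EdgeTree ι m j) : Prunes (split s m l r) (bot s')
  | keep {i j : ι} (s : ℝ≥0) (m : ι) {l l' : EdgeTree ι i m} {r r' : EdgeTree ι m j}
      (hl : Prunes l l') (hr : Prunes r r') : Prunes (split s m l r) (split s m l' r')

end EdgeTree

/-- A furnished tree: a binary planar tree sandwiched between a top and a bottom line, with `k`
top vertices besides those of the two side edges. The regions that meet the top line carry the
indices `index 0, …, index k`, the `l`-th top vertex carries the point `top l`, and `branch l` is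
what hangs below it. The two side edges are constant and carry no further data. -/
structure FurnishedTree (ι : Type*) (Z : Type*) where
  k : ℕ
  index : Fin (k + 1) → ι
  top : Fin k → Z
  branch : ∀ l : Fin k, EdgeTree ι (index l.castSucc) (index l.succ)

namespace FurnishedTree

variable {ι : Type*} {Z : Type*}

/-- `Φ`, given by its restrictions `Φ l` to the branches, is a flowing map for the vector fields
`W`. -/
def IsFlowing [TopologicalSpace Z] [ChartedSpace ℂ Z] (T : FurnishedTree ι Z)
    (W : ι → ι → ∀ z : Z, TangentSpace 𝓘(ℝ, ℂ) z) (Φ : Fin T.k → List Bool → ℝ → Z) : Prop :=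
  ∀ l, (T.branch l).IsFlowing W (Φ l) (T.top l)

/-- The top vertices, with the indices to their left and right. -/
def tops (T : FurnishedTree ι Z) : List (ι × ι × Z) :=
  List.ofFn fun l => (T.index l.castSucc, T.index l.succ, T.top l)

/-- The bottom vertices (without those of the side edges), with the indices to their left and
right and their images under `Φ`. -/
def bottoms (T : FurnishedTree ι Z) (Φ : Fin T.k → List Bool → ℝ → Z) : List (ι × ι × Z) :=
  (List.ofFn fun l => (T.branch l).bottoms (Φ l)).flatten

/-- `g_I(z₁, …, z_k) = ∑ g_{i_{l-1} i_l}(z_l) + ∫_p^q α_{i_k}`, for the points `z_l` listed with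
their left and right indices in `L`, and with the last index `i_k` of the tree (it is the same
along the top and along the bottom line). -/
noncomputable def gValue (T : FurnishedTree ι Z) (g : ι → Z → ℂ) (q : Z)
    (L : List (ι × ι × Z)) : ℂ :=
  (L.map fun v => g v.1 v.2.2 - g v.2.1 v.2.2).sum + g (T.index (Fin.last T.k)) q

/-- `T` with its branches replaced by `b`. -/
def withBranches (T : FurnishedTree ι Z)
    (b : ∀ l : Fin T.k, EdgeTree ι (T.index l.castSucc) (T.index l.succ)) : FurnishedTree ι Z :=
  { k := T.k, index := T.index, top := T.top, branch := b }

end FurnishedTree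

/-! ## Energy of a flowing tree, and the counting argument -/

/-! The energy of a branch is the decrease of Re g_ij from its top to its bottom vertices. Since
g_ij = g_im + g_mj at a vertex, it is the sum of the losses along the edges, all non-negative
because edges descend; the hypothesis bounds the total energy by F. Crossing a collar around a
turning point costs a fixed amount of energy: on the collar α_i − α_j has no zero, and motion at
coordinate speed l|f| loses energy at rate l|f|², so the exchange rate between distance and energy
does not involve μ (`exists_cutoff`). Hence a branch of energy below some δ starts, and then stays,
near a single turning point. Call such a branch cheap.

It remains to bound the number of vertices of a cheap branch and the number of cheap branches shed
by an expensive one. Two devices, both living near one turning point P, do this. A certificate is a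
condition on the indices and the position that flows down along edges, passes to at least one child
at every vertex, and is incompatible with a bottom vertex in the ε-disc. A certified branch is
therefore expensive (`le_energy_of_cert`), so a cheap one carries no certificate. The potential Ψ
takes values in {0, …, M} with M independent of ε, and falls for the sibling whenever an uncertified
branch splits off from an edge that stays near P and outside the ξ-discs. Edges that meet a ξ-disc
are cut there. A cheap branch then has at most 2^Ψ bottom vertices, while an expensive one sheds
boundedly many cheap branches before it has to pay for crossing a collar again or to split into two
expensive ones; this gives a bound linear in the energy (`CountingData.exists_prune`).

The local devices come from the base coordinate ζ centred at the turning point. An edge with indices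
i, j moves ζ approximately in the direction B_i − B_j, where B_k = −conj a_k(0). If a direction n is
positive on this drift and ⟨n, ζ⟩ is already above a threshold, the edge cannot return; such n,
taken in a fixed finite set N, are the escape directions. For the merging pair the drift vanishes,
but Im g_ij is conserved and Re g_ij decreases, so a large imaginary or a very negative real part is
an obstruction as well. If an uncertified branch with non-zero drift leaves a sibling with non-zero
drift, then, no three eigenforms being collinear, the drift has to turn and the sibling gains an
escape direction. Shedding a merging branch does not change the drift, but it requires Re (G_k −
G_l) > 0, and afterwards the sign is the wrong one for another shedding. Because (G_k − G_l)² ≈ c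
ζ³, the sign cannot be restored while the phase of ζ is nearly constant, that is, while no escape
direction is gained.

The main lemmas are `exists_isDirectionSet` for N, `sheddingPotential_lt_of_left` for the fall of
the potential, `IsModelPoint.re_pos_of_escapeSet_eq` for the persistence of the sign,
`exists_isPlanarModel` for the expansions at a turning point, and `exists_countingData`, which makes
the constants uniform. -/

namespace EdgeTree

variable {ι Z σ : Type*}

/-- The curves `Φ` follow, along each edge, a curve admitted by `Fl`, starting at `z`. -/
def FlowsBy (Fl : ι → ι → (ℝ → Z) → ℝ → Prop) :
    {i j : ι} → EdgeTree ι i j → (List Bool → ℝ → Z) → Z → Prop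
  | i, j, bot s, Φ, z => Φ [] 0 = z ∧ Fl i j (Φ []) s
  | i, j, split s _ l r, Φ, z =>
      (Φ [] 0 = z ∧ Fl i j (Φ []) s) ∧
      FlowsBy Fl l (fun a => Φ (false :: a)) (Φ [] s) ∧
      FlowsBy Fl r (fun a => Φ (true :: a)) (Φ [] s)

theorem IsFlowing.flowsBy [TopologicalSpace Z] [ChartedSpace ℂ Z]
    {W : ι → ι → ∀ z : Z, TangentSpace 𝓘(ℝ, ℂ) z} {i j : ι} {t : EdgeTree ι i j}
    {Φ : List Bool → ℝ → Z} {z : Z} (h : t.IsFlowing W Φ z) :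
    t.FlowsBy (fun i j γ s => IsMIntegralCurveOn (I := 𝓘(ℝ, ℂ)) γ (W i j) (Set.Icc 0 s)) Φ z := by
  induction t generalizing Φ z with
  | bot s => exact h
  | split s m l r hl hr => exact ⟨h.1, hl h.2.1, hr h.2.2⟩

/-- The decrease of `f_i - f_j` from the top of a tree to its bottom vertices. -/
noncomputable def energy (f : ι → Z → ℝ) {i j : ι} (t : EdgeTree ι i j)
    (Φ : List Bool → ℝ → Z) (z : Z) : ℝ :=
  f i z - f j z - ((t.bottoms Φ).map fun v => f v.1 v.2.2 - f v.2.1 v.2.2).sum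

theorem energy_bot (f : ι → Z → ℝ) {i j : ι} (s : ℝ≥0) (Φ : List Bool → ℝ → Z) (z : Z) :
    (bot s : EdgeTree ι i j).energy f Φ z =
      (f i z - f j z) - (f i (Φ [] s) - f j (Φ [] s)) := by
  simp [energy, bottoms]

/-- At the vertex the differences telescope, f_i − f_j = (f_i − f_m) + (f_m − f_j), so only the
edges contribute. -/
theorem energy_split (f : ι → Z → ℝ) {i j : ι} (s : ℝ≥0) (m : ι) (l : EdgeTree ι i m)
    (r : EdgeTree ι m j) (Φ : List Bool → ℝ → Z) (z : Z) :
    (split s m l r).energy f Φ z =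
      ((f i z - f j z) - (f i (Φ [] s) - f j (Φ [] s))) +
        l.energy f (fun a => Φ (false :: a)) (Φ [] s) +
        r.energy f (fun a => Φ (true :: a)) (Φ [] s) := by
  simp only [energy, bottoms, List.map_append, List.sum_append]
  ring

/-- The data that bound the number of bottom vertices: the decrease of `f_i - f_j` along flow
curves, cut-off functions `H P` that decrease only at the cost of energy, certificates
`Cert P i j x` that are inherited by flow curves and by one of the two branches at each vertex, and
a potential `Ψ` that decreases whenever a branch without certificate splits off. -/
structure CountingData (Fl : ι → ι → (ℝ → Z) → ℝ → Prop) (f : ι → Z → ℝ) (A B : Set Z)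
    (V U : σ → Set Z) (H : σ → Z → ℝ) (Cert : σ → ι → ι → Z → Prop)
    (Ψ : σ → ι → ι → Z → ℕ) (M : ℕ) (δ δ' : ℝ) : Prop where
  mono : ∀ {i j γ s}, Fl i j γ s → ∀ t₁ t₂, 0 ≤ t₁ → t₁ ≤ t₂ → t₂ ≤ s →
    f i (γ t₂) - f j (γ t₂) ≤ f i (γ t₁) - f j (γ t₁)
  subset : A ⊆ B
  sub : ∀ P, V P ⊆ U P
  disj : ∀ P Q x, x ∈ U P → x ∈ U Q → P = Q
  pos : 0 < δ
  cutoff : ∀ {i j γ s}, Fl i j γ s → ∀ P t₁ t₂, 0 ≤ t₁ → t₁ ≤ t₂ → t₂ ≤ s →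
    δ * (H P (γ t₁) - H P (γ t₂)) ≤
      (f i (γ t₁) - f j (γ t₁)) - (f i (γ t₂) - f j (γ t₂))
  cutoff_one : ∀ P x, x ∉ V P → H P x = 1
  cutoff_zero : ∀ x ∈ A, ∃ P, H P x = 0
  enter : ∀ {i j γ s}, Fl i j γ s → ∀ P t, 0 ≤ t → t ≤ s → γ t ∉ U P → γ s ∈ V P →
    δ' ≤ (f i (γ 0) - f j (γ 0)) - (f i (γ s) - f j (γ s))
  cert_flow : ∀ {i j γ s}, 0 ≤ s → Fl i j γ s → ∀ P, (∀ t, 0 ≤ t → t ≤ s → γ t ∈ V P) →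
    Cert P i j (γ 0) → Cert P i j (γ s)
  cert_split : ∀ {P i j x} m, x ∈ V P → Cert P i j x → Cert P i m x ∨ Cert P m j x
  cert_bot : ∀ {P i j x}, x ∈ V P → x ∈ A → ¬ Cert P i j x
  le_bound : ∀ P i j x, Ψ P i j x ≤ M
  step_left : ∀ {i j γ s}, 0 ≤ s → Fl i j γ s → ∀ P m,
    (∀ t, 0 ≤ t → t ≤ s → γ t ∈ U P ∧ γ t ∉ B) →
    ¬ Cert P i m (γ s) → Ψ P m j (γ s) < Ψ P i j (γ 0)
  step_right : ∀ {i j γ s}, 0 ≤ s → Fl i j γ s → ∀ P m,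
    (∀ t, 0 ≤ t → t ≤ s → γ t ∈ U P ∧ γ t ∉ B) →
    ¬ Cert P m j (γ s) → Ψ P i m (γ s) < Ψ P i j (γ 0)

namespace CountingData

variable {Fl : ι → ι → (ℝ → Z) → ℝ → Prop} {f : ι → Z → ℝ} {A B : Set Z}
    {V U : σ → Set Z} {H : σ → Z → ℝ} {Cert : σ → ι → ι → Z → Prop}
    {Ψ : σ → ι → ι → Z → ℕ} {M : ℕ} {δ δ' : ℝ}

theorem energy_nonneg (h : CountingData Fl f A B V U H Cert Ψ M δ δ') {i j : ι}
    {t : EdgeTree ι i j} {Φ : List Bool → ℝ → Z} {z : Z} (ht : t.FlowsBy Fl Φ z) :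
    0 ≤ t.energy f Φ z := by
  induction t generalizing Φ z with
  | bot s =>
    rw [energy_bot]
    have := h.mono ht.2 0 s le_rfl s.coe_nonneg le_rfl
    rw [ht.1] at this
    linarith
  | split s m l r hl hr =>
    rw [energy_split]
    have := h.mono ht.1.2 0 s le_rfl s.coe_nonneg le_rfl
    rw [ht.1.1] at this
    linarith [hl ht.2.1, hr ht.2.2]

/-- The leftmost bottom vertex bounds the cut-off functions at the top in terms of the energy. -/
theorem exists_cutoff_le (h : CountingData Fl f A B V U H Cert Ψ M δ δ') {i j : ι}
    {t : EdgeTree ι i j} {Φ : List Bool → ℝ → Z} {z : Z} (ht : t.FlowsBy Fl Φ z) :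
    ∃ v ∈ t.bottoms Φ, ∀ P, δ * (H P z - H P v.2.2) ≤ t.energy f Φ z := by
  induction t generalizing Φ z with
  | bot s =>
    refine ⟨_, List.mem_singleton_self _, fun P => ?_⟩
    rw [energy_bot]
    have := h.cutoff ht.2 P 0 s le_rfl s.coe_nonneg le_rfl
    rwa [ht.1] at this
  | split s m l r hl hr =>
    obtain ⟨v, hv, hP⟩ := hl ht.2.1
    refine ⟨v, List.mem_append_left _ hv, fun P => ?_⟩
    rw [energy_split]
    have h1 := h.cutoff ht.1.2 P 0 s le_rfl s.coe_nonneg le_rfl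
    rw [ht.1.1] at h1
    linarith [hP P, h.energy_nonneg ht.2.2]

/-- Some cut-off function vanishes at the leftmost bottom vertex and equals 1 outside its `V P`; a
start outside would cost δ. -/
theorem mem_of_energy_lt (h : CountingData Fl f A B V U H Cert Ψ M δ δ') {i j : ι}
    {t : EdgeTree ι i j} {Φ : List Bool → ℝ → Z} {z : Z} (ht : t.FlowsBy Fl Φ z)
    (hA : ∀ v ∈ t.bottoms Φ, v.2.2 ∈ A) (hE : t.energy f Φ z < δ) : ∃ P, z ∈ V P := by
  obtain ⟨v, hv, hP⟩ := h.exists_cutoff_le ht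
  obtain ⟨P, h0⟩ := h.cutoff_zero _ (hA v hv)
  refine ⟨P, by_contra fun hz => ?_⟩
  have := hP P
  rw [h0, h.cutoff_one P z hz] at this
  linarith

/-- A tree of small energy that starts in `V P` keeps its first edge in `V P`. -/
theorem edge_mem_of_energy_lt (h : CountingData Fl f A B V U H Cert Ψ M δ δ') {i j : ι}
    {t : EdgeTree ι i j} {Φ : List Bool → ℝ → Z} {z : Z}
    (hA : ∀ v ∈ t.bottoms Φ, v.2.2 ∈ A) (hE : t.energy f Φ z < δ) {P : σ} (hz : z ∈ V P)
    {s : ℝ} (hs : ∀ E, t.energy f Φ z = E → ∃ v ∈ t.bottoms Φ, ∀ Q τ, 0 ≤ τ → τ ≤ s →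
      δ * (H Q (Φ [] τ) - H Q v.2.2) ≤ E) (h0 : Φ [] 0 = z) (hs0 : 0 ≤ s) (τ : ℝ)
    (hτ : 0 ≤ τ) (hτs : τ ≤ s) : Φ [] τ ∈ V P := by
  obtain ⟨v, hv, hQ⟩ := hs _ rfl
  obtain ⟨Q, hQ0⟩ := h.cutoff_zero _ (hA v hv)
  have key : ∀ τ, 0 ≤ τ → τ ≤ s → Φ [] τ ∈ V Q := by
    intro τ h1 h2
    by_contra hn
    have := hQ Q τ h1 h2
    rw [hQ0, h.cutoff_one Q _ hn] at this
    linarith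
  -- The bottom vertex singles out Q, and the edge starts in both `V P` and `V Q`, which are
  -- disjoint for distinct indices.
  have hPQ : P = Q := by
    have h1 := key 0 le_rfl hs0
    rw [h0] at h1
    exact h.disj P Q z (h.sub P hz) (h.sub Q h1)
  rw [hPQ]
  exact key τ hτ hτs

theorem bot_edge_mem (h : CountingData Fl f A B V U H Cert Ψ M δ δ') {i j : ι} {s : ℝ≥0}
    {Φ : List Bool → ℝ → Z} {z : Z} (ht : (bot s : EdgeTree ι i j).FlowsBy Fl Φ z)
    (hA : ∀ v ∈ (bot s : EdgeTree ι i j).bottoms Φ, v.2.2 ∈ A)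
    (hE : (bot s : EdgeTree ι i j).energy f Φ z < δ) {P : σ} (hz : z ∈ V P) (τ : ℝ)
    (hτ : 0 ≤ τ) (hτs : τ ≤ s) : Φ [] τ ∈ V P := by
  refine h.edge_mem_of_energy_lt hA hE hz ?_ ht.1 s.coe_nonneg τ hτ hτs
  rintro E rfl
  refine ⟨_, List.mem_singleton_self _, fun Q τ h1 h2 => ?_⟩
  rw [energy_bot]
  have h3 := h.cutoff ht.2 Q τ s h1 h2 le_rfl
  have h4 := h.mono ht.2 0 τ le_rfl h1 h2
  rw [ht.1] at h4
  simp only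
  linarith

theorem split_edge_mem (h : CountingData Fl f A B V U H Cert Ψ M δ δ') {i j m : ι} {s : ℝ≥0}
    {l : EdgeTree ι i m} {r : EdgeTree ι m j}
    {Φ : List Bool → ℝ → Z} {z : Z} (ht : (split s m l r).FlowsBy Fl Φ z)
    (hA : ∀ v ∈ (split s m l r).bottoms Φ, v.2.2 ∈ A)
    (hE : (split s m l r).energy f Φ z < δ) {P : σ} (hz : z ∈ V P) (τ : ℝ)
    (hτ : 0 ≤ τ) (hτs : τ ≤ s) : Φ [] τ ∈ V P := by
  refine h.edge_mem_of_energy_lt hA hE hz ?_ ht.1.1 s.coe_nonneg τ hτ hτs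
  rintro E rfl
  obtain ⟨v, hv, hP⟩ := h.exists_cutoff_le ht.2.1
  refine ⟨v, List.mem_append_left _ hv, fun Q τ h1 h2 => ?_⟩
  rw [energy_split]
  have h3 := h.cutoff ht.1.2 Q τ s h1 h2 le_rfl
  have h4 := h.mono ht.1.2 0 τ le_rfl h1 h2
  rw [ht.1.1] at h4
  linarith [hP Q, h.energy_nonneg ht.2.2]

/-- A tree with a certificate has large energy. -/
theorem le_energy_of_cert (h : CountingData Fl f A B V U H Cert Ψ M δ δ') {i j : ι}
    {t : EdgeTree ι i j} {Φ : List Bool → ℝ → Z} {z : Z} (ht : t.FlowsBy Fl Φ z)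
    (hA : ∀ v ∈ t.bottoms Φ, v.2.2 ∈ A) {P : σ} (hz : z ∈ V P) (hc : Cert P i j z) :
    δ ≤ t.energy f Φ z := by
  by_contra! hE
  induction t generalizing Φ z with
  | bot s =>
    have hV := h.bot_edge_mem ht hA hE hz
    rw [← ht.1] at hc
    exact h.cert_bot (hV s s.coe_nonneg le_rfl) (hA _ (List.mem_singleton_self _))
      (h.cert_flow s.coe_nonneg ht.2 P hV hc)
  | split s m l r hl hr =>
    have hV := h.split_edge_mem ht hA hE hz
    have hs := hV s s.coe_nonneg le_rfl
    rw [← ht.1.1] at hc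
    have hc' := h.cert_flow s.coe_nonneg ht.1.2 P hV hc
    rw [energy_split] at hE
    have hm := h.mono ht.1.2 0 s le_rfl s.coe_nonneg le_rfl
    rw [ht.1.1] at hm
    have h1 := h.energy_nonneg ht.2.1
    have h2 := h.energy_nonneg ht.2.2
    rcases h.cert_split m hs hc' with hc | hc
    · exact hl ht.2.1 (fun v hv => hA v (List.mem_append_left _ hv)) hs hc (by linarith)
    · exact hr ht.2.2 (fun v hv => hA v (List.mem_append_right _ hv)) hs hc (by linarith)

theorem exists_prune_cut {i j : ι} {t : EdgeTree ι i j} {Φ : List Bool → ℝ → Z}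
    (s : ℝ≥0)
    (hs : ∀ s' : ℝ≥0, s' ≤ s → t.Prunes (bot s')) (τ : ℝ) (h0 : 0 ≤ τ) (hτ : τ ≤ s)
    (hB : Φ [] τ ∈ B) :
    ∃ t', t.Prunes t' ∧ (∀ v ∈ t'.bottoms Φ, v.2.2 ∈ B) ∧ (t'.bottoms Φ).length = 1 := by
  refine ⟨bot ⟨τ, h0⟩, hs _ hτ, ?_, rfl⟩
  intro v hv
  rw [List.mem_singleton.mp hv]
  exact hB

/-- The pruning bound for a single branch. -/
theorem exists_prune (h : CountingData Fl f A B V U H Cert Ψ M δ δ') {κ : ℝ}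
    (hκ : 2 * M + 1 ≤ κ * δ) (hκ' : M + 1 ≤ κ * δ') {i j : ι}
    {t : EdgeTree ι i j} {Φ : List Bool → ℝ → Z} {z : Z} (ht : t.FlowsBy Fl Φ z)
    (hA : ∀ v ∈ t.bottoms Φ, v.2.2 ∈ A) :
    ∃ t', t.Prunes t' ∧ (∀ v ∈ t'.bottoms Φ, v.2.2 ∈ B) ∧
      (t.energy f Φ z < δ → ∀ P, z ∈ V P → (t'.bottoms Φ).length ≤ 2 ^ Ψ P i j z) ∧
      (δ ≤ t.energy f Φ z →
        ((t'.bottoms Φ).length : ℝ) ≤ 2 ^ (M + 1) * (κ * t.energy f Φ z - M) ∧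
        ∀ P, z ∈ U P →
          ((t'.bottoms Φ).length : ℝ) ≤
            2 ^ (M + 1) * (κ * t.energy f Φ z - 2 * M + Ψ P i j z)) := by
  have hκ0 : 0 ≤ κ := by
    by_contra! hn
    nlinarith [h.pos, (Nat.cast_nonneg M : (0 : ℝ) ≤ M)]
  have hc1 : (1 : ℝ) ≤ 2 ^ (M + 1) := one_le_pow₀ (by norm_num)
  have hM0 : (0 : ℝ) ≤ M := Nat.cast_nonneg M
  have hcM : (2 : ℝ) * 2 ^ M = 2 ^ (M + 1) := by ring
  -- the case of an edge that meets `B`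
  have cut : ∀ {i j : ι} {t : EdgeTree ι i j} {Φ : List Bool → ℝ → Z} {z : Z},
      (∃ t', t.Prunes t' ∧ (∀ v ∈ t'.bottoms Φ, v.2.2 ∈ B) ∧ (t'.bottoms Φ).length = 1) →
      ∃ t', t.Prunes t' ∧ (∀ v ∈ t'.bottoms Φ, v.2.2 ∈ B) ∧
      (t.energy f Φ z < δ → ∀ P, z ∈ V P → (t'.bottoms Φ).length ≤ 2 ^ Ψ P i j z) ∧
      (δ ≤ t.energy f Φ z →
        ((t'.bottoms Φ).length : ℝ) ≤ 2 ^ (M + 1) * (κ * t.energy f Φ z - M) ∧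
        ∀ P, z ∈ U P →
          ((t'.bottoms Φ).length : ℝ) ≤
            2 ^ (M + 1) * (κ * t.energy f Φ z - 2 * M + Ψ P i j z)) := by
    rintro i j t Φ z ⟨t', h1, h2, h3⟩
    refine ⟨t', h1, h2, fun _ P _ => ?_, fun hE => ⟨?_, fun P _ => ?_⟩⟩
    · rw [h3]; exact Nat.one_le_two_pow
    · rw [h3]
      have := mul_le_mul_of_nonneg_left hE hκ0
      push_cast
      nlinarith
    · rw [h3]
      have := mul_le_mul_of_nonneg_left hE hκ0
      have h4 : (0 : ℝ) ≤ Ψ P i j z := Nat.cast_nonneg _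
      push_cast
      nlinarith
  induction t generalizing Φ z with
  | bot s =>
    exact cut (exists_prune_cut s (fun s' hs' => .cutBot s s' hs') s s.coe_nonneg le_rfl
      (h.subset (hA _ (List.mem_singleton_self _))))
  | split s m l r hl hr =>
    rename_i i j
    -- An edge that meets `B` is cut there and leaves a single vertex. Otherwise the whole edge
    -- avoids `B`, as the fall of the potential requires.
    by_cases hB : ∃ τ, 0 ≤ τ ∧ τ ≤ (s : ℝ) ∧ Φ [] τ ∈ B
    · obtain ⟨τ, h1, h2, h3⟩ := hB
      exact cut (exists_prune_cut s (fun s' hs' => .cutSplit s s' hs' m l r) τ h1 h2 h3)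
    push Not at hB
    have hAl : ∀ v ∈ l.bottoms (fun a => Φ (false :: a)), v.2.2 ∈ A :=
      fun v hv => hA v (List.mem_append_left _ hv)
    have hAr : ∀ v ∈ r.bottoms (fun a => Φ (true :: a)), v.2.2 ∈ A :=
      fun v hv => hA v (List.mem_append_right _ hv)
    obtain ⟨l', hl1, hl2, hl3, hl4⟩ := hl ht.2.1 hAl
    obtain ⟨r', hr1, hr2, hr3, hr4⟩ := hr ht.2.2 hAr
    have hm := h.mono ht.1.2 0 s le_rfl s.coe_nonneg le_rfl
    have hEl := h.energy_nonneg ht.2.1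
    have hEr := h.energy_nonneg ht.2.2
    have hcl := fun P hz => h.le_energy_of_cert ht.2.1 hAl (P := P) hz
    have hcr := fun P hz => h.le_energy_of_cert ht.2.2 hAr (P := P) hz
    have hVl := h.mem_of_energy_lt ht.2.1 hAl
    have hVr := h.mem_of_energy_lt ht.2.2 hAr
    have hEs := energy_split f s m l r Φ z
    have hz : Φ [] 0 = z := ht.1.1
    have hmem : (split s m l r).energy f Φ z < δ → ∀ P, z ∈ V P → ∀ τ, 0 ≤ τ → τ ≤ (s : ℝ) →
      Φ [] τ ∈ V P := fun hE P hP => h.split_edge_mem ht hA hE hP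
    generalize (split s m l r).energy f Φ z = E at hEs hmem ⊢
    generalize l.energy f (fun a => Φ (false :: a)) (Φ [] s) = El at *
    generalize r.energy f (fun a => Φ (true :: a)) (Φ [] s) = Er at *
    refine ⟨split s m l' r', .keep s m hl1 hr1, ?_, ?_, ?_⟩
    · intro v hv
      rcases List.mem_append.mp hv with hv | hv
      exacts [hl2 v hv, hr2 v hv]
    -- Both branches are cheap, hence uncertified, so each serves as the shed branch for the other:
    -- both potentials fall and 2^(Ψ−1) + 2^(Ψ−1) = 2^Ψ.
    · intro hE P hP
      have hV := hmem hE P hP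
      have hs := hV s s.coe_nonneg le_rfl
      rw [hz] at hm
      have hUB : ∀ t, 0 ≤ t → t ≤ (s : ℝ) → Φ [] t ∈ U P ∧ Φ [] t ∉ B :=
        fun t h1 h2 => ⟨h.sub P (hV t h1 h2), hB t h1 h2⟩
      have e1 := h.step_left s.coe_nonneg ht.1.2 P m hUB (fun hc => by linarith [hcl P hs hc])
      have e2 := h.step_right s.coe_nonneg ht.1.2 P m hUB (fun hc => by linarith [hcr P hs hc])
      rw [hz] at e1 e2
      have n1 := hl3 (by linarith) P hs
      have n2 := hr3 (by linarith) P hs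
      have p1 : 2 ^ Ψ P i m (Φ [] s) ≤ 2 ^ (Ψ P i j z - 1) :=
        Nat.pow_le_pow_right (by norm_num) (by omega)
      have p2 : 2 ^ Ψ P m j (Φ [] s) ≤ 2 ^ (Ψ P i j z - 1) :=
        Nat.pow_le_pow_right (by norm_num) (by omega)
      have p3 : 2 ^ Ψ P i j z = 2 * 2 ^ (Ψ P i j z - 1) := by
        rw [← pow_succ']; congr 1; omega
      simp only [bottoms, List.length_append]
      omega
    · intro hE
      simp only [bottoms, List.length_append, Nat.cast_add]
      generalize ((l'.bottoms fun a => Φ (false :: a)).length) = Nl at *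
      generalize ((r'.bottoms fun a => Φ (true :: a)).length) = Nr at *
      rw [hz] at hm
      -- a branch of small energy has few bottom vertices
      have small : ∀ {N n : ℕ}, N ≤ 2 ^ n → n ≤ M → (N : ℝ) ≤ 2 ^ M := by
        intro N n h1 h2
        exact_mod_cast h1.trans (Nat.pow_le_pow_right (by norm_num) h2)
      rcases lt_or_ge El δ with h1 | h1 <;> rcases lt_or_ge Er δ with h2 | h2
      -- Two cheap branches have at most 2 · 2^M vertices together, which κE − 2M ≥ 1 pays for.
      · obtain ⟨P, hP⟩ := hVl h1
        have n1 := small (hl3 h1 P hP) (h.le_bound _ _ _ _)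
        have n2 := small (hr3 h2 P hP) (h.le_bound _ _ _ _)
        have := mul_le_mul_of_nonneg_left hE hκ0
        constructor
        · nlinarith
        · intro P _
          have h4 : (0 : ℝ) ≤ Ψ P i j z := Nat.cast_nonneg _
          nlinarith
      · obtain ⟨P, hP⟩ := hVl h1
        have n1 := small (hl3 h1 P hP) (h.le_bound _ _ _ _)
        obtain ⟨n2, n3⟩ := hr4 h2
        have n4 := n3 P (h.sub P hP)
        -- Since −M = −2M + M, both required bounds have the form κE − 2M + ψ. If the edge stays in
        -- `U P`, shedding the cheap left branch lowers the potential by at least one. If not, the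
        -- edge has entered `V P` from outside `U P`, and κδ' ≥ M + 1 exceeds any potential by one.
        have key : ∀ ψ : ℝ, (ψ = M ∨ ∃ Q, z ∈ U Q ∧ ψ = Ψ Q i j z) →
            1 + Ψ P m j (Φ [] s) ≤ κ * (E - El - Er) + ψ := by
          intro ψ hψ
          have hb : ((Ψ P m j (Φ [] s) : ℕ) : ℝ) ≤ M := by exact_mod_cast h.le_bound P m j _
          by_cases hU : ∀ t, 0 ≤ t → t ≤ (s : ℝ) → Φ [] t ∈ U P
          · have e1 := h.step_left s.coe_nonneg ht.1.2 P m (fun t a b => ⟨hU t a b, hB t a b⟩)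
              (fun hc => by linarith [hcl P hP hc])
            rw [hz] at e1
            have e2 : (1 : ℝ) + Ψ P m j (Φ [] s) ≤ Ψ P i j z := by
              exact_mod_cast (by omega : 1 + Ψ P m j (Φ [] s) ≤ Ψ P i j z)
            have e3 : ((Ψ P i j z : ℕ) : ℝ) ≤ M := by exact_mod_cast h.le_bound P i j _
            have e4 : 0 ≤ κ * (E - El - Er) := mul_nonneg hκ0 (by linarith)
            rcases hψ with rfl | ⟨Q, hQ, rfl⟩
            · linarith
            · have : Q = P := by
                refine h.disj Q P z hQ ?_
                rw [← hz]
                exact hU 0 le_rfl s.coe_nonneg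
              rw [this]; linarith
          · push Not at hU
            obtain ⟨t, t1, t2, t3⟩ := hU
            have e1 := h.enter ht.1.2 P t t1 t2 t3 hP
            rw [hz] at e1
            have e2 := mul_le_mul_of_nonneg_left e1 hκ0
            have e3 : 0 ≤ ψ := by
              rcases hψ with rfl | ⟨Q, hQ, rfl⟩
              exacts [hM0, Nat.cast_nonneg _]
            have e4 : κ * (E - El - Er) = κ * (f i z - f j z - (f i (Φ [] ↑s) - f j (Φ [] ↑s))) := by
              rw [hEs]; ring
            linarith
        -- The unit gained is worth 2^(M+1), more than the at most 2^M vertices of the cheap branch.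
        have fin : ∀ ψ : ℝ, 1 + Ψ P m j (Φ [] s) ≤ κ * (E - El - Er) + ψ →
            (Nl : ℝ) + Nr ≤ 2 ^ (M + 1) * (κ * E - 2 * M + ψ) := by
          intro ψ hψ
          have e1 : 0 ≤ κ * El := mul_nonneg hκ0 hEl
          have e2 : (2 : ℝ) ^ (M + 1) * (κ * Er - 2 * M + Ψ P m j (Φ [] s)) ≤
              2 ^ (M + 1) * (κ * E - 2 * M + ψ - 1) :=
            mul_le_mul_of_nonneg_left (by nlinarith) (by positivity)
          nlinarith
        constructor
        · have := fin M (key M (Or.inl rfl))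
          convert this using 2; ring
        · exact fun Q hQ => fin _ (key _ (Or.inr ⟨Q, hQ, rfl⟩))
      · obtain ⟨P, hP⟩ := hVr h2
        have n1 := small (hr3 h2 P hP) (h.le_bound _ _ _ _)
        obtain ⟨n2, n3⟩ := hl4 h1
        have n4 := n3 P (h.sub P hP)
        have key : ∀ ψ : ℝ, (ψ = M ∨ ∃ Q, z ∈ U Q ∧ ψ = Ψ Q i j z) →
            1 + Ψ P i m (Φ [] s) ≤ κ * (E - El - Er) + ψ := by
          intro ψ hψ
          have hb : ((Ψ P i m (Φ [] s) : ℕ) : ℝ) ≤ M := by exact_mod_cast h.le_bound P i m _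
          by_cases hU : ∀ t, 0 ≤ t → t ≤ (s : ℝ) → Φ [] t ∈ U P
          · have e1 := h.step_right s.coe_nonneg ht.1.2 P m (fun t a b => ⟨hU t a b, hB t a b⟩)
              (fun hc => by linarith [hcr P hP hc])
            rw [hz] at e1
            have e2 : (1 : ℝ) + Ψ P i m (Φ [] s) ≤ Ψ P i j z := by
              exact_mod_cast (by omega : 1 + Ψ P i m (Φ [] s) ≤ Ψ P i j z)
            have e3 : ((Ψ P i j z : ℕ) : ℝ) ≤ M := by exact_mod_cast h.le_bound P i j _
            have e4 : 0 ≤ κ * (E - El - Er) := mul_nonneg hκ0 (by linarith)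
            rcases hψ with rfl | ⟨Q, hQ, rfl⟩
            · linarith
            · have : Q = P := by
                refine h.disj Q P z hQ ?_
                rw [← hz]
                exact hU 0 le_rfl s.coe_nonneg
              rw [this]; linarith
          · push Not at hU
            obtain ⟨t, t1, t2, t3⟩ := hU
            have e1 := h.enter ht.1.2 P t t1 t2 t3 hP
            rw [hz] at e1
            have e2 := mul_le_mul_of_nonneg_left e1 hκ0
            have e3 : 0 ≤ ψ := by
              rcases hψ with rfl | ⟨Q, hQ, rfl⟩
              exacts [hM0, Nat.cast_nonneg _]
            have e4 : κ * (E - El - Er) = κ * (f i z - f j z - (f i (Φ [] ↑s) - f j (Φ [] ↑s))) := by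
              rw [hEs]; ring
            linarith
        have fin : ∀ ψ : ℝ, 1 + Ψ P i m (Φ [] s) ≤ κ * (E - El - Er) + ψ →
            (Nl : ℝ) + Nr ≤ 2 ^ (M + 1) * (κ * E - 2 * M + ψ) := by
          intro ψ hψ
          have e1 : 0 ≤ κ * Er := mul_nonneg hκ0 hEr
          have e2 : (2 : ℝ) ^ (M + 1) * (κ * El - 2 * M + Ψ P i m (Φ [] s)) ≤
              2 ^ (M + 1) * (κ * E - 2 * M + ψ - 1) :=
            mul_le_mul_of_nonneg_left (by nlinarith) (by positivity)
          nlinarith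
        constructor
        · have := fin M (key M (Or.inl rfl))
          convert this using 2; ring
        · exact fun Q hQ => fin _ (key _ (Or.inr ⟨Q, hQ, rfl⟩))
      -- For two expensive branches the constants −M add up to −2M, which implies both bounds
      -- whatever the potential is.
      · have n1 := (hl4 h1).1
        have n2 := (hr4 h2).1
        have e1 : κ * (El + Er) ≤ κ * E := mul_le_mul_of_nonneg_left (by linarith) hκ0
        have e2 : (Nl : ℝ) + Nr ≤ 2 ^ (M + 1) * (κ * E - 2 * M) := by nlinarith
        constructor
        · nlinarith
        · intro P _
          have h4 : (0 : ℝ) ≤ Ψ P i j z := Nat.cast_nonneg _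
          nlinarith

end CountingData

end EdgeTree

/-! ## Finite sets of directions in the plane -/

section Directions

open scoped RealInnerProductSpace

theorem dense_inner_ne_zero {d : ℂ} (hd : d ≠ 0) : Dense {n : ℂ | ⟪n, d⟫ ≠ 0} := by
  intro n
  have h1 : Filter.Tendsto (fun s : ℝ => n + s • d) (𝓝[≠] 0) (𝓝 n) := by
    have : Filter.Tendsto (fun s : ℝ => n + s • d) (𝓝 0) (𝓝 (n + (0 : ℝ) • d)) :=
      (Continuous.tendsto (by fun_prop) 0)
    rw [zero_smul, add_zero] at this
    exact this.mono_left nhdsWithin_le_nhds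
  refine mem_closure_of_tendsto h1 ?_
  have hdd : 0 < ⟪d, d⟫ := real_inner_self_pos.mpr hd
  have h2 : ∀ s : ℝ, ⟪n + s • d, d⟫ = ⟪n, d⟫ + s * ⟪d, d⟫ := fun s => by
    rw [inner_add_left, real_inner_smul_left]
  by_cases h : ⟪n, d⟫ = 0
  · filter_upwards [self_mem_nhdsWithin] with s hs
    rw [h2, h, zero_add]
    exact mul_ne_zero hs hdd.ne'
  · have h3 : Filter.Tendsto (fun s : ℝ => ⟪n + s • d, d⟫) (𝓝[≠] 0) (𝓝 ⟪n, d⟫) :=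
      ((continuous_id.inner continuous_const).tendsto n).comp h1
    exact h3.eventually_ne h

/-- For distinct unit vectors, a − b is positive on a and negative on b. This is an open condition
on n, so n can be moved off the finitely many lines orthogonal to vectors of `D`. Pairs at distance
at least τ form a compact set, so finitely many n and one κ suffice; adjoining negatives makes the
set symmetric. -/
theorem exists_separating_directions (D : Finset ℂ) (hD : ∀ d ∈ D, d ≠ 0) {τ : ℝ} (hτ : 0 < τ) :
    ∃ (N : Finset ℂ) (κ : ℝ), 0 < κ ∧ (∀ n ∈ N, -n ∈ N) ∧ (∀ n ∈ N, ∀ d ∈ D, ⟪n, d⟫ ≠ 0) ∧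
      ∀ a b : ℂ, ‖a‖ = 1 → ‖b‖ = 1 → τ ≤ ‖a - b‖ → ∃ n ∈ N, κ ≤ ⟪n, a⟫ ∧ ⟪n, b⟫ ≤ -κ := by
  classical
  have hgen : Dense (⋂ d ∈ (D : Set ℂ), {n : ℂ | ⟪n, d⟫ ≠ 0}) :=
    dense_biInter_of_isOpen
      (fun d _ => isOpen_ne_fun (continuous_id.inner continuous_const) continuous_const)
      D.countable_toSet (fun d hd => dense_inner_ne_zero (hD d hd))
  set K : Set (ℂ × ℂ) := {x | ‖x.1‖ = 1 ∧ ‖x.2‖ = 1 ∧ τ ≤ ‖x.1 - x.2‖} with hK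
  have hKc : IsCompact K := by
    refine ((isCompact_closedBall (0 : ℂ) 1).prod (isCompact_closedBall (0 : ℂ) 1)).of_isClosed_subset
      ?_ ?_
    · exact (isClosed_eq continuous_fst.norm continuous_const).and
        ((isClosed_eq continuous_snd.norm continuous_const).and
          (isClosed_le continuous_const (continuous_fst.sub continuous_snd).norm))
    · rintro ⟨a, b⟩ ⟨h1, h2, -⟩
      simp only [Set.mem_prod, mem_closedBall_zero_iff]
      exact ⟨h1.le, h2.le⟩
  have hcov : ∀ x ∈ K, ∃ i : ℂ × ℝ, (0 < i.2 ∧ ∀ d ∈ D, ⟪i.1, d⟫ ≠ 0) ∧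
      i.2 < ⟪i.1, x.1⟫ ∧ ⟪i.1, x.2⟫ < -i.2 := by
    rintro ⟨a, b⟩ ⟨ha, hb, hab⟩
    simp only at ha hb hab
    have hne : a ≠ b := by
      rintro rfl
      simp at hab
      linarith
    have hlt : ⟪a, b⟫ < 1 := by
      exact (inner_lt_one_iff_real_of_norm_eq_one ha hb).mpr hne
    have hopen : IsOpen {n : ℂ | 0 < ⟪n, a⟫ ∧ ⟪n, b⟫ < 0} :=
      (isOpen_lt continuous_const (continuous_id.inner continuous_const)).and
        (isOpen_lt (continuous_id.inner continuous_const) continuous_const)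
    obtain ⟨n, hn1, hn2⟩ := hgen.inter_open_nonempty _ hopen ⟨a - b, by
      simp only [Set.mem_ofPred_eq, inner_sub_left, real_inner_self_eq_norm_sq, ha, hb,
        real_inner_comm a b]
      constructor <;> linarith⟩
    refine ⟨(n, min ⟪n, a⟫ (-⟪n, b⟫) / 2), ⟨?_, ?_⟩, ?_, ?_⟩
    · have : 0 < min ⟪n, a⟫ (-⟪n, b⟫) := lt_min hn1.1 (by linarith [hn1.2])
      simp only; linarith
    · simpa using hn2
    · have : 0 < min ⟪n, a⟫ (-⟪n, b⟫) := lt_min hn1.1 (by linarith [hn1.2])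
      have h2 := min_le_left ⟪n, a⟫ (-⟪n, b⟫)
      simp only; linarith
    · have : 0 < min ⟪n, a⟫ (-⟪n, b⟫) := lt_min hn1.1 (by linarith [hn1.2])
      have h2 := min_le_right ⟪n, a⟫ (-⟪n, b⟫)
      simp only; linarith
  obtain ⟨t, ht⟩ := hKc.elim_finite_subcover
    (fun i : {i : ℂ × ℝ // 0 < i.2 ∧ ∀ d ∈ D, ⟪i.1, d⟫ ≠ 0} =>
      {x : ℂ × ℂ | i.1.2 < ⟪i.1.1, x.1⟫ ∧ ⟪i.1.1, x.2⟫ < -i.1.2})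
    (fun i => (isOpen_lt continuous_const (continuous_const.inner continuous_fst)).and
        (isOpen_lt (continuous_const.inner continuous_snd) continuous_const))
    (fun x hx => by
      obtain ⟨i, hi, h⟩ := hcov x hx
      exact Set.mem_iUnion.mpr ⟨⟨i, hi⟩, h⟩)
  obtain ⟨κ, hκ, hκt⟩ : ∃ κ : ℝ, 0 < κ ∧ ∀ i ∈ t, κ ≤ i.1.2 := by
    rcases t.eq_empty_or_nonempty with rfl | hne
    · exact ⟨1, one_pos, by simp⟩
    · exact ⟨t.inf' hne fun i => i.1.2, (Finset.lt_inf'_iff _).mpr fun i _ => i.2.1,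
        fun i hi => Finset.inf'_le _ hi⟩
  refine ⟨t.image (fun i => i.1.1) ∪ t.image (fun i => -i.1.1), κ, hκ, ?_, ?_, ?_⟩
  · intro n hn
    simp only [Finset.mem_union, Finset.mem_image] at hn ⊢
    rcases hn with ⟨i, hi, rfl⟩ | ⟨i, hi, rfl⟩
    · exact Or.inr ⟨i, hi, rfl⟩
    · exact Or.inl ⟨i, hi, by simp⟩
  · intro n hn d hd
    simp only [Finset.mem_union, Finset.mem_image] at hn
    rcases hn with ⟨i, hi, rfl⟩ | ⟨i, hi, rfl⟩
    · exact i.2.2 d hd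
    · rw [inner_neg_left]
      exact neg_ne_zero.mpr (i.2.2 d hd)
  · intro a b ha hb hab
    obtain ⟨i, hi⟩ := Set.mem_iUnion.mp (ht (show (a, b) ∈ K from ⟨ha, hb, hab⟩))
    obtain ⟨hit, h1, h2⟩ := Set.mem_iUnion.mp hi
    have := hκt i hit
    simp only at h1 h2
    exact ⟨i.1.1, Finset.mem_union_left _ (Finset.mem_image_of_mem _ hit), by linarith, by linarith⟩

theorem norm_normalize {z : ℂ} (hz : z ≠ 0) : ‖(‖z‖⁻¹ : ℝ) • z‖ = 1 := by
  rw [norm_smul, norm_inv, norm_norm, inv_mul_cancel₀ (norm_ne_zero_iff.mpr hz)]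

/-- A finite symmetric set of directions `n`, transverse to the vectors of `D`, that separates
rays with an angle at least `τ`, and that detects a vector `o` of `D` not directed against `z`, or
else the turn from `v = o + v'` to `v'`. -/
structure IsDirectionSet (D : Finset ℂ) (τ : ℝ) (N : Finset ℂ) (κ : ℝ) : Prop where
  pos : 0 < κ
  neg_mem : ∀ n ∈ N, -n ∈ N
  ne_zero : ∀ n ∈ N, ∀ d ∈ D, ⟪n, d⟫ ≠ 0
  separates : ∀ a b : ℂ, a ≠ 0 → b ≠ 0 → τ ≤ ‖(‖a‖⁻¹ : ℝ) • a - (‖b‖⁻¹ : ℝ) • b‖ →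
    ∃ n ∈ N, κ * ‖a‖ ≤ ⟪n, a⟫ ∧ ⟪n, b⟫ ≤ -(κ * ‖b‖)
  turns : ∀ v ∈ D, ∀ v' ∈ D, ∀ o ∈ D, v = o + v' → ¬ SameRay ℝ v v' → ∀ z : ℂ, z ≠ 0 →
    (∃ n ∈ N, κ * ‖z‖ ≤ ⟪n, z⟫ ∧ 0 < ⟪n, o⟫) ∨
      ∃ n ∈ N, κ * ‖z‖ ≤ ⟪n, z⟫ ∧ ⟪n, v⟫ < 0 ∧ 0 < ⟪n, v'⟫

theorem le_inner_of_le_normalize {n z : ℂ} {κ : ℝ} (hz : z ≠ 0)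
    (h : κ ≤ ⟪n, (‖z‖⁻¹ : ℝ) • z⟫) : κ * ‖z‖ ≤ ⟪n, z⟫ := by
  rw [real_inner_smul_right] at h
  have hp : 0 < ‖z‖ := norm_pos_iff.mpr hz
  rwa [inv_mul_eq_div, le_div_iff₀ hp] at h

theorem inner_le_of_normalize_le {n z : ℂ} {κ : ℝ} (hz : z ≠ 0)
    (h : ⟪n, (‖z‖⁻¹ : ℝ) • z⟫ ≤ -κ) : ⟪n, z⟫ ≤ -(κ * ‖z‖) := by
  rw [real_inner_smul_right] at h
  have hp : 0 < ‖z‖ := norm_pos_iff.mpr hz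
  rw [inv_mul_eq_div, div_le_iff₀ hp] at h
  linarith

/-- Two scales are needed. `N₁` separates the rays of `D` that differ from each other. `N₂` is fine
enough to separate z from −o unless z is so close to the ray of −o = v' − v that a direction of
`N₁`, positive on v' and negative on v, is still positive on z. -/
theorem exists_isDirectionSet (D : Finset ℂ) (hD : ∀ d ∈ D, d ≠ 0) {τ : ℝ} (hτ : 0 < τ) :
    ∃ N κ, IsDirectionSet D τ N κ := by
  classical
  obtain ⟨τ₁, hτ₁, hsep⟩ : ∃ τ₁ : ℝ, 0 < τ₁ ∧ ∀ v ∈ D, ∀ v' ∈ D, ¬ SameRay ℝ v v' →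
      τ₁ ≤ ‖(‖v'‖⁻¹ : ℝ) • v' - (‖v‖⁻¹ : ℝ) • v‖ := by
    set E := (D ×ˢ D).filter fun x => ¬ SameRay ℝ x.1 x.2
    set F : ℂ × ℂ → ℝ := fun x => ‖(‖x.2‖⁻¹ : ℝ) • x.2 - (‖x.1‖⁻¹ : ℝ) • x.1‖
    have hF : ∀ x ∈ E, 0 < F x := by
      intro x hx
      have hx := Finset.mem_filter.mp hx
      rw [Finset.mem_product] at hx
      refine norm_pos_iff.mpr (sub_ne_zero.mpr fun h => hx.2 ?_)
      exact (sameRay_iff_inv_norm_smul_eq_of_ne (hD _ hx.1.1) (hD _ hx.1.2)).mpr h.symm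
    have hE : ∀ v ∈ D, ∀ v' ∈ D, ¬ SameRay ℝ v v' → (v, v') ∈ E := fun v hv v' hv' h => by
      exact Finset.mem_filter.mpr ⟨Finset.mem_product.mpr ⟨hv, hv'⟩, h⟩
    rcases E.eq_empty_or_nonempty with he | hne
    · exact ⟨1, one_pos, fun v hv v' hv' h => by simpa [he] using hE v hv v' hv' h⟩
    · exact ⟨E.inf' hne F, (Finset.lt_inf'_iff _).mpr hF,
        fun v hv v' hv' h => Finset.inf'_le F (hE v hv v' hv' h)⟩
  obtain ⟨N₁, κ₁, hκ₁, hs₁, hg₁, hN₁⟩ := exists_separating_directions D hD hτ₁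
  obtain ⟨L, hL, hLN⟩ : ∃ L : ℝ, 0 < L ∧ ∀ n ∈ N₁, ‖n‖ ≤ L := by
    refine ⟨∑ n ∈ N₁, ‖n‖ + 1, by positivity, fun n hn => ?_⟩
    have := Finset.single_le_sum (f := fun n : ℂ => ‖n‖) (fun n _ => norm_nonneg n) hn
    linarith
  -- Vectors of `N₁` have norm at most L, so moving a unit vector by κ₁ / (2L) changes its pairing
  -- with them by at most κ₁ / 2.
  have hτ₂ : 0 < min τ (κ₁ / (2 * L)) := lt_min hτ (by positivity)
  obtain ⟨N₂, κ₂, hκ₂, hs₂, hg₂, hN₂⟩ := exists_separating_directions D hD hτ₂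
  refine ⟨N₁ ∪ N₂, min (κ₁ / 2) κ₂, lt_min (by positivity) hκ₂, ?_, ?_, ?_, ?_⟩
  · intro n hn
    rcases Finset.mem_union.mp hn with h | h
    exacts [Finset.mem_union_left _ (hs₁ n h), Finset.mem_union_right _ (hs₂ n h)]
  · intro n hn
    rcases Finset.mem_union.mp hn with h | h
    exacts [hg₁ n h, hg₂ n h]
  · intro a b ha hb hab
    obtain ⟨n, hn, h1, h2⟩ := hN₂ _ _ (norm_normalize ha) (norm_normalize hb)
      ((min_le_left _ _).trans hab)
    have := min_le_right (κ₁ / 2) κ₂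
    exact ⟨n, Finset.mem_union_right _ hn, le_inner_of_le_normalize ha (by linarith),
      inner_le_of_normalize_le hb (by linarith)⟩
  · intro v hv v' hv' o ho hvo hray z hz
    have hmin := min_le_left (κ₁ / 2) κ₂
    have hmin' := min_le_right (κ₁ / 2) κ₂
    have hz1 := norm_normalize hz
    have ho0 := hD o ho
    by_cases hc : min τ (κ₁ / (2 * L)) ≤ ‖(‖z‖⁻¹ : ℝ) • z - (‖-o‖⁻¹ : ℝ) • (-o)‖
    · left
      obtain ⟨n, hn, h1, h2⟩ := hN₂ _ _ hz1 (norm_normalize (neg_ne_zero.mpr ho0)) hc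
      refine ⟨n, Finset.mem_union_right _ hn, le_inner_of_le_normalize hz (by linarith), ?_⟩
      have h3 := inner_le_of_normalize_le (neg_ne_zero.mpr ho0) h2
      rw [inner_neg_right, norm_neg] at h3
      have : 0 < κ₂ * ‖o‖ := mul_pos hκ₂ (norm_pos_iff.mpr ho0)
      linarith
    · right
      push Not at hc
      have hv0 := hD v hv
      have hv'0 := hD v' hv'
      obtain ⟨n, hn, h1, h2⟩ := hN₁ _ _ (norm_normalize hv'0) (norm_normalize hv0)
        (hsep v hv v' hv' hray)
      have h3 := le_inner_of_le_normalize hv'0 h1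
      have h4 := inner_le_of_normalize_le hv0 h2
      have p1 : 0 < κ₁ * ‖v‖ := mul_pos hκ₁ (norm_pos_iff.mpr hv0)
      have p2 : 0 < κ₁ * ‖v'‖ := mul_pos hκ₁ (norm_pos_iff.mpr hv'0)
      refine ⟨n, Finset.mem_union_left _ hn, le_inner_of_le_normalize hz ?_, by linarith,
        by linarith⟩
      -- The pairing of n with v' − v is at least κ₁(‖v'‖ + ‖v‖), and ‖o‖ is at most that sum of
      -- norms.
      have h5 : κ₁ ≤ ⟪n, (‖-o‖⁻¹ : ℝ) • (-o)⟫ := by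
        have ho' : -o = v' - v := by rw [hvo]; ring
        have hp : 0 < ‖-o‖ := norm_pos_iff.mpr (neg_ne_zero.mpr ho0)
        rw [real_inner_smul_right, inv_mul_eq_div, le_div_iff₀ hp, ho', inner_sub_right]
        have : ‖v' - v‖ ≤ ‖v'‖ + ‖v‖ := norm_sub_le _ _
        nlinarith
      have h6 : ⟪n, (‖z‖⁻¹ : ℝ) • z⟫ = ⟪n, (‖-o‖⁻¹ : ℝ) • (-o)⟫ +
          ⟪n, (‖z‖⁻¹ : ℝ) • z - (‖-o‖⁻¹ : ℝ) • (-o)⟫ := by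
        rw [inner_sub_right]; ring
      have h7 := abs_le.mp (abs_real_inner_le_norm n
        ((‖z‖⁻¹ : ℝ) • z - (‖-o‖⁻¹ : ℝ) • (-o)))
      have h8 : ‖n‖ * ‖(‖z‖⁻¹ : ℝ) • z - (‖-o‖⁻¹ : ℝ) • (-o)‖ ≤ κ₁ / 2 := by
        have h9 := hc.le.trans (min_le_right _ _)
        calc _ ≤ L * (κ₁ / (2 * L)) :=
              mul_le_mul (hLN n hn) h9 (norm_nonneg _) hL.le
          _ = κ₁ / 2 := by field_simp
      linarith [h7.1]

end Directions

/-! ## Certificates and potentials near a turning point -/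

section Certificates

open scoped RealInnerProductSpace

variable {ι : Type*}

/-- At most one value is taken twice, and no value three times. -/
def HasSinglePair (B : ι → ℂ) : Prop :=
  ∀ k l k' l', k ≠ l → B k = B l → k' ≠ l' → B k' = B l' →
    (k' = k ∧ l' = l) ∨ (k' = l ∧ l' = k)

/-- The position `ζ` and the values `G` are far from the turning point. -/
def IsFar (B : ι → ℂ) (Λ e e' : ℝ) (ζ : ℂ) (G : ι → ℂ) : Prop :=
  Λ * e ≤ ‖ζ‖ ∧ ∀ k l, k ≠ l → B k = B l → Λ * e' ≤ ‖G k - G l‖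

/-- A sufficient condition for a flowing tree, whose first edge has indices `i, j` and starts at
the position `ζ` with the values `G` of the integrals, not to end at the turning point. -/
def IsCertified (B : ι → ℂ) (N : Finset ℂ) (Λ e e' : ℝ) (i j : ι) (ζ : ℂ) (G : ι → ℂ) : Prop :=
  (B i ≠ B j ∧ ∃ n ∈ N, 0 < ⟪n, B i - B j⟫ ∧ e < ⟪n, ζ⟫) ∨
    (B i = B j ∧ i ≠ j ∧ (e' < |(G i - G j).im| ∨ (G i - G j).re < -e')) ∨
    (i = j ∧ IsFar B Λ e e' ζ G)

open scoped Classical in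
/-- The directions in which an edge with indices `i, j` moves away from the turning point. -/
noncomputable def escapeSet (B : ι → ℂ) (N : Finset ℂ) (e : ℝ) (i j : ι) (ζ : ℂ) : Finset ℂ :=
  N.filter fun n => 0 < ⟪n, B i - B j⟫ ∧ e < ⟪n, ζ⟫

/-- The next merging branch can split off from an edge with indices `i, j`. -/
def CanShed (B : ι → ℂ) (i j : ι) (G : ι → ℂ) : Prop :=
  (∃ k, k ≠ j ∧ B k = B j ∧ 0 < (G k - G j).re) ∨ ∃ k, k ≠ i ∧ B i = B k ∧ 0 < (G i - G k).re

open scoped Classical in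
/-- The potential, which decreases whenever a branch without certificate splits off. -/
noncomputable def sheddingPotential (B : ι → ℂ) (N : Finset ℂ) (e : ℝ) (i j : ι) (ζ : ℂ)
    (G : ι → ℂ) : ℕ :=
  -- An escape direction is worth 8. The three values for B i = B j lie strictly between the largest
  -- value with one escape direction, 8|N| − 7, and the smallest with none, 8|N|. Among these three,
  -- shedding a merging branch leads from −3 (a merging pair with positive real part) to −4 (a
  -- constant edge), and from −4 to −5 (the pair in the opposite order). The final unit records a
  -- merging branch that can still be shed.
  if B i = B j then
    if i = j then 8 * N.card - 4 else if 0 < (G i - G j).re then 8 * N.card - 3 else 8 * N.card - 5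
  else 8 * (N.card - (escapeSet B N e i j ζ).card) + if CanShed B i j G then 1 else 0

variable {B : ι → ℂ} {N : Finset ℂ} {Λ e e' τ κ : ℝ} {i j m : ι} {ζ ζ₀ : ℂ} {G G₀ : ι → ℂ}

theorem mem_escapeSet {n : ℂ} :
    n ∈ escapeSet B N e i j ζ ↔ n ∈ N ∧ 0 < ⟪n, B i - B j⟫ ∧ e < ⟪n, ζ⟫ := by
  classical
  exact Finset.mem_filter

theorem escapeSet_subset : escapeSet B N e i j ζ ⊆ N := fun _ hn => (mem_escapeSet.mp hn).1

theorem sheddingPotential_le : sheddingPotential B N e i j ζ G ≤ 8 * N.card + 1 := by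
  unfold sheddingPotential
  split_ifs <;> omega

theorem isFar_neg : IsFar (-B) Λ e e' ζ (-G) ↔ IsFar B Λ e e' ζ G := by
  have h : ∀ k l, ‖(-G) k - (-G) l‖ = ‖G k - G l‖ := fun k l => by
    rw [Pi.neg_apply, Pi.neg_apply, neg_sub_neg, norm_sub_rev]
  unfold IsFar
  simp only [h]
  simp only [Pi.neg_apply, neg_inj]

/-- Orientation reversal. -/
theorem isCertified_neg :
    IsCertified (-B) N Λ e e' j i ζ (-G) ↔ IsCertified B N Λ e e' i j ζ G := by
  simp only [IsCertified, isFar_neg]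
  simp only [Pi.neg_apply, neg_sub_neg, neg_inj, ne_eq, eq_comm (a := j), eq_comm (a := B j)]

theorem escapeSet_neg : escapeSet (-B) N e j i ζ = escapeSet B N e i j ζ := by
  ext n
  simp only [mem_escapeSet, Pi.neg_apply, neg_sub_neg]

theorem canShed_neg : CanShed (-B) j i (-G) ↔ CanShed B i j G := by
  simp only [CanShed, Pi.neg_apply, neg_sub_neg, neg_inj]
  rw [or_comm]
  simp only [eq_comm]

theorem sheddingPotential_neg :
    sheddingPotential (-B) N e j i ζ (-G) = sheddingPotential B N e i j ζ G := by
  classical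
  unfold sheddingPotential
  have hs : (if CanShed (-B) j i (-G) then 1 else 0) = if CanShed B i j G then 1 else 0 :=
    if_congr canShed_neg rfl rfl
  rw [escapeSet_neg]
  simp only [Pi.neg_apply, neg_sub_neg, neg_inj, eq_comm (a := j), eq_comm (a := B j)]
  congr 2

/-- The unit vectors of ζ and −ζ are at distance 2 ≥ τ, so a separating direction has pairing at
least κ‖ζ‖ ≥ κΛe > e with ζ. -/
theorem exists_lt_inner {D : Finset ℂ} (hN : IsDirectionSet D τ N κ) (hτ : τ ≤ 2) (he : 0 < e)
    (hκ : 1 < κ * Λ) (hζ : Λ * e ≤ ‖ζ‖) : ∃ n ∈ N, e < ⟪n, ζ⟫ := by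
  have hΛ : 0 < Λ := by
    by_contra! h
    nlinarith [hN.pos]
  have hz : ζ ≠ 0 := by
    rw [← norm_pos_iff]
    exact (mul_pos hΛ he).trans_le hζ
  obtain ⟨n, hn, h1, -⟩ := hN.separates ζ (-ζ) hz (neg_ne_zero.mpr hz) (by
    rw [norm_neg, smul_neg, sub_neg_eq_add, ← two_smul ℝ, norm_smul, norm_normalize hz]
    simpa using hτ)
  refine ⟨n, hn, lt_of_lt_of_le ?_ h1⟩
  nlinarith [hN.pos]

/-- A direction positive on B_i − B_j is positive on B_i − B_m or on B_m − B_j. If B_i = B_j ≠ B_m,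
the children drift in opposite directions, and any n with ⟨n, ζ⟩ > e certifies one of them; `hlink`
supplies such an n from a large integral. If a constant edge splits into the merging pair and its
reverse, the two integrals are opposite and too large for both to lack a certificate. -/
theorem IsCertified.split {D : Finset ℂ} (hN : IsDirectionSet D τ N κ) (hτ : τ ≤ 2)
    (hD : ∀ k l, B k ≠ B l → B k - B l ∈ D) (he : 0 < e) (he' : 0 < e')
    (hκ : 1 < κ * Λ) (hΛ : 2 < Λ)
    (hB : HasSinglePair B)
    (hlink : ∀ k l, k ≠ l → B k = B l → e' < ‖G k - G l‖ → Λ * e ≤ ‖ζ‖)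
    (h : IsCertified B N Λ e e' i j ζ G) (m : ι) :
    IsCertified B N Λ e e' i m ζ G ∨ IsCertified B N Λ e e' m j ζ G := by
  -- both branches are non-trivial, with opposite directions
  have opp : B i = B j → B i ≠ B m → Λ * e ≤ ‖ζ‖ →
      IsCertified B N Λ e e' i m ζ G ∨ IsCertified B N Λ e e' m j ζ G := by
    intro hij him hζ
    obtain ⟨n, hn, h1⟩ := exists_lt_inner hN hτ he hκ hζ
    rcases lt_or_gt_of_ne (hN.ne_zero n hn _ (hD i m him)) with h2 | h2
    · refine Or.inr (Or.inl ⟨by rw [← hij]; exact him.symm, n, hn, ?_, h1⟩)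
      rw [← hij, ← neg_sub, inner_neg_right]
      linarith
    · exact Or.inl (Or.inl ⟨him, n, hn, h2, h1⟩)
  rcases h with ⟨hij, n, hn, h1, h2⟩ | ⟨hij, hne, h⟩ | ⟨rfl, h⟩
  · by_cases him : B i = B m
    · exact Or.inr (Or.inl ⟨him ▸ hij, n, hn, him ▸ h1, h2⟩)
    · by_cases hmj : B m = B j
      · exact Or.inl (Or.inl ⟨him, n, hn, hmj ▸ h1, h2⟩)
      · have h3 : ⟪n, B i - B j⟫ = ⟪n, B i - B m⟫ + ⟪n, B m - B j⟫ := by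
          rw [← inner_add_right]; congr 1; ring
        rcases lt_or_ge 0 ⟪n, B i - B m⟫ with h4 | h4
        · exact Or.inl (Or.inl ⟨him, n, hn, h4, h2⟩)
        · exact Or.inr (Or.inl ⟨hmj, n, hn, by linarith, h2⟩)
  · by_cases hmi : m = i
    · subst hmi; exact Or.inr (Or.inr (Or.inl ⟨hij, hne, h⟩))
    by_cases hmj : m = j
    · subst hmj; exact Or.inl (Or.inr (Or.inl ⟨hij, hne, h⟩))
    have hnorm : e' < ‖G i - G j‖ := by
      rcases h with h | h
      · exact h.trans_le (Complex.abs_im_le_norm _)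
      · have := abs_le.mp (Complex.abs_re_le_norm (G i - G j))
        linarith [this.1]
    by_cases him : B i = B m
    · rcases hB i j i m hne hij (Ne.symm hmi) him with h | h
      exacts [absurd h.2 hmj, absurd h.2 hmi]
    · exact opp hij him (hlink i j hne hij hnorm)
  · by_cases hmi : m = i
    · subst hmi; exact Or.inr (Or.inr (Or.inr ⟨rfl, h⟩))
    by_cases him : B i = B m
    · have h1 := h.2 i m (Ne.symm hmi) him
      by_cases h2 : IsCertified B N Λ e e' i m ζ G
      · exact Or.inl h2
      refine Or.inr (Or.inr (Or.inl ⟨him.symm, hmi, ?_⟩))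
      have h3 : ¬ (e' < |(G i - G m).im| ∨ (G i - G m).re < -e') := fun h4 =>
        h2 (Or.inr (Or.inl ⟨him, Ne.symm hmi, h4⟩))
      push Not at h3
      right
      have h5 := Complex.norm_le_abs_re_add_abs_im (G i - G m)
      have h6 : (G m - G i).re = -(G i - G m).re := by simp
      rw [h6]
      by_contra! h7
      have : |(G i - G m).re| ≤ e' := abs_le.mpr ⟨h3.2, by linarith⟩
      nlinarith
    · exact opp rfl him h.1

/-- The norm of the integral is at least Λe' > 2e', so if the imaginary part is at most e' in
absolute value and the real part at least −e', the real part cannot be non-positive. -/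
theorem IsFar.not_isCertified_re_pos (hfar : IsFar B Λ e e' ζ G) (he' : 0 < e') (hΛ : 2 < Λ)
    (hij : B i = B j) (hne : i ≠ j) (hc : ¬ IsCertified B N Λ e e' i j ζ G) :
    |(G i - G j).im| ≤ e' ∧ 0 < (G i - G j).re := by
  have h : ¬ (e' < |(G i - G j).im| ∨ (G i - G j).re < -e') :=
    fun h => hc (Or.inr (Or.inl ⟨hij, hne, h⟩))
  push Not at h
  refine ⟨h.1, ?_⟩
  by_contra! h1
  have h2 := hfar.2 i j hne hij
  have h3 := Complex.norm_le_abs_re_add_abs_im (G i - G j)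
  have : |(G i - G j).re| ≤ e' := abs_le.mpr ⟨h.2, by linarith⟩
  nlinarith [h.1]

theorem escapeSet_eq_empty (hij : B i ≠ B j) (hc : ¬ IsCertified B N Λ e e' i j ζ G) :
    escapeSet B N e i j ζ = ∅ := by
  refine Finset.eq_empty_of_forall_notMem fun n hn => ?_
  obtain ⟨h1, h2, h3⟩ := mem_escapeSet.mp hn
  exact hc (Or.inl ⟨hij, n, h1, h2, h3⟩)

/-- Escape directions persist along the edge. If the shed branch i, m and the rest m, j both drift,
each old escape direction survives, since otherwise it would certify i, m; and `turns` yields a new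
one, its other alternative being again a certificate for i, m. If i, m is the merging pair, the
drift is unchanged and the shedding bit goes from 1 to 0 unless escape directions were gained on the
way. The remaining cases pass between pairs with and without drift, where the spacing of the values
of the potential decides. -/
theorem sheddingPotential_lt_of_left {D : Finset ℂ} (hN : IsDirectionSet D τ N κ) (hτ : τ ≤ 2)
    (hD : ∀ k l, B k ≠ B l → B k - B l ∈ D) (he : 0 < e) (he' : 0 < e')
    (hκ : 1 < κ * Λ) (hΛ : 2 < Λ) (hB : HasSinglePair B)
    (hray : ∀ i m j, B i ≠ B m → B m ≠ B j → B i ≠ B j → ¬ SameRay ℝ (B i - B j) (B m - B j))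
    (hfar : IsFar B Λ e e' ζ G)
    (hmono : B i ≠ B j → ∀ n ∈ N, 0 < ⟪n, B i - B j⟫ → ⟪n, ζ₀⟫ ≤ ⟪n, ζ⟫)
    (hre : B i = B j → (G i - G j).re ≤ (G₀ i - G₀ j).re)
    (hphase : B i ≠ B j → escapeSet B N e i j ζ₀ = escapeSet B N e i j ζ →
      ∀ k l, k ≠ l → B k = B l → |(G k - G l).im| ≤ e' → 0 < (G k - G l).re →
        0 < (G₀ k - G₀ l).re)
    (hc : ¬ IsCertified B N Λ e e' i m ζ G) :
    sheddingPotential B N e m j ζ G < sheddingPotential B N e i j ζ₀ G₀ := by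
  have hΛ0 : 0 < Λ := by linarith
  have hz : ζ ≠ 0 := by
    rw [← norm_pos_iff]
    exact (mul_pos hΛ0 he).trans_le hfar.1
  have hlt : ∀ {n : ℂ}, κ * ‖ζ‖ ≤ ⟪n, ζ⟫ → e < ⟪n, ζ⟫ := fun {n} h => by
    have := mul_le_mul_of_nonneg_left hfar.1 hN.pos.le
    nlinarith
  -- With N non-empty, the truncated subtractions in the potential are true ones.
  have hcard : 1 ≤ N.card := by
    obtain ⟨n, hn, -⟩ := exists_lt_inner hN hτ he hκ hfar.1
    exact Finset.card_pos.mpr ⟨n, hn⟩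
  have hsub : B i ≠ B j → escapeSet B N e i j ζ₀ ⊆ escapeSet B N e i j ζ := by
    intro hij n hn
    obtain ⟨h1, h2, h3⟩ := mem_escapeSet.mp hn
    exact mem_escapeSet.mpr ⟨h1, h2, h3.trans_le (hmono hij n h1 h2)⟩
  have hle : ∀ k l ξ, (escapeSet B N e k l ξ).card ≤ N.card := fun k l ξ =>
    Finset.card_le_card escapeSet_subset
  by_cases him : B i = B m
  · -- a branch of the merging pair splits off
    have hne : i ≠ m := by
      rintro rfl
      exact hc (Or.inr (Or.inr ⟨rfl, hfar⟩))
    obtain ⟨h1, h2⟩ := hfar.not_isCertified_re_pos he' hΛ him hne hc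
    by_cases hij : B i = B j
    · have hmj : B m = B j := him ▸ hij
      by_cases hj : m = j
      · subst hj
        have h3 := h2.trans_le (hre hij)
        simp only [sheddingPotential, if_true, if_pos hij, if_neg hne, if_pos h3]
        omega
      · have hj' : i = j := by
          by_contra hn
          rcases hB i m i j hne him hn hij with h | h
          exacts [hj h.2.symm, hne h.1]
        subst hj'
        have h4 : ¬ 0 < (G m - G i).re := by
          have : (G m - G i).re = -(G i - G m).re := by simp
          linarith
        simp only [sheddingPotential, if_true, if_pos hmj, if_neg hj, if_neg h4]
        omega
    · have hmj : B m ≠ B j := him ▸ hij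
      have heq : escapeSet B N e m j ζ = escapeSet B N e i j ζ := by
        ext n; simp only [mem_escapeSet, him]
      simp only [sheddingPotential, if_neg hij, if_neg hmj, heq]
      rcases (hsub hij).eq_or_ssubset with h3 | h3
      · have h4 : CanShed B i j G₀ :=
          Or.inr ⟨m, hne.symm, him, hphase hij h3 i m hne him h1 h2⟩
        -- The merging pair is unique, j is not in it, and m has replaced i; a further shedding
        -- would need Re (G m − G i) > 0, the opposite of the sign just established.
        have h5 : ¬ CanShed B m j G := by
          rintro (⟨k, hk, hkj, -⟩ | ⟨k, hk, hmk, hk2⟩)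
          · rcases hB i m k j hne him hk hkj with h | h
            · exact hmj (congrArg B h.2).symm
            · exact hij (congrArg B h.2).symm
          · rcases hB i m m k hne him hk.symm hmk with h | h
            · exact hne h.1.symm
            · have h6 : (G m - G i).re = -(G i - G m).re := by simp
              rw [h.2, h6] at hk2
              linarith
        rw [h3, if_pos h4, if_neg h5]
        omega
      · have h4 := Finset.card_lt_card h3
        have h5 := hle i j ζ
        split_ifs <;> omega
  · have hA := escapeSet_eq_empty him hc
    by_cases hmj : B m = B j
    · have hij : B i ≠ B j := hmj ▸ him
      have heq : escapeSet B N e i j ζ = ∅ := by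
        rw [← hA]; ext n; simp only [mem_escapeSet, hmj]
      have h0 : escapeSet B N e i j ζ₀ = ∅ := Finset.subset_empty.mp (heq ▸ hsub hij)
      simp only [sheddingPotential, if_neg hij, if_pos hmj, h0, Finset.card_empty]
      split_ifs <;> omega
    · by_cases hij : B i = B j
      -- The rest drifts opposite to the shed branch, so a direction positive on ζ that does not
      -- certify i, m is an escape direction of m, j.
      · obtain ⟨n, hn, h1⟩ := exists_lt_inner hN hτ he hκ hfar.1
        have h2 : n ∈ escapeSet B N e m j ζ := by
          refine mem_escapeSet.mpr ⟨hn, ?_, h1⟩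
          rw [← hij, ← neg_sub, inner_neg_right]
          rcases lt_or_gt_of_ne (hN.ne_zero n hn _ (hD i m him)) with h2 | h2
          · linarith
          · exact absurd (mem_escapeSet.mpr ⟨hn, h2, h1⟩) (hA ▸ Finset.notMem_empty n)
        have h3 := Finset.card_pos.mpr ⟨n, h2⟩
        have h5 := hle m j ζ
        simp only [sheddingPotential, if_neg hmj, if_pos hij]
        split_ifs <;> omega
      · have hsplit : ∀ n : ℂ, ⟪n, B i - B j⟫ = ⟪n, B i - B m⟫ + ⟪n, B m - B j⟫ := fun n => by
          rw [← inner_add_right]; congr 1; ring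
        have hssub : escapeSet B N e i j ζ₀ ⊂ escapeSet B N e m j ζ := by
          refine (Finset.ssubset_iff_of_subset ?_).mpr ?_
          · intro n hn
            obtain ⟨h1, h2, h3⟩ := mem_escapeSet.mp (hsub hij hn)
            refine mem_escapeSet.mpr ⟨h1, ?_, h3⟩
            by_contra! h4
            have h5 := hsplit n
            exact absurd (mem_escapeSet.mpr ⟨h1, (by linarith : 0 < ⟪n, B i - B m⟫), h3⟩)
              (hA ▸ Finset.notMem_empty n)
          · rcases hN.turns _ (hD i j hij) _ (hD m j hmj) _ (hD i m him) (by ring)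
              (hray i m j him hmj hij) ζ hz with ⟨n, hn, h1, h2⟩ | ⟨n, hn, h1, h2, h3⟩
            · exact absurd (mem_escapeSet.mpr ⟨hn, h2, hlt h1⟩) (hA ▸ Finset.notMem_empty n)
            · refine ⟨n, mem_escapeSet.mpr ⟨hn, h3, hlt h1⟩, fun h4 => ?_⟩
              linarith [(mem_escapeSet.mp h4).2.1]
        have h4 := Finset.card_lt_card hssub
        have h5 := hle m j ζ
        simp only [sheddingPotential, if_neg hij, if_neg hmj]
        split_ifs <;> omega

/-- Negating B and G while exchanging left and right preserves certificates and potentials, which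
reduces this to the other side. -/
theorem sheddingPotential_lt_of_right {D : Finset ℂ} (hN : IsDirectionSet D τ N κ) (hτ : τ ≤ 2)
    (hD : ∀ k l, B k ≠ B l → B k - B l ∈ D) (he : 0 < e) (he' : 0 < e')
    (hκ : 1 < κ * Λ) (hΛ : 2 < Λ) (hB : HasSinglePair B)
    (hray : ∀ i m j, B i ≠ B m → B m ≠ B j → B i ≠ B j → ¬ SameRay ℝ (B i - B j) (B m - B j))
    (hfar : IsFar B Λ e e' ζ G)
    (hmono : B i ≠ B j → ∀ n ∈ N, 0 < ⟪n, B i - B j⟫ → ⟪n, ζ₀⟫ ≤ ⟪n, ζ⟫)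
    (hre : B i = B j → (G i - G j).re ≤ (G₀ i - G₀ j).re)
    (hphase : B i ≠ B j → escapeSet B N e i j ζ₀ = escapeSet B N e i j ζ →
      ∀ k l, k ≠ l → B k = B l → |(G k - G l).im| ≤ e' → 0 < (G k - G l).re →
        0 < (G₀ k - G₀ l).re)
    (hc : ¬ IsCertified B N Λ e e' m j ζ G) :
    sheddingPotential B N e i m ζ G < sheddingPotential B N e i j ζ₀ G₀ := by
  rw [← sheddingPotential_neg (i := i) (j := m), ← sheddingPotential_neg (i := i) (j := j)]
  refine sheddingPotential_lt_of_left hN hτ ?_ he he' hκ hΛ ?_ ?_ (isFar_neg.mpr hfar) ?_ ?_ ?_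
    (mt isCertified_neg.mp hc)
  · intro k l hkl
    simpa only [Pi.neg_apply, neg_sub_neg] using hD l k (fun h => hkl (by simp [h]))
  · intro k l k' l' h1 h2 h3 h4
    exact hB k l k' l' h1 (neg_injective h2) h3 (neg_injective h4)
  · intro a b c h1 h2 h3 h4
    refine hray a b c (fun h => h1 (by simp [h])) (fun h => h2 (by simp [h]))
      (fun h => h3 (by simp [h])) ?_
    have h5 : ∀ k l, (-B) k - (-B) l = -(B k - B l) := fun k l => by
      simp only [Pi.neg_apply]; ring
    rw [h5, h5, sameRay_neg_iff] at h4
    exact h4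
  · intro hji n hn h
    refine hmono (fun h => hji (by simp [h])) n hn ?_
    simpa only [Pi.neg_apply, neg_sub_neg] using h
  · intro hji
    simpa only [Pi.neg_apply, neg_sub_neg] using hre (neg_injective hji).symm
  · intro hji heq k l hkl hB' h1 h2
    rw [escapeSet_neg, escapeSet_neg] at heq
    simp only [Pi.neg_apply, neg_sub_neg] at h1 h2 ⊢
    exact hphase (fun h => hji (by simp [h])) heq l k hkl.symm (neg_injective hB').symm h1 h2

end Certificates

/-! ## Orders of vanishing of holomorphic functions at a point of the plane -/

section Orders

open Filter

theorem exists_pow_mul_of_analyticAt {f : ℂ → ℂ} (hf : AnalyticAt ℂ f 0) (h0 : f 0 = 0)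
    (hne : ¬ ∀ᶠ t in 𝓝 0, f t = 0) :
    ∃ (m : ℕ) (v : ℂ → ℂ), 1 ≤ m ∧ AnalyticAt ℂ v 0 ∧ v 0 ≠ 0 ∧
      ∀ᶠ t in 𝓝 0, f t = t ^ m * v t := by
  obtain ⟨m, v, hv, hv0, h⟩ := hf.exists_eventuallyEq_pow_smul_nonzero_iff.mpr hne
  refine ⟨m, v, ?_, hv, hv0, by simpa using h⟩
  rw [Nat.one_le_iff_ne_zero]
  rintro rfl
  have := h.self_of_nhds
  simp only [h0, sub_self, pow_zero, one_smul] at this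
  exact hv0 this.symm

theorem deriv_eventually_pow_mul {f v : ℂ → ℂ} {m : ℕ} (hm : 1 ≤ m) (hv : AnalyticAt ℂ v 0)
    (h : ∀ᶠ t in 𝓝 0, f t = t ^ m * v t) :
    ∀ᶠ t in 𝓝 0, deriv f t = t ^ (m - 1) * (m * v t + t * deriv v t) := by
  filter_upwards [h.eventually_nhds, hv.eventually_analyticAt] with t ht hvt
  rw [EventuallyEq.deriv_eq ht]
  have h1 : HasDerivAt (fun t => t ^ m * v t) ((m * t ^ (m - 1)) * v t + t ^ m * deriv v t) t :=
    (hasDerivAt_pow m t).mul hvt.differentiableAt.hasDerivAt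
  rw [h1.deriv]
  obtain ⟨k, rfl⟩ := Nat.exists_eq_add_of_le' hm
  simp only [Nat.add_sub_cancel, pow_succ]
  ring

theorem eq_of_pow_mul_eq {X Y : ℂ → ℂ} {a b : ℕ} {x y : ℂ}
    (h : ∀ᶠ t in 𝓝[≠] 0, t ^ a * X t = t ^ b * Y t) (hX : Tendsto X (𝓝[≠] 0) (𝓝 x))
    (hY : Tendsto Y (𝓝[≠] 0) (𝓝 y)) (hx : x ≠ 0) (hy : y ≠ 0) : a = b := by
  have key : ∀ {X Y : ℂ → ℂ} {a b : ℕ} {x y : ℂ}, (∀ᶠ t in 𝓝[≠] 0, t ^ a * X t = t ^ b * Y t) →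
      Tendsto X (𝓝[≠] 0) (𝓝 x) → Tendsto Y (𝓝[≠] 0) (𝓝 y) → x ≠ 0 → b ≤ a := by
    intro X Y a b x y h hX hY hx
    by_contra! hab
    obtain ⟨k, rfl⟩ := Nat.exists_eq_add_of_lt hab
    have h1 : Tendsto (fun t : ℂ => t ^ (k + 1) * Y t) (𝓝[≠] 0) (𝓝 (0 ^ (k + 1) * y)) :=
      (((continuous_pow (k + 1)).tendsto 0).mono_left nhdsWithin_le_nhds).mul hY
    have h2 : Tendsto X (𝓝[≠] 0) (𝓝 (0 ^ (k + 1) * y)) := by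
      refine h1.congr' ?_
      filter_upwards [h, self_mem_nhdsWithin] with t ht ht0
      have : t ^ a ≠ 0 := pow_ne_zero _ ht0
      apply mul_left_cancel₀ this
      rw [ht]; ring
    have := tendsto_nhds_unique hX h2
    simp only [ne_eq, Nat.add_eq_zero_iff, one_ne_zero, and_false, not_false_eq_true, zero_pow,
      zero_mul] at this
    exact hx this
  exact le_antisymm (key (h.mono fun t ht => ht.symm) hY hX hy) (key h hX hY hx)

theorem eventually_norm_bounds {v : ℂ → ℂ} (hv : ContinuousAt v 0) (hv0 : v 0 ≠ 0) :
    ∀ᶠ t in 𝓝 0, ‖v 0‖ / 2 ≤ ‖v t‖ ∧ ‖v t‖ ≤ 2 * ‖v 0‖ := by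
  have hp : 0 < ‖v 0‖ := norm_pos_iff.mpr hv0
  have h := hv.norm
  filter_upwards [h.eventually (lt_mem_nhds (show ‖v 0‖ / 2 < ‖v 0‖ by linarith)),
    h.eventually (gt_mem_nhds (show ‖v 0‖ < 2 * ‖v 0‖ by linarith))] with t h1 h2
  exact ⟨h1.le, h2.le⟩

theorem exists_norm_bounds_of_pow_mul {f v : ℂ → ℂ} {m : ℕ} (hv : AnalyticAt ℂ v 0)
    (hv0 : v 0 ≠ 0) (h : ∀ᶠ t in 𝓝 0, f t = t ^ m * v t) :
    ∃ c₁ c₂ : ℝ, 0 < c₁ ∧ 0 < c₂ ∧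
      ∀ᶠ t in 𝓝 0, c₁ * ‖t‖ ^ m ≤ ‖f t‖ ∧ ‖f t‖ ≤ c₂ * ‖t‖ ^ m := by
  have hp : 0 < ‖v 0‖ := norm_pos_iff.mpr hv0
  refine ⟨‖v 0‖ / 2, 2 * ‖v 0‖, by positivity, by positivity, ?_⟩
  filter_upwards [h, eventually_norm_bounds hv.continuousAt hv0] with t ht hb
  rw [ht, norm_mul, norm_pow]
  have : 0 ≤ ‖t‖ ^ m := by positivity
  constructor <;> nlinarith

end Orders

/-! ## The planar model at a turning point -/

section PlanarModel

open Filter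

/-- The eigenforms near a point `t = 0` over a turning point: `ζ` is the coordinate of the base
curve, and `G k` is the integral of the eigenform `a k dζ`. The eigenforms that come together
differ by `√ζ`, up to a non-vanishing factor. -/
structure IsPlanarModel {ι : Type*} (ζ : ℂ → ℂ) (G a : ι → ℂ → ℂ) : Prop where
  analytic : AnalyticAt ℂ ζ 0
  zero : ζ 0 = 0
  not_const : ¬ ∀ᶠ t in 𝓝 0, ζ t = 0
  analytic_integral : ∀ k, AnalyticAt ℂ (G k) 0
  integral_zero : ∀ k, G k 0 = 0
  deriv_eq : ∀ k, ∀ᶠ t in 𝓝 0, deriv (G k) t = a k t * deriv ζ t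
  continuousAt : ∀ k, ContinuousAt (a k) 0
  singlePair : ∀ k l k' l', k ≠ l → a k 0 = a l 0 → k' ≠ l' → a k' 0 = a l' 0 →
    (k' = k ∧ l' = l) ∨ (k' = l ∧ l' = k)
  sqrt : ∀ k l, k ≠ l → a k 0 = a l 0 → ∃ c : ℂ, c ≠ 0 ∧
    Tendsto (fun t => (a k t - a l t) ^ 2 / ζ t) (𝓝[≠] 0) (𝓝 c)

namespace IsPlanarModel

variable {ι : Type*} {ζ : ℂ → ℂ} {G a : ι → ℂ → ℂ}

theorem deriv_sub_eq (h : IsPlanarModel ζ G a) (k l : ι) :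
    ∀ᶠ t in 𝓝 0, deriv (fun t => G k t - G l t) t = (a k t - a l t) * deriv ζ t := by
  filter_upwards [h.deriv_eq k, h.deriv_eq l, (h.analytic_integral k).eventually_analyticAt,
    (h.analytic_integral l).eventually_analyticAt] with t h1 h2 h3 h4
  rw [deriv_fun_sub h3.differentiableAt h4.differentiableAt, h1, h2]
  ring

theorem eventually_deriv_ne_zero (h : IsPlanarModel ζ G a) : ∀ᶠ t in 𝓝[≠] 0, deriv ζ t ≠ 0 := by
  obtain ⟨m, v, hm, hv, hv0, hf⟩ := exists_pow_mul_of_analyticAt h.analytic h.zero h.not_const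
  have h1 : ContinuousAt (fun t => m * v t + t * deriv v t) 0 := by
    have := hv.continuousAt
    have := hv.deriv.continuousAt
    fun_prop
  have h2 : (m : ℂ) * v 0 + 0 * deriv v 0 ≠ 0 := by
    simp only [zero_mul, add_zero]
    exact mul_ne_zero (Nat.cast_ne_zero.mpr (by omega)) hv0
  filter_upwards [(deriv_eventually_pow_mul hm hv hf).filter_mono nhdsWithin_le_nhds,
    (h1.eventually_ne h2).filter_mono nhdsWithin_le_nhds, self_mem_nhdsWithin] with t e1 e2 e3
  rw [e1]
  exact mul_ne_zero (pow_ne_zero _ e3) e2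

theorem eventually_ne_zero (h : IsPlanarModel ζ G a) : ∀ᶠ t in 𝓝[≠] 0, ζ t ≠ 0 := by
  rcases h.analytic.eventually_eq_zero_or_eventually_ne_zero with h1 | h1
  exacts [absurd h1 h.not_const, h1]

theorem eventually_sub_ne_zero (h : IsPlanarModel ζ G a) {k l : ι} (hkl : k ≠ l) :
    ∀ᶠ t in 𝓝[≠] 0, a k t - a l t ≠ 0 := by
  by_cases hA : a k 0 = a l 0
  · obtain ⟨c, hc, ht⟩ := h.sqrt k l hkl hA
    filter_upwards [ht.eventually_ne hc] with t h1 h2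
    simp [h2] at h1
  · exact (((h.continuousAt k).sub (h.continuousAt l)).eventually_ne
      (sub_ne_zero.mpr hA)).filter_mono nhdsWithin_le_nhds

theorem eventually_deriv_sub_ne_zero (h : IsPlanarModel ζ G a) {k l : ι} (hkl : k ≠ l) :
    ∀ᶠ t in 𝓝[≠] 0, deriv (fun t => G k t - G l t) t ≠ 0 := by
  filter_upwards [(h.deriv_sub_eq k l).filter_mono nhdsWithin_le_nhds,
    h.eventually_sub_ne_zero hkl, h.eventually_deriv_ne_zero] with t h1 h2 h3
  rw [h1]
  exact mul_ne_zero h2 h3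

/-- The integral of the difference of the two merging eigenforms behaves like `ζ ^ (3 / 2)`. -/
theorem exists_integral_order (h : IsPlanarModel ζ G a) {k l : ι} (hkl : k ≠ l)
    (hA : a k 0 = a l 0) :
    (∃ (q : ℕ) (H : ℂ → ℂ), 1 ≤ q ∧ AnalyticAt ℂ H 0 ∧ H 0 ≠ 0 ∧
      ∀ᶠ t in 𝓝 0, G k t - G l t = t ^ q * H t) ∧
    ∃ c : ℂ, c ≠ 0 ∧ Tendsto (fun t => (G k t - G l t) ^ 2 / ζ t ^ 3) (𝓝[≠] 0) (𝓝 c) := by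
  have hG : AnalyticAt ℂ (fun t => G k t - G l t) 0 :=
    (h.analytic_integral k).sub (h.analytic_integral l)
  have hne : ¬ ∀ᶠ t in 𝓝 0, G k t - G l t = 0 := by
    intro h0
    have h1 : ∀ᶠ t in 𝓝[≠] (0 : ℂ), False := by
      filter_upwards [h.eventually_deriv_sub_ne_zero hkl,
        h0.eventually_nhds.filter_mono nhdsWithin_le_nhds] with t h1 h2
      apply h1
      rw [EventuallyEq.deriv_eq h2]
      simp
    exact h1.exists.elim fun _ h => h
  obtain ⟨q, H, hq, hH, hH0, hGH⟩ := exists_pow_mul_of_analyticAt hG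
    (by simp [h.integral_zero]) hne
  refine ⟨⟨q, H, hq, hH, hH0, hGH⟩, ?_⟩
  obtain ⟨m, v, hm, hv, hv0, hζ⟩ := exists_pow_mul_of_analyticAt h.analytic h.zero h.not_const
  obtain ⟨c, hc, hlim⟩ := h.sqrt k l hkl hA
  have cH : ContinuousAt (fun t => q * H t + t * deriv H t) 0 := by
    have := hH.continuousAt
    have := hH.deriv.continuousAt
    fun_prop
  have cv : ContinuousAt (fun t => m * v t + t * deriv v t) 0 := by
    have := hv.continuousAt
    have := hv.deriv.continuousAt
    fun_prop
  -- Orders of vanishing are compared in ((G k − G l)')² = (a k − a l)² ζ'², where (a k − a l)² has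
  -- the order of ζ. The outcome is 2q = 3m.
  have hexp : 2 * (q - 1) = m + 2 * (m - 1) := by
    refine eq_of_pow_mul_eq (X := fun t => (q * H t + t * deriv H t) ^ 2)
      (Y := fun t => (a k t - a l t) ^ 2 / ζ t * (v t * (m * v t + t * deriv v t) ^ 2))
      (x := (q * H 0 + 0 * deriv H 0) ^ 2) (y := c * (v 0 * (m * v 0 + 0 * deriv v 0) ^ 2))
      ?_ ?_ ?_ ?_ ?_
    · filter_upwards [hζ.filter_mono nhdsWithin_le_nhds,
        (deriv_eventually_pow_mul hq hH hGH).filter_mono nhdsWithin_le_nhds,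
        (deriv_eventually_pow_mul hm hv hζ).filter_mono nhdsWithin_le_nhds,
        (h.deriv_sub_eq k l).filter_mono nhdsWithin_le_nhds, h.eventually_ne_zero] with
        t e1 e2 e3 e4 e5
      have e6 : (t ^ (q - 1) * (q * H t + t * deriv H t)) ^ 2 =
          (a k t - a l t) ^ 2 / ζ t * (ζ t * (deriv ζ t) ^ 2) := by
        rw [← e2, e4]
        field_simp
      rw [e3] at e6
      calc _ = (t ^ (q - 1) * (q * H t + t * deriv H t)) ^ 2 := by rw [mul_pow, ← pow_mul]; ring
        _ = _ := e6
        _ = (a k t - a l t) ^ 2 / ζ t *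
            (t ^ m * v t * (t ^ (m - 1) * (m * v t + t * deriv v t)) ^ 2) := by rw [← e1]
        _ = _ := by ring
    · exact ((cH.pow 2).tendsto).mono_left nhdsWithin_le_nhds
    · exact hlim.mul (((hv.continuousAt.mul (cv.pow 2)).tendsto).mono_left nhdsWithin_le_nhds)
    · simp only [zero_mul, add_zero]
      exact pow_ne_zero _ (mul_ne_zero (Nat.cast_ne_zero.mpr (by omega)) hH0)
    · simp only [zero_mul, add_zero]
      exact mul_ne_zero hc (mul_ne_zero hv0
        (pow_ne_zero _ (mul_ne_zero (Nat.cast_ne_zero.mpr (by omega)) hv0)))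
  have h2q : q * 2 = m * 3 := by omega
  refine ⟨H 0 ^ 2 / v 0 ^ 3, div_ne_zero (pow_ne_zero _ hH0) (pow_ne_zero _ hv0), ?_⟩
  have hlim2 : Tendsto (fun t => H t ^ 2 / v t ^ 3) (𝓝[≠] 0) (𝓝 (H 0 ^ 2 / v 0 ^ 3)) :=
    (((hH.continuousAt.pow 2).div (hv.continuousAt.pow 3)
      (pow_ne_zero _ hv0)).tendsto).mono_left nhdsWithin_le_nhds
  refine hlim2.congr' ?_
  filter_upwards [hζ.filter_mono nhdsWithin_le_nhds, hGH.filter_mono nhdsWithin_le_nhds,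
    self_mem_nhdsWithin] with t e1 e2 e3
  rw [e1, e2, mul_pow, mul_pow, ← pow_mul, ← pow_mul, h2q,
    mul_div_mul_left _ _ (pow_ne_zero _ e3)]

/-- Near `0`, the square of the integral has the phase of `ζ ^ 3`, up to a constant. -/
theorem exists_phase (h : IsPlanarModel ζ G a) {k l : ι} (hkl : k ≠ l) (hA : a k 0 = a l 0)
    {η : ℝ} (hη : 0 < η) :
    ∃ c : ℂ, c ≠ 0 ∧
      ∀ᶠ t in 𝓝[≠] 0, ‖(G k t - G l t) ^ 2 - c * ζ t ^ 3‖ ≤ η * ‖c * ζ t ^ 3‖ := by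
  obtain ⟨-, c, hc, hlim⟩ := h.exists_integral_order hkl hA
  refine ⟨c, hc, ?_⟩
  have hη' : 0 < η * ‖c‖ := mul_pos hη (norm_pos_iff.mpr hc)
  filter_upwards [(Metric.tendsto_nhds.mp hlim) _ hη', h.eventually_ne_zero] with t e1 e2
  rw [dist_eq_norm] at e1
  have e3 : (G k t - G l t) ^ 2 - c * ζ t ^ 3 =
      ((G k t - G l t) ^ 2 / ζ t ^ 3 - c) * ζ t ^ 3 := by
    rw [sub_mul, div_mul_cancel₀ _ (pow_ne_zero _ e2)]
  rw [e3, norm_mul, norm_mul, ← mul_assoc]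
  exact mul_le_mul_of_nonneg_right e1.le (norm_nonneg _)

/-- The thresholds for the position and for the integrals that belong to a small radius `ε`. -/
theorem exists_thresholds (h : IsPlanarModel ζ G a) {L Λ : ℝ} (hL : 0 < L) (hΛ : 1 ≤ Λ) :
    ∃ C₀ : ℝ, 1 ≤ C₀ ∧ ∃ O ∈ 𝓝 (0 : ℂ), ∀ ε C : ℝ, 0 < ε → C₀ ≤ C →
      ∃ e e' : ℝ, 0 < e ∧ 0 < e' ∧ ∀ t ∈ O,
        (‖t‖ ≤ ε → L * ‖ζ t‖ ≤ e ∧ ∀ k l, k ≠ l → a k 0 = a l 0 → ‖G k t - G l t‖ ≤ e') ∧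
        (C * ε < ‖t‖ → Λ * e ≤ ‖ζ t‖ ∧
          ∀ k l, k ≠ l → a k 0 = a l 0 → Λ * e' ≤ ‖G k t - G l t‖) ∧
        ∀ k l, k ≠ l → a k 0 = a l 0 → e' < ‖G k t - G l t‖ → Λ * e ≤ ‖ζ t‖ := by
  obtain ⟨m, v, hm, hv, hv0, hζ⟩ := exists_pow_mul_of_analyticAt h.analytic h.zero h.not_const
  obtain ⟨c₁, c₂, hc₁, hc₂, hb⟩ := exists_norm_bounds_of_pow_mul hv hv0 hζ
  have lepow : ∀ {x : ℝ} {n : ℕ}, 1 ≤ x → 1 ≤ n → x ≤ x ^ n := fun hx hn =>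
    le_self_pow₀ hx (by omega)
  have hC₂ : 1 ≤ 1 + Λ * (L * c₂) / c₁ := by
    have : 0 ≤ Λ * (L * c₂) / c₁ := by positivity
    linarith
  have hfar : ∀ ε C : ℝ, 0 < ε → 1 + Λ * (L * c₂) / c₁ ≤ C → ∀ t : ℂ, c₁ * ‖t‖ ^ m ≤ ‖ζ t‖ →
      C * ε < ‖t‖ → Λ * (L * (c₂ * ε ^ m)) ≤ ‖ζ t‖ := by
    intro ε C hε hC t h1 h2
    refine le_trans ?_ h1
    have h3 : (C * ε) ^ m ≤ ‖t‖ ^ m :=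
      pow_le_pow_left₀ (mul_nonneg (by linarith) hε.le) h2.le m
    have h4 : Λ * (L * c₂) / c₁ ≤ C ^ m := by
      have := lepow (hC₂.trans hC) hm
      linarith
    rw [div_le_iff₀ hc₁] at h4
    rw [mul_pow] at h3
    have h5 : 0 < ε ^ m := by positivity
    nlinarith [mul_le_mul_of_nonneg_left h3 hc₁.le, mul_le_mul_of_nonneg_right h4 h5.le]
  by_cases hp : ∃ k l, k ≠ l ∧ a k 0 = a l 0
  · obtain ⟨p, s, hps, hAps⟩ := hp
    obtain ⟨⟨q, H, hq, hH, hH0, hGH⟩, -⟩ := h.exists_integral_order hps hAps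
    obtain ⟨d₁, d₂, hd₁, hd₂, hd⟩ := exists_norm_bounds_of_pow_mul hH hH0 hGH
    have hnorm : ∀ k l, k ≠ l → a k 0 = a l 0 → ∀ t, ‖G k t - G l t‖ = ‖G p t - G s t‖ := by
      intro k l hkl hA t
      rcases h.singlePair p s k l hps hAps hkl hA with ⟨rfl, rfl⟩ | ⟨rfl, rfl⟩
      · rfl
      · exact norm_sub_rev _ _
    set C₂ := 1 + Λ * (L * c₂) / c₁ with hC₂def
    have hr : 0 ≤ Λ * d₂ / d₁ := by positivity
    -- The threshold e bounds L‖ζ‖ on the ε-disc. The threshold e' is taken at radius C₂ε instead of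
    -- ε, so that an integral above e' forces ‖t‖ > C₂ε and hence ‖ζ‖ ≥ Λe. The second factor of C₀
    -- then brings the integrals above Λe'.
    refine ⟨C₂ * (1 + Λ * d₂ / d₁), ?_, _, hb.and hd, fun ε C hε hC =>
      ⟨L * (c₂ * ε ^ m), d₂ * (C₂ * ε) ^ q, by positivity, by positivity, ?_⟩⟩
    · nlinarith
    have hCC₂ : C₂ ≤ C := by nlinarith
    rintro t ⟨⟨hb1, hb2⟩, hd1, hd2⟩
    refine ⟨fun ht => ⟨?_, fun k l hkl hA => ?_⟩, fun ht => ⟨hfar ε C hε hCC₂ t hb1 ht,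
      fun k l hkl hA => ?_⟩, fun k l hkl hA hlt => ?_⟩
    · refine mul_le_mul_of_nonneg_left (hb2.trans ?_) hL.le
      exact mul_le_mul_of_nonneg_left (pow_le_pow_left₀ (norm_nonneg _) ht m) hc₂.le
    · rw [hnorm k l hkl hA]
      refine hd2.trans (mul_le_mul_of_nonneg_left (pow_le_pow_left₀ (norm_nonneg _) ?_ q) hd₂.le)
      nlinarith
    · rw [hnorm k l hkl hA]
      refine le_trans ?_ hd1
      have e1 : (C₂ * (1 + Λ * d₂ / d₁) * ε) ^ q ≤ ‖t‖ ^ q := by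
        refine pow_le_pow_left₀ (by positivity) (le_trans ?_ ht.le) q
        exact mul_le_mul_of_nonneg_right hC hε.le
      have e2 : Λ * d₂ / d₁ ≤ (1 + Λ * d₂ / d₁) ^ q := by
        have := lepow (show 1 ≤ 1 + Λ * d₂ / d₁ by linarith) hq
        linarith
      rw [div_le_iff₀ hd₁] at e2
      have e3 : (C₂ * (1 + Λ * d₂ / d₁) * ε) ^ q = (C₂ * ε) ^ q * (1 + Λ * d₂ / d₁) ^ q := by
        rw [← mul_pow]; ring
      rw [e3] at e1
      have e4 : 0 ≤ (C₂ * ε) ^ q := by positivity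
      nlinarith [mul_le_mul_of_nonneg_left e1 hd₁.le, mul_le_mul_of_nonneg_left e2 e4]
    · rw [hnorm k l hkl hA] at hlt
      refine hfar ε C₂ hε le_rfl t hb1 ?_
      by_contra! hle
      have := mul_le_mul_of_nonneg_left (pow_le_pow_left₀ (norm_nonneg _) hle q) hd₂.le
      linarith
  · push Not at hp
    -- Without a merging pair the conditions on e' are vacuous, and 1 will do.
    refine ⟨1 + Λ * (L * c₂) / c₁, hC₂, _, hb, fun ε C hε hC =>
      ⟨L * (c₂ * ε ^ m), 1, by positivity, one_pos, ?_⟩⟩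
    rintro t ⟨hb1, hb2⟩
    refine ⟨fun ht => ⟨?_, fun k l hkl hA => absurd hA (hp k l hkl)⟩,
      fun ht => ⟨hfar ε C hε hC t hb1 ht, fun k l hkl hA => absurd hA (hp k l hkl)⟩,
      fun k l hkl hA => absurd hA (hp k l hkl)⟩
    refine mul_le_mul_of_nonneg_left (hb2.trans ?_) hL.le
    exact mul_le_mul_of_nonneg_left (pow_le_pow_left₀ (norm_nonneg _) ht m) hc₂.le

end IsPlanarModel

end PlanarModel

/-! ## Flow curves of the planar model -/

section PlanarFlow

open Filter
open scoped RealInnerProductSpace ComplexConjugate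

theorem norm_cube_sub_cube_le {x y : ℂ} (hx : ‖x‖ = 1) (hy : ‖y‖ = 1) :
    ‖x ^ 3 - y ^ 3‖ ≤ 3 * ‖x - y‖ := by
  have h1 : x ^ 3 - y ^ 3 = (x ^ 2 + x * y + y ^ 2) * (x - y) := by ring
  rw [h1, norm_mul]
  refine mul_le_mul_of_nonneg_right ?_ (norm_nonneg _)
  have h2 := norm_add₃_le (a := x ^ 2) (b := x * y) (c := y ^ 2)
  simp only [norm_pow, norm_mul, hx, hy] at h2
  linarith

/-- If `u₁ ^ 2 ≈ c ζ₁ ^ 3` and `u₂ ^ 2 ≈ c ζ₂ ^ 3`, if `ζ₁` and `ζ₂` have nearly the same phase, and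
if `u₂` is nearly real, then `u₁ ^ 2` has positive real part. -/
theorem re_sq_pos_of_phase {c ζ₁ ζ₂ u₁ u₂ : ℂ} (hc : c ≠ 0) (h₁ : ζ₁ ≠ 0) (h₂ : ζ₂ ≠ 0)
    (hu₁ : ‖u₁ ^ 2 - c * ζ₁ ^ 3‖ ≤ 1 / 10 * ‖c * ζ₁ ^ 3‖)
    (hu₂ : ‖u₂ ^ 2 - c * ζ₂ ^ 3‖ ≤ 1 / 10 * ‖c * ζ₂ ^ 3‖)
    (hζ : ‖(‖ζ₁‖⁻¹ : ℝ) • ζ₁ - (‖ζ₂‖⁻¹ : ℝ) • ζ₂‖ ≤ 1 / 20) (him : 2 * |u₂.im| ≤ ‖u₂‖) :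
    0 < (u₁ ^ 2).re := by
  set x : ℂ := (‖ζ₁‖⁻¹ : ℝ) • ζ₁ with hx
  set y : ℂ := (‖ζ₂‖⁻¹ : ℝ) • ζ₂ with hy
  have hx1 : ‖x‖ = 1 := norm_normalize h₁
  have hy1 : ‖y‖ = 1 := norm_normalize h₂
  have n₁ : 0 < ‖ζ₁‖ := norm_pos_iff.mpr h₁
  have n₂ : 0 < ‖ζ₂‖ := norm_pos_iff.mpr h₂
  have nc : 0 < ‖c‖ := norm_pos_iff.mpr hc
  have e₁ : ζ₁ = (‖ζ₁‖ : ℂ) * x := by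
    rw [hx, Complex.real_smul, Complex.ofReal_inv, mul_inv_cancel_left₀]
    exact_mod_cast n₁.ne'
  have e₂ : ζ₂ = (‖ζ₂‖ : ℂ) * y := by
    rw [hy, Complex.real_smul, Complex.ofReal_inv, mul_inv_cancel_left₀]
    exact_mod_cast n₂.ne'
  have f₁ : (c * ζ₁ ^ 3).re = ‖ζ₁‖ ^ 3 * (c * x ^ 3).re := by
    conv_lhs => rw [e₁]
    rw [← Complex.re_ofReal_mul]
    push_cast
    ring_nf
  have f₂ : (c * ζ₂ ^ 3).re = ‖ζ₂‖ ^ 3 * (c * y ^ 3).re := by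
    conv_lhs => rw [e₂]
    rw [← Complex.re_ofReal_mul]
    push_cast
    ring_nf
  have g₁ := abs_le.mp ((Complex.abs_re_le_norm _).trans hu₁)
  have g₂ := abs_le.mp ((Complex.abs_re_le_norm _).trans hu₂)
  rw [Complex.sub_re, f₁, norm_mul, norm_pow] at g₁
  rw [Complex.sub_re, f₂, norm_mul, norm_pow] at g₂
  -- `Re (u₂ ^ 2)` is large
  have k₁ : ‖u₂‖ ^ 2 / 2 ≤ (u₂ ^ 2).re := by
    have e3 : (u₂ ^ 2).re = ‖u₂‖ ^ 2 - 2 * u₂.im ^ 2 := by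
      rw [Complex.sq_norm, Complex.normSq_apply, pow_two, Complex.mul_re]; ring
    rw [e3]
    have := mul_self_le_mul_self (by positivity) him
    nlinarith [sq_abs u₂.im]
  have k₂ : (9 / 10) * (‖c‖ * ‖ζ₂‖ ^ 3) ≤ ‖u₂‖ ^ 2 := by
    have e3 := norm_sub_norm_le (c * ζ₂ ^ 3) (u₂ ^ 2)
    rw [norm_sub_rev (c * ζ₂ ^ 3)] at e3
    have e4 := e3.trans hu₂
    rw [norm_mul, norm_pow, norm_pow] at e4
    linarith
  -- From Re u₂² one has 9/20, less the error 1/10, which leaves 35/100. The change of phase costs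
  -- at most 3/20, and the remaining 2/10 still exceeds the error 1/10 in u₁².
  have k₃ : (35 / 100) * ‖c‖ ≤ (c * y ^ 3).re := by
    have hp : 0 < ‖ζ₂‖ ^ 3 := by positivity
    by_contra! hn
    nlinarith [mul_lt_mul_of_pos_left hn hp, g₂.2]
  have k₄ : |(c * x ^ 3).re - (c * y ^ 3).re| ≤ ‖c‖ * (3 * (1 / 20)) := by
    rw [← Complex.sub_re, ← mul_sub]
    refine (Complex.abs_re_le_norm _).trans ?_
    rw [norm_mul]
    refine mul_le_mul_of_nonneg_left ((norm_cube_sub_cube_le hx1 hy1).trans ?_) nc.le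
    linarith
  have k₅ := (abs_le.mp k₄).1
  have hp : 0 < ‖ζ₁‖ ^ 3 := by positivity
  have k₆ : (2 / 10) * ‖c‖ ≤ (c * x ^ 3).re := by linarith
  nlinarith [mul_le_mul_of_nonneg_left k₆ hp.le, g₁.1, mul_pos nc hp]

variable {ι : Type*}

/-- The curve `t` is, up to a non-negative factor, a curve of steepest descent of
`Re (G i - G j)`. -/
def IsDescentCurve (G : ι → ℂ → ℂ) (i j : ι) (t : ℝ → ℂ) (s : ℝ) : Prop :=
  ∀ τ ∈ Set.Icc 0 s, ∃ l : ℝ, 0 ≤ l ∧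
    HasDerivWithinAt t (-(l * conj (deriv (fun z => G i z - G j z) (t τ)))) (Set.Icc 0 s) τ

/-- The points where the estimates for the planar model hold, for directions `N` and for constants
`c k l` such that `(G k - G l) ^ 2 ≈ c k l ζ ^ 3` for merging eigenforms. -/
structure IsModelPoint (ζ : ℂ → ℂ) (G a : ι → ℂ → ℂ) (N : Finset ℂ) (c : ι → ι → ℂ) (z : ℂ) :
    Prop where
  analytic : AnalyticAt ℂ ζ z
  analytic_integral : ∀ k, AnalyticAt ℂ (G k) z
  deriv_eq : ∀ k l, deriv (fun t => G k t - G l t) z = (a k z - a l z) * deriv ζ z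
  inner_nonneg : ∀ k l, ∀ n ∈ N, 0 < ⟪n, -conj (a k 0) - -conj (a l 0)⟫ →
    0 ≤ ⟪n, -conj (a k z - a l z)⟫
  ne_zero : z ≠ 0 → ∀ k l, k ≠ l → deriv (fun t => G k t - G l t) z ≠ 0
  phase_ne_zero : ∀ k l, k ≠ l → a k 0 = a l 0 → c k l ≠ 0
  phase : z ≠ 0 → ∀ k l, k ≠ l → a k 0 = a l 0 →
    ‖(G k z - G l z) ^ 2 - c k l * ζ z ^ 3‖ ≤ 1 / 10 * ‖c k l * ζ z ^ 3‖

theorem IsDescentCurve.continuousOn {G : ι → ℂ → ℂ} {i j : ι} {t : ℝ → ℂ} {s : ℝ}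
    (ht : IsDescentCurve G i j t s) : ContinuousOn t (Set.Icc 0 s) := fun τ hτ => by
  obtain ⟨l, -, h⟩ := ht τ hτ
  exact h.continuousWithinAt

theorem monotoneOn_of_hasDerivWithinAt {f : ℝ → ℝ} {s : ℝ}
    (h : ∀ τ ∈ Set.Icc 0 s, ∃ f', 0 ≤ f' ∧ HasDerivWithinAt f f' (Set.Icc 0 s) τ) :
    MonotoneOn f (Set.Icc 0 s) := by
  refine monotoneOn_of_deriv_nonneg (convex_Icc 0 s) ?_ ?_ ?_
  · intro τ hτ
    obtain ⟨f', -, hf⟩ := h τ hτ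
    exact hf.continuousWithinAt
  · intro τ hτ
    obtain ⟨f', -, hf⟩ := h τ (interior_subset hτ)
    exact (hf.mono interior_subset).differentiableWithinAt
  · intro τ hτ
    obtain ⟨f', h0, hf⟩ := h τ (interior_subset hτ)
    rw [(hf.hasDerivAt (mem_interior_iff_mem_nhds.mp hτ)).deriv]
    exact h0

theorem constant_of_hasDerivWithinAt_zero {E : Type*} [NormedAddCommGroup E] [NormedSpace ℝ E]
    {f : ℝ → E} {s : ℝ}
    (h : ∀ τ ∈ Set.Icc 0 s, HasDerivWithinAt f 0 (Set.Icc 0 s) τ) :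
    ∀ τ ∈ Set.Icc 0 s, f τ = f 0 := by
  refine constant_of_has_deriv_right_zero (fun τ hτ => (h τ hτ).continuousWithinAt) ?_
  intro τ hτ
  exact (h τ ⟨hτ.1, hτ.2.le⟩).mono_of_mem_nhdsWithin (Icc_mem_nhdsGE_of_mem hτ)

namespace IsModelPoint

variable {ζ : ℂ → ℂ} {G a : ι → ℂ → ℂ} {N : Finset ℂ} {c : ι → ι → ℂ} {i j : ι} {t : ℝ → ℂ} {s : ℝ}

/-- In the base coordinate the velocity is −conj(a_i − a_j) times the non-negative factor l|ζ'|²: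
the ramification of ζ affects the speed but not the direction. -/
theorem monotoneOn_inner (hz : ∀ τ ∈ Set.Icc 0 s, IsModelPoint ζ G a N c (t τ))
    (ht : IsDescentCurve G i j t s) {n : ℂ} (hn : n ∈ N)
    (hpos : 0 < ⟪n, -conj (a i 0) - -conj (a j 0)⟫) :
    MonotoneOn (fun τ => ⟪n, ζ (t τ)⟫) (Set.Icc 0 s) := by
  refine monotoneOn_of_hasDerivWithinAt fun τ hτ => ?_
  obtain ⟨l, hl, hd⟩ := ht τ hτ
  have hm := hz τ hτ
  have h1 := hm.analytic.differentiableAt.hasDerivAt.scomp_hasDerivWithinAt_of_eq τ hd rfl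
  have h2 := (hasDerivWithinAt_const τ (Set.Icc 0 s) n).inner ℝ h1
  refine ⟨_, ?_, h2⟩
  rw [inner_zero_left, add_zero, hm.deriv_eq]
  have h3 : -(↑l * conj ((a i (t τ) - a j (t τ)) * deriv ζ (t τ))) • deriv ζ (t τ) =
      (l * ‖deriv ζ (t τ)‖ ^ 2) • (-conj (a i (t τ) - a j (t τ))) := by
    rw [Complex.real_smul, smul_eq_mul, map_mul]
    push_cast
    rw [← Complex.conj_mul']
    ring
  rw [h3, real_inner_smul_right]
  exact mul_nonneg (by positivity) (hm.inner_nonneg i j n hn hpos)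

/-- Steepest descent for the real part of a holomorphic function gives that function the real
derivative −l|dG|²; the real part decreases and the imaginary part is conserved. -/
theorem hasDerivWithinAt_integral {τ : ℝ} (hm : IsModelPoint ζ G a N c (t τ))
    {l : ℝ} (hd : HasDerivWithinAt t
      (-(l * conj (deriv (fun z => G i z - G j z) (t τ)))) (Set.Icc 0 s) τ) :
    HasDerivWithinAt (fun τ => G i (t τ) - G j (t τ))
      (((-(l * ‖deriv (fun z => G i z - G j z) (t τ)‖ ^ 2) : ℝ) : ℂ)) (Set.Icc 0 s) τ := by
  have h1 := (((hm.analytic_integral i).sub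
    (hm.analytic_integral j)).differentiableAt.hasDerivAt).scomp_hasDerivWithinAt_of_eq τ hd rfl
  refine h1.congr_deriv ?_
  rw [smul_eq_mul]
  push_cast
  rw [← Complex.conj_mul']
  simp only [Pi.sub_def]
  ring

theorem antitoneOn_re (hz : ∀ τ ∈ Set.Icc 0 s, IsModelPoint ζ G a N c (t τ))
    (ht : IsDescentCurve G i j t s) :
    AntitoneOn (fun τ => (G i (t τ) - G j (t τ)).re) (Set.Icc 0 s) := by
  have : MonotoneOn (fun τ => -(G i (t τ) - G j (t τ)).re) (Set.Icc 0 s) := by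
    refine monotoneOn_of_hasDerivWithinAt fun τ hτ => ?_
    obtain ⟨l, hl, hd⟩ := ht τ hτ
    have h1 := hasDerivWithinAt_integral (hz τ hτ) hd
    have h2 := (Complex.reCLM.hasFDerivAt.comp_hasDerivWithinAt τ h1).neg
    refine ⟨_, ?_, h2⟩
    simp only [Complex.reCLM_apply, Complex.ofReal_re, neg_neg]
    positivity
  intro x hx y hy hxy
  exact neg_le_neg_iff.mp (this hx hy hxy)

theorem im_eq (hz : ∀ τ ∈ Set.Icc 0 s, IsModelPoint ζ G a N c (t τ))
    (ht : IsDescentCurve G i j t s) :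
    ∀ τ ∈ Set.Icc 0 s, (G i (t τ) - G j (t τ)).im = (G i (t 0) - G j (t 0)).im := by
  refine constant_of_hasDerivWithinAt_zero
    (f := fun τ => (G i (t τ) - G j (t τ)).im) fun τ hτ => ?_
  obtain ⟨l, hl, hd⟩ := ht τ hτ
  have h1 := hasDerivWithinAt_integral (hz τ hτ) hd
  have h2 := Complex.imCLM.hasFDerivAt.comp_hasDerivWithinAt τ h1
  exact h2.congr_deriv (by rw [Complex.imCLM_apply, Complex.ofReal_im])

theorem continuousOn_integral (hz : ∀ τ ∈ Set.Icc 0 s, IsModelPoint ζ G a N c (t τ))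
    (ht : IsDescentCurve G i j t s) (k : ι) :
    ContinuousOn (fun τ => G k (t τ)) (Set.Icc 0 s) := fun τ hτ =>
  ((hz τ hτ).analytic_integral k).continuousAt.comp_continuousWithinAt (ht.continuousOn τ hτ)

/-- As long as the set of escape directions does not change, the phase of `ζ` along a non-trivial
edge is nearly constant, so that the integral of the merging eigenforms keeps its sign. -/
theorem re_pos_of_escapeSet_eq {D : Finset ℂ} {τ₀ κ Λ e e' : ℝ}
    (hN : IsDirectionSet D τ₀ N κ) (hτ₀ : τ₀ ≤ 1 / 20) (hκ : 1 < κ * Λ) (hΛ : 2 < Λ) (he : 0 < e)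
    (hD : -conj (a i 0) - -conj (a j 0) ∈ D) (hs : 0 ≤ s)
    (hz : ∀ τ ∈ Set.Icc 0 s, IsModelPoint ζ G a N c (t τ)) (h0 : ∀ τ ∈ Set.Icc 0 s, t τ ≠ 0)
    (ht : IsDescentCurve G i j t s)
    (hfar : ∀ τ ∈ Set.Icc 0 s, Λ * e ≤ ‖ζ (t τ)‖)
    (hesc : escapeSet (fun k => -conj (a k 0)) N e i j (ζ (t 0)) =
      escapeSet (fun k => -conj (a k 0)) N e i j (ζ (t s)))
    {k l : ι} (hkl : k ≠ l) (hA : a k 0 = a l 0) (hfar' : Λ * e' ≤ ‖G k (t s) - G l (t s)‖)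
    (him : |(G k (t s) - G l (t s)).im| ≤ e') (hre : 0 < (G k (t s) - G l (t s)).re) :
    0 < (G k (t 0) - G l (t 0)).re := by
  have hs0 : (0 : ℝ) ∈ Set.Icc 0 s := ⟨le_rfl, hs⟩
  have hss : s ∈ Set.Icc 0 s := ⟨hs, le_rfl⟩
  have hζ0 : ∀ τ ∈ Set.Icc 0 s, ζ (t τ) ≠ 0 := fun τ hτ => by
    rw [← norm_pos_iff]
    exact (mul_pos (by linarith) he).trans_le (hfar τ hτ)
  have hlt : ∀ τ ∈ Set.Icc 0 s, e < κ * ‖ζ (t τ)‖ := fun τ hτ => by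
    have := mul_le_mul_of_nonneg_left (hfar τ hτ) hN.pos.le
    nlinarith
  -- the phase of `ζ` is nearly constant
  have hphase : ∀ τ ∈ Set.Icc 0 s,
      ‖(‖ζ (t τ)‖⁻¹ : ℝ) • ζ (t τ) - (‖ζ (t s)‖⁻¹ : ℝ) • ζ (t s)‖ ≤ 1 / 20 := by
    intro τ hτ
    by_contra! hgt
    obtain ⟨n, hn, h1, h2⟩ := hN.separates _ _ (hζ0 τ hτ) (hζ0 s hss) (by linarith)
    have l1 := hlt τ hτ
    have l2 := hlt s hss
    -- One of n, −n is positive on the drift. If it is n, monotonicity from τ to s contradicts the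
    -- separation. If it is −n, this is an escape direction at time s, hence by `hesc` at time 0,
    -- hence ⟨−n, ζ⟩ > e at time τ, against ⟨n, ζ⟩ > 0 there.
    rcases lt_or_gt_of_ne (hN.ne_zero n hn _ hD) with h3 | h3
    · have h4 : 0 < ⟪-n, -conj (a i 0) - -conj (a j 0)⟫ := by
        rw [inner_neg_left]; linarith
      have h5 : -n ∈ escapeSet (fun k => -conj (a k 0)) N e i j (ζ (t s)) :=
        mem_escapeSet.mpr ⟨hN.neg_mem n hn, h4, by rw [inner_neg_left]; linarith⟩
      rw [← hesc] at h5
      have h6 := (mem_escapeSet.mp h5).2.2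
      have h7 := monotoneOn_inner hz ht (hN.neg_mem n hn) h4 hs0 hτ hτ.1
      simp only [inner_neg_left] at h6 h7
      linarith
    · have h7 := monotoneOn_inner hz ht hn h3 hτ hss hτ.2
      simp only at h7
      linarith
  have hsq : ∀ τ ∈ Set.Icc 0 s, 0 < ((G k (t τ) - G l (t τ)) ^ 2).re := fun τ hτ =>
    re_sq_pos_of_phase ((hz τ hτ).phase_ne_zero k l hkl hA) (hζ0 τ hτ) (hζ0 s hss)
      ((hz τ hτ).phase (h0 τ hτ) k l hkl hA) ((hz s hss).phase (h0 s hss) k l hkl hA)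
      (hphase τ hτ) (by nlinarith [abs_nonneg (G k (t s) - G l (t s)).im])
  -- A change of sign would pass through a zero of the real part, where the square has non-positive
  -- real part.
  by_contra! hneg
  have hcont : ContinuousOn (fun τ => (G k (t τ) - G l (t τ)).re) (Set.Icc 0 s) :=
    Complex.continuous_re.comp_continuousOn
      ((continuousOn_integral hz ht k).sub (continuousOn_integral hz ht l))
  obtain ⟨τ, hτ, h1⟩ := intermediate_value_Icc hs hcont ⟨hneg, hre.le⟩
  have h2 := hsq τ hτ
  rw [pow_two, Complex.mul_re] at h2
  simp only at h1
  rw [h1] at h2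
  nlinarith [mul_self_nonneg (G k (t τ) - G l (t τ)).im]

end IsModelPoint

/-- Near `0` all points are model points. -/
theorem IsPlanarModel.exists_isModelPoint [Finite ι] {ζ : ℂ → ℂ} {G a : ι → ℂ → ℂ}
    (h : IsPlanarModel ζ G a) (N : Finset ℂ) :
    ∃ c, ∀ᶠ z in 𝓝 0, IsModelPoint ζ G a N c z := by
  have hc : ∀ k l, ∃ c : ℂ, k ≠ l → a k 0 = a l 0 → c ≠ 0 ∧ ∀ᶠ z in 𝓝[≠] 0,
      ‖(G k z - G l z) ^ 2 - c * ζ z ^ 3‖ ≤ 1 / 10 * ‖c * ζ z ^ 3‖ := by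
    intro k l
    by_cases hkl : k ≠ l ∧ a k 0 = a l 0
    · obtain ⟨c, hc, hev⟩ := h.exists_phase hkl.1 hkl.2 (η := 1 / 10) (by norm_num)
      exact ⟨c, fun _ _ => ⟨hc, hev⟩⟩
    · exact ⟨0, fun h1 h2 => absurd ⟨h1, h2⟩ hkl⟩
  choose c hc using hc
  refine ⟨c, ?_⟩
  have e1 : ∀ᶠ z in 𝓝 (0 : ℂ), ∀ k, AnalyticAt ℂ (G k) z :=
    eventually_all.mpr fun k => (h.analytic_integral k).eventually_analyticAt
  have e2 : ∀ᶠ z in 𝓝 (0 : ℂ), ∀ k l,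
      deriv (fun t => G k t - G l t) z = (a k z - a l z) * deriv ζ z :=
    eventually_all.mpr fun k => eventually_all.mpr fun l => h.deriv_sub_eq k l
  have e3 : ∀ᶠ z in 𝓝 (0 : ℂ), ∀ k l, ∀ n ∈ N, 0 < ⟪n, -conj (a k 0) - -conj (a l 0)⟫ →
      0 ≤ ⟪n, -conj (a k z - a l z)⟫ := by
    refine eventually_all.mpr fun k => eventually_all.mpr fun l =>
      (Filter.eventually_all_finset N).mpr fun n _ => ?_
    by_cases hp : 0 < ⟪n, -conj (a k 0) - -conj (a l 0)⟫
    · have hcont : ContinuousAt (fun z => ⟪n, -conj (a k z - a l z)⟫) 0 :=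
        continuousAt_const.inner
          (Complex.continuous_conj.continuousAt.comp
            ((h.continuousAt k).sub (h.continuousAt l))).neg
      have h1 : 0 < ⟪n, -conj (a k 0 - a l 0)⟫ := by
        convert hp using 2
        rw [map_sub]; ring
      filter_upwards [hcont.eventually (lt_mem_nhds h1)] with z hz _ using hz.le
    · exact Eventually.of_forall fun z h1 => absurd h1 hp
  have e4 : ∀ᶠ z in 𝓝 (0 : ℂ), z ≠ 0 → ∀ k l, k ≠ l →
      deriv (fun t => G k t - G l t) z ≠ 0 := by
    have : ∀ᶠ z in 𝓝[≠] (0 : ℂ), ∀ k l, k ≠ l → deriv (fun t => G k t - G l t) z ≠ 0 := by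
      refine eventually_all.mpr fun k => eventually_all.mpr fun l => ?_
      by_cases hkl : k = l
      · exact Eventually.of_forall fun z h1 => absurd hkl h1
      · filter_upwards [h.eventually_deriv_sub_ne_zero hkl] with z hz _ using hz
    exact eventually_nhdsWithin_iff.mp this
  have e5 : ∀ᶠ z in 𝓝 (0 : ℂ), z ≠ 0 → ∀ k l, k ≠ l → a k 0 = a l 0 →
      ‖(G k z - G l z) ^ 2 - c k l * ζ z ^ 3‖ ≤ 1 / 10 * ‖c k l * ζ z ^ 3‖ := by
    have : ∀ᶠ z in 𝓝[≠] (0 : ℂ), ∀ k l, k ≠ l → a k 0 = a l 0 →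
        ‖(G k z - G l z) ^ 2 - c k l * ζ z ^ 3‖ ≤ 1 / 10 * ‖c k l * ζ z ^ 3‖ := by
      refine eventually_all.mpr fun k => eventually_all.mpr fun l => ?_
      by_cases hkl : k ≠ l ∧ a k 0 = a l 0
      · filter_upwards [(hc k l hkl.1 hkl.2).2] with z hz _ _ using hz
      · exact Eventually.of_forall fun z h1 h2 => absurd ⟨h1, h2⟩ hkl
    exact eventually_nhdsWithin_iff.mp this
  filter_upwards [h.analytic.eventually_analyticAt, e1, e2, e3, e4, e5] with z h1 h2 h3 h4 h5 h6
  exact ⟨h1, h2, h3, h4, h5, fun k l hkl hA => (hc k l hkl hA).1, h6⟩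

theorem IsDescentCurve.eq_of_self {G : ι → ℂ → ℂ} {i : ι} {t : ℝ → ℂ} {s : ℝ}
    (ht : IsDescentCurve G i i t s) : ∀ τ ∈ Set.Icc 0 s, t τ = t 0 := by
  refine constant_of_hasDerivWithinAt_zero fun τ hτ => ?_
  obtain ⟨l, hl, hd⟩ := ht τ hτ
  simpa using hd

end PlanarFlow

/-! ## Vector fields, forms and endomorphisms in local coordinates -/

section IntegralCurves

variable {Z : Type*} [TopologicalSpace Z] [ChartedSpace ℂ Z]

theorem HasMFDerivAt.restrictScalars_real {f : Z → ℂ} {z : Z} {f' : TangentSpace 𝓘(ℂ) z →L[ℂ] ℂ}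
    (h : HasMFDerivAt 𝓘(ℂ) 𝓘(ℂ) f z f') :
    HasMFDerivAt 𝓘(ℝ, ℂ) 𝓘(ℝ, ℂ) f z
      (show TangentSpace 𝓘(ℝ, ℂ) z →L[ℝ] TangentSpace 𝓘(ℝ, ℂ) (f z) from
        (ContinuousLinearMap.restrictScalars ℝ (show ℂ →L[ℂ] ℂ from f') : ℂ →L[ℝ] ℂ)) := by
  refine ⟨h.1, ?_⟩
  have := h.2
  exact HasFDerivWithinAt.restrictScalars ℝ this

theorem IsMIntegralCurveOn.hasDerivWithinAt_comp {W : ∀ z : Z, TangentSpace 𝓘(ℝ, ℂ) z} {γ : ℝ → Z}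
    {s : Set ℝ} (hγ : IsMIntegralCurveOn (I := 𝓘(ℝ, ℂ)) γ W s) {τ : ℝ} (hτ : τ ∈ s) {f : Z → ℂ}
    {f' : TangentSpace 𝓘(ℂ) (γ τ) →L[ℂ] ℂ} (h : HasMFDerivAt 𝓘(ℂ) 𝓘(ℂ) f (γ τ) f') :
    HasDerivWithinAt (f ∘ γ) ((show ℂ → ℂ from f') (W (γ τ))) s τ := by
  have h1 := h.restrictScalars_real.comp_hasMFDerivWithinAt τ (hγ τ hτ)
  set w : ℂ := W (γ τ) with hw
  set L : ℂ →L[ℂ] ℂ := f' with hL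
  have h2 : HasFDerivWithinAt (f ∘ γ)
      ((L.restrictScalars ℝ).comp ((1 : ℝ →L[ℝ] ℝ).smulRight w)) s τ :=
    hasMFDerivWithinAt_iff_hasFDerivWithinAt.mp h1
  refine h2.hasDerivWithinAt.congr_deriv ?_
  simp only [ContinuousLinearMap.comp_apply, ContinuousLinearMap.smulRight_apply,
    one_apply_eq_self, one_smul]
  rfl

end IntegralCurves

section CoordinateField

variable {Y : Type*} [TopologicalSpace Y] [ChartedSpace ℂ Y] [IsManifold 𝓘(ℂ) ω Y]

/-- The coordinate vector field of a chart. -/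
theorem contMDiffOn_coordinateField {c : OpenPartialHomeomorph Y ℂ}
    (hc : c ∈ IsManifold.maximalAtlas 𝓘(ℂ) ω Y) :
    ContMDiffOn 𝓘(ℂ) (𝓘(ℂ).prod 𝓘(ℂ)) ω
      (fun t : ℂ => Bundle.TotalSpace.mk' ℂ (E := (TangentSpace 𝓘(ℂ) : Y → Type _)) (c.symm t)
        (mfderiv 𝓘(ℂ) 𝓘(ℂ) c.symm t (1 : ℂ))) c.target := by
  have h1 : ContMDiffOn 𝓘(ℂ) 𝓘(ℂ) ω c.symm c.target := contMDiffOn_symm_of_mem_maximalAtlas hc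
  have h2 := h1.contMDiffOn_tangentMapWithin (m := ω) (by simp) c.open_target.uniqueMDiffOn
  have h3 : ContMDiff 𝓘(ℂ) (𝓘(ℂ).prod 𝓘(ℂ)) ω
      (fun t : ℂ => (⟨t, (1 : ℂ)⟩ : TangentBundle 𝓘(ℂ) ℂ)) :=
    contMDiff_vectorSpace_iff_contDiff.mpr contDiff_const
  have h4 := h2.comp h3.contMDiffOn (s := c.target) (fun t ht => ht)
  refine h4.congr fun t ht => ?_
  simp only [Function.comp, tangentMapWithin]
  rw [mfderivWithin_of_isOpen c.open_target ht]

theorem contDiffOn_form_coordinateField {c : OpenPartialHomeomorph Y ℂ}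
    (hc : c ∈ IsManifold.maximalAtlas 𝓘(ℂ) ω Y) {α : ∀ y : Y, TangentSpace 𝓘(ℂ) y →L[ℂ] ℂ}
    (hα : ContMDiff 𝓘(ℂ) (𝓘(ℂ).prod 𝓘(ℂ, ℂ →L[ℂ] ℂ)) ω
      (fun y => Bundle.TotalSpace.mk' (ℂ →L[ℂ] ℂ) y (α y))) :
    ContDiffOn ℂ ω (fun t => α (c.symm t) (mfderiv 𝓘(ℂ) 𝓘(ℂ) c.symm t (1 : ℂ))) c.target := by
  have h1 : ContMDiffOn 𝓘(ℂ) 𝓘(ℂ) ω c.symm c.target := contMDiffOn_symm_of_mem_maximalAtlas hc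
  have h2 := ContMDiffOn.clm_bundle_apply (IM := 𝓘(ℂ)) (F₁ := ℂ) (F₂ := ℂ)
    (E₁ := (TangentSpace 𝓘(ℂ) : Y → Type _)) (E₂ := fun _ : Y => ℂ)
    (b := c.symm) (ϕ := fun t => α (c.symm t)) (hα.comp_contMDiffOn h1)
    (contMDiffOn_coordinateField hc)
  exact contMDiffOn_iff_contDiffOn.mp fun t ht =>
    (Bundle.contMDiffWithinAt_totalSpace.mp (h2 t ht)).2

end CoordinateField

/-! ### The Higgs field in a local trivialization -/

section EndomorphismFamily

variable {X : Type*} [TopologicalSpace X] [ChartedSpace ℂ X] [IsManifold 𝓘(ℂ) ω X]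
  {F : Type*} [NormedAddCommGroup F] [NormedSpace ℂ F]
  {E : X → Type*} [TopologicalSpace (Bundle.TotalSpace F E)] [∀ P, TopologicalSpace (E P)]
  [∀ P, AddCommGroup (E P)] [∀ P, Module ℂ (E P)] [∀ P, IsTopologicalAddGroup (E P)]
  [∀ P, ContinuousSMul ℂ (E P)] [FiberBundle F E] [VectorBundle ℂ F E]
  [∀ P, FiniteDimensional ℂ (E P)]

open Filter

set_option maxHeartbeats 1000000 in
/-- Near `Q`, a Higgs field is given by a continuous family of endomorphisms of the model fibre. -/
theorem exists_endomorphism_family [FiniteDimensional ℂ F] [ContMDiffVectorBundle ω F E 𝓘(ℂ)]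
    {θ : ∀ P : X, TangentSpace 𝓘(ℂ) P →L[ℂ] E P →L[ℂ] E P} (hθ : IsHiggsField (F := F) θ) (Q : X) :
    ∃ T : ℂ → F →L[ℂ] F, ContinuousAt T (chartAt ℂ Q Q) ∧
      ∀ᶠ z in 𝓝 (chartAt ℂ Q Q), eigenPoly θ Q z = (T z : F →ₗ[ℂ] F).charpoly := by
  have h1 : ContMDiffOn 𝓘(ℂ) 𝓘(ℂ) ω (chartAt ℂ Q).symm (chartAt ℂ Q).target :=
    contMDiffOn_chart_symm
  have h2 := ContMDiffOn.clm_bundle_apply (IM := 𝓘(ℂ)) (F₁ := ℂ) (F₂ := F →L[ℂ] F)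
    (E₁ := (TangentSpace 𝓘(ℂ) : X → Type _)) (E₂ := fun P => E P →L[ℂ] E P)
    (b := (chartAt ℂ Q).symm) (ϕ := fun z => θ ((chartAt ℂ Q).symm z))
    (ContMDiff.comp_contMDiffOn (I' := 𝓘(ℂ)) hθ h1) (contMDiffOn_coordinateField
    (IsManifold.chart_mem_maximalAtlas (I := 𝓘(ℂ)) (n := ω) Q))
  have h3 := h2 (chartAt ℂ Q Q) (mem_chart_target ℂ Q)
  rw [contMDiffWithinAt_hom_bundle] at h3
  have h4 := h3.2.continuousWithinAt.continuousAt
    ((chartAt ℂ Q).open_target.mem_nhds (mem_chart_target ℂ Q))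
  refine ⟨_, h4, ?_⟩
  have h5 : ∀ᶠ z in 𝓝 (chartAt ℂ Q Q), (chartAt ℂ Q).symm z ∈
      (trivializationAt F E ((chartAt ℂ Q).symm (chartAt ℂ Q Q))).baseSet := by
    refine (h1.continuousOn.continuousAt ((chartAt ℂ Q).open_target.mem_nhds
      (mem_chart_target ℂ Q))).eventually ?_
    exact (trivializationAt F E _).open_baseSet.mem_nhds
      (FiberBundle.mem_baseSet_trivializationAt F E _)
  filter_upwards [h5] with z hz
  rw [ContinuousLinearMap.inCoordinates_eq hz hz]
  exact (LinearEquiv.charpoly_conj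
    ((trivializationAt F E ((chartAt ℂ Q).symm (chartAt ℂ Q Q))).continuousLinearEquivAt ℂ _
      hz).toLinearEquiv _).symm

end EndomorphismFamily

/-! ### One-forms and flow curves in a holomorphic coordinate -/

section FormCoefficient

variable {Y : Type*} [TopologicalSpace Y] [ChartedSpace ℂ Y]

/-- The coefficient of the one-form `α` in the coordinate `c`. -/
noncomputable def formCoefficient (c : OpenPartialHomeomorph Y ℂ)
    (α : ∀ y : Y, TangentSpace 𝓘(ℂ) y →L[ℂ] ℂ) (t : ℂ) : ℂ :=
  α (c.symm t) (mfderiv 𝓘(ℂ) 𝓘(ℂ) c.symm t (1 : ℂ))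

/-- The differential of the coordinate `c`, as a complex number. -/
noncomputable def coordinateDeriv (c : OpenPartialHomeomorph Y ℂ) (y : Y)
    (v : TangentSpace 𝓘(ℂ) y) : ℂ :=
  mfderiv 𝓘(ℂ) 𝓘(ℂ) c y v

/-- Evaluating a form on equal vectors at equal points. -/
theorem form_congr (α : ∀ y : Y, TangentSpace 𝓘(ℂ) y →L[ℂ] ℂ) {y y' : Y} (hy : y = y')
    (v : TangentSpace 𝓘(ℂ) y) (v' : TangentSpace 𝓘(ℂ) y') (hv : (v : ℂ) = (v' : ℂ)) :
    α y v = α y' v' := by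
  subst hy
  exact congrArg (α y) hv

variable {Z : Type*} [TopologicalSpace Z] [ChartedSpace ℂ Z]

theorem ConformalMetric.pullbackNormSq_nonneg (h : ConformalMetric Y) (π : Z → Y) (z : Z)
    (v : TangentSpace 𝓘(ℂ) z) : 0 ≤ h.pullbackNormSq π z v := by
  unfold ConformalMetric.pullbackNormSq
  rcases eq_or_ne (mfderiv 𝓘(ℂ) 𝓘(ℂ) π z v) 0 with h0 | h0
  · rw [h0]
    have := h.normSq_smul (π z) 0 0
    simp only [zero_smul, norm_zero] at this
    rw [this]; simp
  · exact (h.normSq_pos _ _ h0).le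

variable [IsManifold 𝓘(ℂ) ω Y]

theorem mdifferentiableAt_coordinate {c : OpenPartialHomeomorph Y ℂ}
    (hc : c ∈ IsManifold.maximalAtlas 𝓘(ℂ) ω Y) {y : Y} (hy : y ∈ c.source) :
    MDifferentiableAt 𝓘(ℂ) 𝓘(ℂ) c y :=
  ((contMDiffOn_of_mem_maximalAtlas hc).mdifferentiableOn (by simp)).mdifferentiableAt
    (c.open_source.mem_nhds hy)

theorem mdifferentiableAt_coordinate_symm {c : OpenPartialHomeomorph Y ℂ}
    (hc : c ∈ IsManifold.maximalAtlas 𝓘(ℂ) ω Y) {t : ℂ} (ht : t ∈ c.target) :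
    MDifferentiableAt 𝓘(ℂ) 𝓘(ℂ) c.symm t :=
  ((contMDiffOn_symm_of_mem_maximalAtlas hc).mdifferentiableOn (by simp)).mdifferentiableAt
    (c.open_target.mem_nhds ht)

theorem mfderiv_symm_mfderiv {c : OpenPartialHomeomorph Y ℂ}
    (hc : c ∈ IsManifold.maximalAtlas 𝓘(ℂ) ω Y) {y : Y} (hy : y ∈ c.source)
    (v : TangentSpace 𝓘(ℂ) y) :
    (mfderiv 𝓘(ℂ) 𝓘(ℂ) c.symm (c y) (mfderiv 𝓘(ℂ) 𝓘(ℂ) c y v) : ℂ) = v := by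
  have h1 : HasMFDerivAt 𝓘(ℂ) 𝓘(ℂ) (c.symm ∘ c) y _ :=
    (mdifferentiableAt_coordinate_symm hc (c.map_source hy)).hasMFDerivAt.comp y
      (mdifferentiableAt_coordinate hc hy).hasMFDerivAt
  have h2 : HasMFDerivAt 𝓘(ℂ) 𝓘(ℂ) (c.symm ∘ c) y (ContinuousLinearMap.id ℂ (TangentSpace 𝓘(ℂ) y)) :=
    (hasMFDerivAt_id y).congr_of_eventuallyEq (c.eventually_left_inverse hy)
  have h3 := hasMFDerivAt_unique h1 h2
  exact congrArg (fun L : ℂ →L[ℂ] ℂ => L v) h3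

theorem form_apply_eq {c : OpenPartialHomeomorph Y ℂ}
    (hc : c ∈ IsManifold.maximalAtlas 𝓘(ℂ) ω Y) (α : ∀ y : Y, TangentSpace 𝓘(ℂ) y →L[ℂ] ℂ)
    {y : Y} (hy : y ∈ c.source) (v : TangentSpace 𝓘(ℂ) y) :
    α y v = formCoefficient c α (c y) * coordinateDeriv c y v := by
  set T : ℂ := mfderiv 𝓘(ℂ) 𝓘(ℂ) c y v with hT
  have h1 := form_congr α (c.left_inv hy) (mfderiv 𝓘(ℂ) 𝓘(ℂ) c.symm (c y) T) v
    (mfderiv_symm_mfderiv hc hy v)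
  change _ = _ * T
  rw [← h1, formCoefficient, mul_comm]
  have h2 : T = T • (1 : ℂ) := by simp
  conv_lhs => rw [h2]
  erw [map_smul, map_smul]
  rfl

theorem differentiableOn_formCoefficient {c : OpenPartialHomeomorph Y ℂ}
    (hc : c ∈ IsManifold.maximalAtlas 𝓘(ℂ) ω Y) {α : ∀ y : Y, TangentSpace 𝓘(ℂ) y →L[ℂ] ℂ}
    (hα : ContMDiff 𝓘(ℂ) (𝓘(ℂ).prod 𝓘(ℂ, ℂ →L[ℂ] ℂ)) ω
      (fun y => Bundle.TotalSpace.mk' (ℂ →L[ℂ] ℂ) y (α y))) :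
    DifferentiableOn ℂ (formCoefficient c α) c.target :=
  (contDiffOn_form_coordinateField hc hα).differentiableOn (by simp)

/-- For a conformal metric the gradient is the conjugate derivative over the squared length of the
coordinate vector, so μ, the metric and the change of coordinates all enter through one factor l ≥
0. The same l occurs in the velocity and in the loss of energy, which is why estimates comparing the
two are uniform in μ. -/
theorem IsMIntegralCurveOn.hasDerivWithinAt_flowField {c : OpenPartialHomeomorph Y ℂ}
    (hc : c ∈ IsManifold.maximalAtlas 𝓘(ℂ) ω Y) (h : ConformalMetric Y) {π : Z → Y}
    (hπ : MDifferentiable 𝓘(ℂ) 𝓘(ℂ) π) {r : ℕ}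
    {α : Fin r → ∀ y : Y, TangentSpace 𝓘(ℂ) y →L[ℂ] ℂ} {p : Z} {g : Fin r → Z → ℂ}
    (hg : ∀ i, IsIntegralFrom π (α i) p (g i)) {μ : ℝ} (hμ : 0 ≤ μ) {i j : Fin r} {γ : ℝ → Z}
    {s : Set ℝ} (hγ : IsMIntegralCurveOn (I := 𝓘(ℝ, ℂ)) γ (flowField h π g μ i j) s)
    {τ : ℝ} (hτ : τ ∈ s) (hy : π (γ τ) ∈ c.source) :
    ∃ l : ℝ, 0 ≤ l ∧
      HasDerivWithinAt (fun σ => c (π (γ σ)))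
        (-(l * (starRingEnd ℂ) (formCoefficient c (α i) (c (π (γ τ))) -
          formCoefficient c (α j) (c (π (γ τ)))))) s τ ∧
      HasDerivWithinAt (fun σ => (g i (γ σ) - g j (γ σ)).re)
        (-(l * ‖formCoefficient c (α i) (c (π (γ τ))) -
          formCoefficient c (α j) (c (π (γ τ)))‖ ^ 2)) s τ := by
  set z := γ τ with hz
  set f : ℂ := formCoefficient c (α i) (c (π z)) - formCoefficient c (α j) (c (π z)) with hf
  have h1 : HasMFDerivAt 𝓘(ℂ) 𝓘(ℂ) (c ∘ π) z _ :=
    (mdifferentiableAt_coordinate hc hy).hasMFDerivAt.comp z (hπ z).hasMFDerivAt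
  have h2 : HasMFDerivAt 𝓘(ℂ) 𝓘(ℂ) (fun x => g i x - g j x) z _ := ((hg i).2 z).sub ((hg j).2 z)
  have h3 := hγ.hasDerivWithinAt_comp hτ h1
  have h4 := hγ.hasDerivWithinAt_comp hτ h2
  set T : ℂ →L[ℂ] ℂ := (mfderiv 𝓘(ℂ) 𝓘(ℂ) c (π z)).comp (mfderiv 𝓘(ℂ) 𝓘(ℂ) π z) with hT
  have key : ∀ v : ℂ, (((α i (π z)).comp (mfderiv 𝓘(ℂ) 𝓘(ℂ) π z) -
      (α j (π z)).comp (mfderiv 𝓘(ℂ) 𝓘(ℂ) π z) : TangentSpace 𝓘(ℂ) z →L[ℂ] ℂ) v : ℂ) =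
      f * (v * T 1) := by
    intro v
    have e : T v = v * T 1 := by
      conv_lhs => rw [← mul_one v, ← smul_eq_mul, map_smul, smul_eq_mul]
    rw [← e, hf, sub_mul]
    exact congrArg₂ (· - ·) (form_apply_eq hc (α i) hy _) (form_apply_eq hc (α j) hy _)
  set N := h.pullbackNormSq π z (1 : ℂ) with hN
  have hN0 : 0 ≤ N := h.pullbackNormSq_nonneg π z _
  set w : ℂ := flowField h π g μ i j z with hw
  have hW : w = -(((μ / N : ℝ) : ℂ) * (starRingEnd ℂ) (f * T 1)) := by
    have hd : (mfderiv 𝓘(ℂ) 𝓘(ℂ) (fun x => g i x - g j x) z (1 : ℂ) : ℂ) = f * T 1 := by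
      rw [h2.mfderiv]
      exact (key 1).trans (by rw [one_mul])
    have : w = ((-μ : ℝ) : ℂ) * ((starRingEnd ℂ)
      (mfderiv 𝓘(ℂ) 𝓘(ℂ) (fun x => g i x - g j x) z (1 : ℂ) : ℂ) / (N : ℂ)) := by
      rfl
    rw [this, hd]
    push_cast
    ring
  refine ⟨μ / N * ‖T 1‖ ^ 2, by positivity, ?_, ?_⟩
  · refine h3.congr_deriv ?_
    have e : T w = w * T 1 := by
      conv_lhs => rw [← mul_one w, ← smul_eq_mul, map_smul, smul_eq_mul]
    refine e.trans ?_
    rw [hW, map_mul]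
    push_cast
    rw [← Complex.mul_conj']
    ring
  · have h5 := (Complex.reCLM.hasFDerivAt (x := g i z - g j z)).comp_hasDerivWithinAt τ h4
    refine h5.congr_deriv ?_
    refine (congrArg Complex.re (key _)).trans ?_
    rw [hW, map_mul]
    have : f * (-(((μ / N : ℝ) : ℂ) * ((starRingEnd ℂ) f * (starRingEnd ℂ) (T 1))) * T 1) =
      ((-(μ / N * ‖T 1‖ ^ 2 * ‖f‖ ^ 2) : ℝ) : ℂ) := by
      push_cast
      rw [← Complex.mul_conj', ← Complex.mul_conj']
      ring
    rw [this, Complex.ofReal_re]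

end FormCoefficient

/-! ## Local structure of the eigenforms over a turning point -/

section Eigenforms

open Filter Polynomial

theorem Polynomial.rootMultiplicity_prod_X_sub_C {ι : Type*} [Fintype ι] (A : ι → ℂ) (c : ℂ) :
    (∏ k, (X - C (A k))).rootMultiplicity c = (Finset.univ.filter fun k => A k = c).card := by
  rw [← Polynomial.count_roots, Polynomial.roots_prod _ _ (Finset.prod_ne_zero_iff.mpr
    fun k _ => X_sub_C_ne_zero _)]
  simp only [roots_X_sub_C, Multiset.bind_singleton]
  rw [Multiset.count_map, Finset.card_def]
  simp only [Finset.filter_val, eq_comm]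

theorem LinearMap.charpoly_eq_prod_of_smul {V : Type*} [AddCommGroup V] [Module ℂ V]
    [FiniteDimensional ℂ V] {r : ℕ} {f : Fin r → ℂ} {b : ℂ} (hb : b ≠ 0) {S : V →ₗ[ℂ] V}
    (h : (b • S).charpoly = ∏ i, (X - C (f i))) : S.charpoly = ∏ i, (X - C (f i / b)) := by
  have hr : Module.finrank ℂ V = r := by
    have h1 := (b • S).charpoly_natDegree
    rw [h, natDegree_prod_of_monic _ _ fun i _ => monic_X_sub_C _] at h1
    simpa using h1.symm
  refine Polynomial.funext fun x => ?_
  have h1 := congrArg (eval (b * x)) h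
  rw [LinearMap.eval_charpoly, eval_prod] at h1
  rw [LinearMap.eval_charpoly, eval_prod]
  have h2 : algebraMap ℂ (Module.End ℂ V) (b * x) - b • S =
      b • (algebraMap ℂ (Module.End ℂ V) x - S) := by
    ext v
    simp [smul_sub, smul_comm x b]
  rw [h2, LinearMap.det_smul, hr] at h1
  have h3 : ∏ i, eval (b * x) (X - C (f i)) = b ^ r * ∏ i, eval x (X - C (f i / b)) := by
    rw [show b ^ r = ∏ _i : Fin r, b by simp, ← Finset.prod_mul_distrib]
    refine Finset.prod_congr rfl fun i _ => ?_
    simp only [eval_sub, eval_X, eval_C]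
    field_simp
  rw [h3] at h1
  exact mul_left_cancel₀ (pow_ne_zero r hb) h1

variable {F : Type*} [NormedAddCommGroup F] [NormedSpace ℂ F] [FiniteDimensional ℂ F]

/-- An eigenvector bounds the eigenvalue by the operator norm; this supplies the boundedness needed
to remove singularities where ζ' vanishes. -/
theorem norm_le_of_charpoly_eq_prod {ι : Type*} [Fintype ι] {S : F →L[ℂ] F} {f : ι → ℂ}
    (h : (S : F →ₗ[ℂ] F).charpoly = ∏ i, (X - C (f i))) (i : ι) : ‖f i‖ ≤ ‖S‖ := by
  have h1 : (S : F →ₗ[ℂ] F).charpoly.IsRoot (f i) := by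
    rw [h, IsRoot.def, eval_prod]
    exact Finset.prod_eq_zero (Finset.mem_univ i) (by simp)
  obtain ⟨v, hv⟩ := ((Module.End.hasEigenvalue_iff_isRoot_charpoly _ _).mpr h1).exists_hasEigenvector
  have h2 : S v = f i • v := hv.apply_eq_smul
  have h3 := S.le_opNorm v
  rw [h2, norm_smul] at h3
  exact le_of_mul_le_mul_right h3 (norm_pos_iff.mpr hv.2)

/-- Both sides of det(x − T) = ∏ (x − a_i) are continuous, so the factorization extends to a point
over which ζ' may vanish. -/
theorem charpoly_eq_prod_of_tendsto {ι : Type*} [Fintype ι] {T : ℂ → F →L[ℂ] F} {z₀ : ℂ}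
    (hT : ContinuousAt T z₀) {l : Filter ℂ} [l.NeBot] {y : ℂ → ℂ} (hy : Tendsto y l (𝓝 z₀))
    {a : ι → ℂ → ℂ} {A : ι → ℂ} (ha : ∀ i, Tendsto (a i) l (𝓝 (A i)))
    (h : ∀ᶠ t in l, (T (y t) : F →ₗ[ℂ] F).charpoly = ∏ i, (X - C (a i t))) :
    (T z₀ : F →ₗ[ℂ] F).charpoly = ∏ i, (X - C (A i)) := by
  refine Polynomial.funext fun x => ?_
  have h1 : Tendsto (fun t => (algebraMap ℂ (F →L[ℂ] F) x - T (y t)).det) l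
      (𝓝 (algebraMap ℂ (F →L[ℂ] F) x - T z₀).det) :=
    ContinuousLinearMap.continuous_det.continuousAt.tendsto.comp
      (tendsto_const_nhds.sub (hT.tendsto.comp hy))
  have h2 : Tendsto (fun t => ∏ i, (x - a i t)) l (𝓝 (∏ i, (x - A i))) :=
    tendsto_finsetProd _ fun i _ => tendsto_const_nhds.sub (ha i)
  have h3 : ∀ S : F →L[ℂ] F, (S : F →ₗ[ℂ] F).charpoly.eval x =
      (algebraMap ℂ (F →L[ℂ] F) x - S).det := fun S => LinearMap.eval_charpoly _ _
  rw [h3, eval_prod]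
  simp only [eval_sub, eval_X, eval_C]
  refine tendsto_nhds_unique h1 (h2.congr' ?_)
  filter_upwards [h] with t ht
  rw [← h3, ht, eval_prod]
  simp

/-- The bounded quotient has a limit at 0 by Riemann's theorem, and the product formula at 0 itself
follows by continuity. -/
theorem exists_analyticAt_div {f g : ℂ → ℂ} (hf : AnalyticAt ℂ f 0) (hg : AnalyticAt ℂ g 0)
    (hg0 : ∀ᶠ t in 𝓝[≠] 0, g t ≠ 0) {M : ℝ} (hM : ∀ᶠ t in 𝓝[≠] 0, ‖f t / g t‖ ≤ M) :
    ∃ a : ℂ → ℂ, ContinuousAt a 0 ∧ (∀ t, t ≠ 0 → a t = f t / g t) ∧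
      ∀ᶠ t in 𝓝 0, f t = a t * g t := by
  have hd : ∀ᶠ t in 𝓝[≠] (0 : ℂ), DifferentiableAt ℂ (fun t => f t / g t) t := by
    filter_upwards [hg0, hf.eventually_analyticAt.filter_mono nhdsWithin_le_nhds,
      hg.eventually_analyticAt.filter_mono nhdsWithin_le_nhds] with t h1 h2 h3
    exact h2.differentiableAt.div h3.differentiableAt h1
  have hb : IsBoundedUnder (· ≤ ·) (𝓝[≠] (0 : ℂ)) fun t => ‖f t / g t - f 0 / g 0‖ := by
    refine isBoundedUnder_of_eventually_le (a := M + ‖f 0 / g 0‖) ?_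
    filter_upwards [hM] with t ht
    exact (norm_sub_le _ _).trans (by gcongr)
  have h1 := Complex.tendsto_limUnder_of_differentiable_on_punctured_nhds_of_bounded_under hd hb
  refine ⟨Function.update (fun t => f t / g t) 0 (limUnder (𝓝[≠] (0 : ℂ)) fun t => f t / g t),
    continuousAt_update_same.mpr h1, fun t ht => Function.update_of_ne ht _ _, ?_⟩
  have h2 : ∀ᶠ t in 𝓝[≠] (0 : ℂ), f t = Function.update (fun t => f t / g t) 0
      (limUnder (𝓝[≠] (0 : ℂ)) fun t => f t / g t) t * g t := by
    filter_upwards [hg0, self_mem_nhdsWithin] with t h3 h4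
    rw [Function.update_of_ne h4, div_mul_cancel₀ _ h3]
  rw [eventually_nhdsWithin_iff] at h2
  filter_upwards [h2] with t ht
  rcases eq_or_ne t 0 with rfl | h3
  · rw [Function.update_self]
    refine tendsto_nhds_unique (hf.continuousAt.tendsto.mono_left nhdsWithin_le_nhds)
      ((h1.mul (hg.continuousAt.tendsto.mono_left nhdsWithin_le_nhds)).congr' ?_)
    filter_upwards [hg0] with t h3
    exact div_mul_cancel₀ _ h3
  · exact ht h3

theorem eventually_deriv_ne_zero_of_not_eventually_eq {ζ : ℂ → ℂ} {t₀ : ℂ}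
    (hζ : AnalyticAt ℂ ζ t₀) (hc : ¬ ∀ᶠ t in 𝓝 t₀, ζ t = ζ t₀) :
    ∀ᶠ t in 𝓝[≠] t₀, deriv ζ t ≠ 0 := by
  refine hζ.deriv.eventually_eq_zero_or_eventually_ne_zero.resolve_left fun h1 => hc ?_
  obtain ⟨ρ, hρ, h2⟩ := Metric.eventually_nhds_iff_ball.mp (h1.and hζ.eventually_analyticAt)
  filter_upwards [Metric.ball_mem_nhds t₀ hρ] with t ht
  exact (convex_ball t₀ ρ).is_const_of_fderivWithin_eq_zero (𝕜 := ℂ)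
    (fun z hz => (h2 z hz).2.differentiableAt.differentiableWithinAt)
    (fun z hz => by
      rw [fderivWithin_of_isOpen Metric.isOpen_ball hz]
      ext
      simpa using (h2 z hz).1) ht (Metric.mem_ball_self hρ)

theorem exists_primitive_of_analyticAt {f : ℂ → ℂ} (hf : AnalyticAt ℂ f 0) :
    ∃ G : ℂ → ℂ, AnalyticAt ℂ G 0 ∧ G 0 = 0 ∧ ∀ᶠ t in 𝓝 0, HasDerivAt G (f t) t := by
  obtain ⟨ρ, hρ, h1⟩ := Metric.eventually_nhds_iff_ball.mp hf.eventually_analyticAt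
  obtain ⟨G, hG0, hG⟩ := (DifferentiableOn.isExactOn_ball fun t ht =>
    (h1 t ht).differentiableAt.differentiableWithinAt).with_val_at 0 0
  refine ⟨G, ?_, hG0, ?_⟩
  · exact DifferentiableOn.analyticAt (fun t ht =>
      (hG t ht).differentiableAt.differentiableWithinAt) (Metric.ball_mem_nhds 0 hρ)
  · filter_upwards [Metric.ball_mem_nhds (0 : ℂ) hρ] with t ht using hG t ht

/-- The two branches of a square root `β (± √ζ)`. -/
theorem tendsto_sq_sub_div {ζ β a b : ℂ → ℂ} (hβ : AnalyticAt ℂ β 0) (hβ' : deriv β 0 ≠ 0)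
    (hζ : Tendsto ζ (𝓝[≠] 0) (𝓝[≠] 0))
    (h : ∀ᶠ t in 𝓝[≠] 0, ∀ s : ℂ, s ^ 2 = ζ t → β s = a t ∨ β s = b t) :
    Tendsto (fun t => (a t - b t) ^ 2 / ζ t) (𝓝[≠] 0) (𝓝 ((2 * deriv β 0) ^ 2)) := by
  have h1 : Tendsto (fun s => ((β s - β (-s)) / s) ^ 2) (𝓝[≠] 0) (𝓝 ((2 * deriv β 0) ^ 2)) := by
    have h2 : HasDerivAt (fun s => β s - β (-s)) (2 * deriv β 0) 0 := by
      have h3 := hβ.differentiableAt.hasDerivAt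
      have h4 : HasDerivAt (fun s : ℂ => β (-s)) (deriv β 0 * (-1)) 0 :=
        HasDerivAt.comp (0 : ℂ) (h₂ := β) (by simpa using h3) (hasDerivAt_neg (0 : ℂ))
      exact (h3.sub h4).congr_deriv (by ring)
    have h5 := h2.tendsto_slope
    refine (h5.congr fun s => ?_).pow 2
    simp [slope_def_field]
  -- The principal square root may jump; only s² = ζ and s → 0 are used.
  set s : ℂ → ℂ := fun t => ζ t ^ (1 / 2 : ℂ) with hs
  have hs2 : ∀ t, s t ^ 2 = ζ t := fun t => by
    rw [hs]
    simp
  have hs0 : Tendsto s (𝓝[≠] 0) (𝓝[≠] 0) := by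
    refine tendsto_nhdsWithin_iff.mpr ⟨?_, ?_⟩
    · rw [tendsto_zero_iff_norm_tendsto_zero]
      have h6 : ∀ t, ‖s t‖ = √‖ζ t‖ := fun t => by
        rw [← hs2, norm_pow, Real.sqrt_sq (norm_nonneg _)]
      simp only [h6]
      have h7 := (Real.continuous_sqrt.comp continuous_norm).tendsto (0 : ℂ)
      simp only [Function.comp, norm_zero, Real.sqrt_zero] at h7
      exact h7.comp (hζ.mono_right nhdsWithin_le_nhds)
    · filter_upwards [hζ.eventually self_mem_nhdsWithin] with t ht h8
      have h9 : s t = 0 := h8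
      exact ht (by rw [← hs2, h9]; simp)
  have hne : ∀ᶠ s in 𝓝[≠] (0 : ℂ), β s - β (-s) ≠ 0 := by
    have h3 := h1.eventually_ne (pow_ne_zero 2 (mul_ne_zero two_ne_zero hβ'))
    filter_upwards [h3] with s h4 h5
    exact h4 (by rw [h5]; simp)
  refine (h1.comp hs0).congr' ?_
  filter_upwards [h, hs0.eventually hne] with t h2 h3
  have h4 := h2 (s t) (hs2 t)
  have h5 := h2 (-s t) (by rw [neg_sq, hs2])
  simp only [Function.comp]
  rw [div_pow, hs2]
  congr 1
  -- β takes distinct values at s and −s, so these are a and b in some order, and squaring removes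
  -- the ambiguity.
  rcases h4 with h4 | h4 <;> rcases h5 with h5 | h5 <;> rw [h4, h5] at h3 ⊢
  · simp at h3
  · ring
  · simp at h3

theorem card_filter_eq_of_rootMultiplicity {r : ℕ} {A : Fin r → ℂ} {c : ℂ} {k l : Fin r}
    (hc : (∏ k, (X - C (A k))).rootMultiplicity c = 2) (hkl : k ≠ l) (hk : A k = c) (hl : A l = c)
    {m : Fin r} (hm : A m = c) : m = k ∨ m = l := by
  rw [rootMultiplicity_prod_X_sub_C] at hc
  have h1 : ({k, l} : Finset (Fin r)) = Finset.univ.filter fun k => A k = c := by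
    refine Finset.eq_of_subset_of_card_le ?_ (by rw [hc, Finset.card_pair hkl])
    intro x hx
    simp only [Finset.mem_insert, Finset.mem_singleton] at hx
    rcases hx with rfl | rfl <;> simp [hk, hl]
  have h2 : m ∈ ({k, l} : Finset (Fin r)) := by rw [h1]; simp [hm]
  simpa using h2

/-- The local structure of the eigenforms over a generic turning point. -/
theorem exists_isPlanarModel {r : ℕ} {ζ : ℂ → ℂ} {f : Fin r → ℂ → ℂ} {p : ℂ → ℂ[X]} {z₀ : ℂ}
    {T : ℂ → F →L[ℂ] F} (hζ : AnalyticAt ℂ ζ 0) (hζ0 : ζ 0 = 0) (hζc : ¬ ∀ᶠ t in 𝓝 0, ζ t = 0)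
    (hf : ∀ k, AnalyticAt ℂ (f k) 0) (hT : ContinuousAt T z₀)
    (hp : ∀ᶠ z in 𝓝 z₀, p z = (T z : F →ₗ[ℂ] F).charpoly)
    (hpf : ∀ᶠ t in 𝓝 0, deriv ζ t ≠ 0 → p (z₀ + ζ t) = ∏ k, (X - C (f k t / deriv ζ t)))
    (hgen : ∃ c : ℂ, (p z₀).rootMultiplicity c = 2 ∧
      (∀ c' : ℂ, 2 ≤ (p z₀).rootMultiplicity c' → c' = c) ∧
      ∃ β : ℂ → ℂ, AnalyticAt ℂ β 0 ∧ β 0 = c ∧ deriv β 0 ≠ 0 ∧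
        ∀ᶠ s in 𝓝 (0 : ℂ), (p (z₀ + s ^ 2)).IsRoot (β s)) :
    ∃ G a : Fin r → ℂ → ℂ, IsPlanarModel ζ G a ∧
      (∀ k, ∀ᶠ t in 𝓝 0, HasDerivAt (G k) (f k t) t) ∧ p z₀ = ∏ k, (X - C (a k 0)) := by
  have hd := eventually_deriv_ne_zero_of_not_eventually_eq hζ (by rwa [hζ0])
  have hy : Tendsto (fun t => z₀ + ζ t) (𝓝[≠] 0) (𝓝 z₀) := by
    have := (continuousAt_const (y := z₀)).add hζ.continuousAt
    have h1 : Tendsto (fun t => z₀ + ζ t) (𝓝 0) (𝓝 (z₀ + ζ 0)) := this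
    rw [hζ0, add_zero] at h1
    exact h1.mono_left nhdsWithin_le_nhds
  have hch : ∀ᶠ t in 𝓝[≠] 0, (T (z₀ + ζ t) : F →ₗ[ℂ] F).charpoly =
      ∏ k, (X - C (f k t / deriv ζ t)) := by
    filter_upwards [hd, hy.eventually hp, hpf.filter_mono nhdsWithin_le_nhds] with t h1 h2 h3
    rw [← h2, h3 h1]
  -- The eigenvalues are bounded by the norm of the endomorphism, which converges, so every f_k / ζ'
  -- extends over 0.
  have hM : ∀ k, ∀ᶠ t in 𝓝[≠] 0, ‖f k t / deriv ζ t‖ ≤ ‖T z₀‖ + 1 := by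
    intro k
    have h1 : Tendsto (fun t => ‖T (z₀ + ζ t)‖) (𝓝[≠] 0) (𝓝 ‖T z₀‖) :=
      (hT.tendsto.comp hy).norm
    filter_upwards [hch, h1.eventually_lt_const (lt_add_one _)] with t h2 h3
    exact (norm_le_of_charpoly_eq_prod h2 k).trans h3.le
  choose a hac hat haf using fun k => exists_analyticAt_div (hf k) hζ.deriv hd (hM k)
  choose G hGa hG0 hG using fun k => exists_primitive_of_analyticAt (hf k)
  have hA : p z₀ = ∏ k, (X - C (a k 0)) := by
    rw [hp.self_of_nhds]
    refine charpoly_eq_prod_of_tendsto hT hy (a := a)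
      (fun k => (hac k).tendsto.mono_left nhdsWithin_le_nhds) ?_
    filter_upwards [hch, self_mem_nhdsWithin] with t h1 h2
    rw [h1]
    exact Finset.prod_congr rfl fun k _ => by rw [hat k t h2]
  obtain ⟨c, hc, hcu, β, hβ, hβ0, hβ', hβr⟩ := hgen
  have hpair : ∀ k l, k ≠ l → a k 0 = a l 0 → a k 0 = c := by
    intro k l hkl h
    refine hcu _ ?_
    rw [hA, rootMultiplicity_prod_X_sub_C, ← Finset.card_pair hkl]
    refine Finset.card_le_card fun x hx => ?_
    simp only [Finset.mem_insert, Finset.mem_singleton] at hx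
    rcases hx with rfl | rfl <;> simp [h]
  rw [hA] at hc
  refine ⟨G, a, ⟨hζ, hζ0, hζc, hGa, hG0, fun k => ?_, hac, ?_, ?_⟩, hG, hA⟩
  · filter_upwards [hG k, haf k] with t h1 h2
    rw [h1.deriv, h2]
  · intro k l k' l' hkl h hkl' h'
    have h1 := hpair k l hkl h
    have h2 := hpair k' l' hkl' h'
    have h3 := card_filter_eq_of_rootMultiplicity hc hkl h1 (h ▸ h1) h2
    have h4 := card_filter_eq_of_rootMultiplicity hc hkl h1 (h ▸ h1) (h' ▸ h2)
    grind
  · intro k l hkl h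
    have h1 := hpair k l hkl h
    refine ⟨(2 * deriv β 0) ^ 2, pow_ne_zero 2 (mul_ne_zero two_ne_zero hβ'), ?_⟩
    have hζt : Tendsto ζ (𝓝 0) (𝓝 0) := by simpa [hζ0] using hζ.continuousAt.tendsto
    refine tendsto_sq_sub_div hβ hβ' (tendsto_nhdsWithin_iff.mpr
      ⟨hζt.mono_left nhdsWithin_le_nhds, ?_⟩) ?_
    · refine hζ.eventually_eq_zero_or_eventually_ne_zero.resolve_left hζc
    -- All other eigenvalues stay away from c, so a root β(s) close to c has to belong to k or l.
    · have h5 : ∃ η > 0, ∀ m, m ≠ k → m ≠ l → η < ‖a m 0 - c‖ := by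
        have h6 : ∀ᶠ η in 𝓝[>] (0 : ℝ), ∀ m, m ≠ k → m ≠ l → η < ‖a m 0 - c‖ := by
          refine eventually_all.mpr fun m => ?_
          by_cases hm : a m 0 = c
          · filter_upwards with η h7 h8
            rcases card_filter_eq_of_rootMultiplicity hc hkl h1 (h ▸ h1) hm with h9 | h9
            exacts [absurd h9 h7, absurd h9 h8]
          · have : ∀ᶠ η in 𝓝[>] (0 : ℝ), η < ‖a m 0 - c‖ :=
              (eventually_lt_nhds (norm_pos_iff.mpr (sub_ne_zero.mpr hm))).filter_mono
                nhdsWithin_le_nhds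
            filter_upwards [this] with η h7 _ _ using h7
        obtain ⟨η, h7, h8⟩ := (h6.and self_mem_nhdsWithin).exists
        exact ⟨η, h8, h7⟩
      obtain ⟨η, hη, h6⟩ := h5
      have h7 : ∀ᶠ t in 𝓝[≠] (0 : ℂ), ∀ m, ‖a m t - a m 0‖ < η / 2 := by
        refine eventually_all.mpr fun m => ?_
        have := ((hac m).tendsto.sub_const (a m 0)).norm
        rw [sub_self, norm_zero] at this
        exact (this.mono_left nhdsWithin_le_nhds).eventually_lt_const (half_pos hη)
      have h8 : ∀ᶠ s in 𝓝 (0 : ℂ), ‖β s - c‖ < η / 2 ∧ (p (z₀ + s ^ 2)).IsRoot (β s) := by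
        have := (hβ.continuousAt.tendsto.sub_const c).norm
        rw [hβ0, sub_self, norm_zero] at this
        exact (this.eventually_lt_const (half_pos hη)).and hβr
      obtain ⟨ρ, hρ, h9⟩ := Metric.eventually_nhds_iff_ball.mp h8
      have h10 : ∀ᶠ t in 𝓝[≠] (0 : ℂ), ‖ζ t‖ < ρ ^ 2 := by
        have := hζt.norm
        rw [norm_zero] at this
        exact (this.mono_left nhdsWithin_le_nhds).eventually_lt_const (by positivity)
      filter_upwards [h7, h10, hd, hpf.filter_mono nhdsWithin_le_nhds, self_mem_nhdsWithin]
        with t h11 h12 h13 h14 h15 s hs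
      have h16 : s ∈ Metric.ball (0 : ℂ) ρ := by
        rw [mem_ball_zero_iff]
        rw [← hs, norm_pow] at h12
        exact lt_of_pow_lt_pow_left₀ 2 hρ.le h12
      obtain ⟨h17, h18⟩ := h9 s h16
      rw [hs, h14 h13, IsRoot.def, eval_prod, Finset.prod_eq_zero_iff] at h18
      obtain ⟨m, -, hm⟩ := h18
      simp only [eval_sub, eval_X, eval_C] at hm
      rw [← hat m t h15, sub_eq_zero] at hm
      have h19 : m = k ∨ m = l := by
        by_contra! h20
        have h21 := h6 m h20.1 h20.2
        have h22 := h11 m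
        have : a m 0 - c = (β s - c) - (a m t - a m 0) := by rw [hm]; ring
        rw [this] at h21
        have := norm_sub_le (β s - c) (a m t - a m 0)
        linarith
      rcases h19 with rfl | rfl
      · exact Or.inl hm
      · exact Or.inr hm

end Eigenforms

/-! ## Spectral covers in local coordinates -/

section CoordinateExpression

open Filter
variable {X : Type*} [TopologicalSpace X] [ChartedSpace ℂ X] [IsManifold 𝓘(ℂ) ω X]
variable {Y : Type*} [TopologicalSpace Y] [ChartedSpace ℂ Y] [IsManifold 𝓘(ℂ) ω Y]

/-- The map `φ` in the coordinate `c` on the source and in the preferred chart at `Q`, centred at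
`Q`, on the target. -/
noncomputable def coordinateExpression (φ : Y → X) (c : OpenPartialHomeomorph Y ℂ) (Q : X) (t : ℂ) :
    ℂ :=
  chartAt ℂ Q (φ (c.symm t)) - chartAt ℂ Q Q

theorem eventually_mem_target_and_source {φ : Y → X} (hφ : Continuous φ)
    {c : OpenPartialHomeomorph Y ℂ} {Q : X} {t : ℂ} (ht : t ∈ c.target)
    (hQ : φ (c.symm t) ∈ (chartAt ℂ Q).source) :
    ∀ᶠ t' in 𝓝 t, t' ∈ c.target ∧ φ (c.symm t') ∈ (chartAt ℂ Q).source :=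
  (c.open_target.eventually_mem ht).and
    ((hφ.continuousAt.comp (c.continuousAt_symm ht)).eventually
      ((chartAt ℂ Q).open_source.mem_nhds hQ))

theorem analyticAt_coordinateExpression {φ : Y → X} (hφ : ContMDiff 𝓘(ℂ) 𝓘(ℂ) ω φ)
    {c : OpenPartialHomeomorph Y ℂ} (hc : c ∈ IsManifold.maximalAtlas 𝓘(ℂ) ω Y) {Q : X} {t : ℂ}
    (ht : t ∈ c.target) (hQ : φ (c.symm t) ∈ (chartAt ℂ Q).source) :
    AnalyticAt ℂ (coordinateExpression φ c Q) t := by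
  have h1 : ∀ᶠ t' in 𝓝 t, DifferentiableAt ℂ (coordinateExpression φ c Q) t' := by
    filter_upwards [eventually_mem_target_and_source hφ.continuous ht hQ] with t' ⟨h1, h2⟩
    have h3 : MDifferentiableAt 𝓘(ℂ) 𝓘(ℂ) (chartAt ℂ Q ∘ φ ∘ c.symm) t' :=
      (mdifferentiableAt_coordinate (IsManifold.chart_mem_maximalAtlas Q) h2).comp t'
        ((hφ.mdifferentiable (by simp) _).comp t' (mdifferentiableAt_coordinate_symm hc h1))
    exact h3.differentiableAt.sub_const _
  exact Complex.analyticAt_iff_eventually_differentiableAt.mpr h1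

/-- The chain rule for the coordinate expression of a map. -/
theorem mfderiv_coordinateField {φ : Y → X} (hφ : ContMDiff 𝓘(ℂ) 𝓘(ℂ) ω φ)
    {c : OpenPartialHomeomorph Y ℂ} (hc : c ∈ IsManifold.maximalAtlas 𝓘(ℂ) ω Y) {Q : X} {t : ℂ}
    (ht : t ∈ c.target) (hQ : φ (c.symm t) ∈ (chartAt ℂ Q).source) :
    coordinateDeriv (chartAt ℂ Q) (φ (c.symm t)) (mfderiv 𝓘(ℂ) 𝓘(ℂ) φ (c.symm t)
      (mfderiv 𝓘(ℂ) 𝓘(ℂ) c.symm t (1 : ℂ))) = deriv (coordinateExpression φ c Q) t := by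
  have h3 : HasMFDerivAt 𝓘(ℂ) 𝓘(ℂ) (chartAt ℂ Q ∘ φ ∘ c.symm) t _ :=
    (mdifferentiableAt_coordinate (IsManifold.chart_mem_maximalAtlas Q) hQ).hasMFDerivAt.comp t
      ((hφ.mdifferentiable (by simp) _).hasMFDerivAt.comp t
        (mdifferentiableAt_coordinate_symm hc ht).hasMFDerivAt)
  have h4 : ∀ L : ℂ →L[ℂ] ℂ, HasFDerivAt (fun t => chartAt ℂ Q (φ (c.symm t))) L t →
      deriv (coordinateExpression φ c Q) t = L 1 := fun L hL =>
    (hL.hasDerivAt.sub_const (chartAt ℂ Q Q)).deriv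
  exact (h4 _ h3.hasFDerivAt).symm

theorem charpoly_congr {E : X → Type*} [∀ P, TopologicalSpace (E P)]
    [∀ P, AddCommGroup (E P)] [∀ P, Module ℂ (E P)] [∀ P, IsTopologicalAddGroup (E P)]
    [∀ P, ContinuousSMul ℂ (E P)] [∀ P, FiniteDimensional ℂ (E P)]
    (θ : ∀ P : X, TangentSpace 𝓘(ℂ) P →L[ℂ] E P →L[ℂ] E P) {x x' : X} (hx : x = x')
    (v : TangentSpace 𝓘(ℂ) x) (v' : TangentSpace 𝓘(ℂ) x') (b : ℂ)
    (hv : (v : ℂ) = (b • v' : ℂ)) :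
    (θ x v : E x →ₗ[ℂ] E x).charpoly = (b • (θ x' v' : E x' →ₗ[ℂ] E x')).charpoly := by
  subst hx
  have h1 : v = b • v' := hv
  rw [h1, map_smul]
  rfl

variable {F : Type*} [NormedAddCommGroup F] [NormedSpace ℂ F]
  {E : X → Type*} [TopologicalSpace (Bundle.TotalSpace F E)] [∀ P, TopologicalSpace (E P)]
  [∀ P, AddCommGroup (E P)] [∀ P, Module ℂ (E P)] [∀ P, IsTopologicalAddGroup (E P)]
  [∀ P, ContinuousSMul ℂ (E P)] [FiberBundle F E] [VectorBundle ℂ F E]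
  [∀ P, FiniteDimensional ℂ (E P)]
  {θ : ∀ P : X, TangentSpace 𝓘(ℂ) P →L[ℂ] E P →L[ℂ] E P} {φ : Y → X} {r : ℕ}
  {α : Fin r → ∀ y : Y, TangentSpace 𝓘(ℂ) y →L[ℂ] ℂ}

/-- Where φ is unramified, ∂/∂t is sent to ζ' ∂/∂z, so the coefficients of the α_i on Y are the
eigenvalues on X times ζ'. -/
theorem IsSpectralCover.eigenPoly_eq (hφ : IsSpectralCover θ φ α)
    {c : OpenPartialHomeomorph Y ℂ} (hc : c ∈ IsManifold.maximalAtlas 𝓘(ℂ) ω Y) {Q : X} {t : ℂ}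
    (ht : t ∈ c.target) (hQ : φ (c.symm t) ∈ (chartAt ℂ Q).source)
    (hd : deriv (coordinateExpression φ c Q) t ≠ 0) :
    eigenPoly θ Q (chartAt ℂ Q Q + coordinateExpression φ c Q t) =
      ∏ i, (Polynomial.X - Polynomial.C
        (formCoefficient c (α i) t / deriv (coordinateExpression φ c Q) t)) := by
  refine LinearMap.charpoly_eq_prod_of_smul hd ?_
  have hz : chartAt ℂ Q Q + coordinateExpression φ c Q t = chartAt ℂ Q (φ (c.symm t)) := by
    rw [coordinateExpression]; ring
  rw [hz, ← charpoly_congr θ ((chartAt ℂ Q).left_inv hQ).symm (mfderiv 𝓘(ℂ) 𝓘(ℂ) φ (c.symm t)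
      (mfderiv 𝓘(ℂ) 𝓘(ℂ) c.symm t (1 : ℂ))) _ _ ?_, hφ.eigenforms]
  · rfl
  · rw [← mfderiv_coordinateField hφ.holomorphic hc ht hQ]
    refine (mfderiv_symm_mfderiv (IsManifold.chart_mem_maximalAtlas Q) hQ
      (mfderiv 𝓘(ℂ) 𝓘(ℂ) φ _ _)).symm.trans ?_
    generalize hw : coordinateDeriv (chartAt ℂ Q) (φ (c.symm t)) (mfderiv 𝓘(ℂ) 𝓘(ℂ) φ (c.symm t)
      (mfderiv 𝓘(ℂ) 𝓘(ℂ) c.symm t (1 : ℂ))) = w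
    rw [coordinateDeriv] at hw
    rw [hw]
    have h2 : w = w • (1 : ℂ) := by simp
    conv_lhs => rw [h2]
    exact map_smul (mfderiv 𝓘(ℂ) 𝓘(ℂ) (chartAt ℂ Q).symm (chartAt ℂ Q (φ (c.symm t)))) w (1 : ℂ)

end CoordinateExpression

/-! ### Isolation and finiteness of the turning points -/

section SpectralCover

open Filter
variable {X : Type*} [TopologicalSpace X] [ChartedSpace ℂ X] [IsManifold 𝓘(ℂ) ω X]
variable {Y : Type*} [TopologicalSpace Y] [ChartedSpace ℂ Y] [IsManifold 𝓘(ℂ) ω Y]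

theorem eventually_coordinateExpression_eq_iff {φ : Y → X} (hφ : Continuous φ)
    {c : OpenPartialHomeomorph Y ℂ} {Q : X} {t : ℂ} (ht : t ∈ c.target)
    (hQ : φ (c.symm t) ∈ (chartAt ℂ Q).source) :
    (∀ᶠ t' in 𝓝 t, coordinateExpression φ c Q t' = coordinateExpression φ c Q t) ↔
      ∀ᶠ y in 𝓝 (c.symm t), φ y = φ (c.symm t) := by
  have hs : c.symm t ∈ c.source := c.map_target ht
  constructor
  · intro h
    have h1 := (c.continuousAt hs).eventually ((c.right_inv ht).symm ▸
      h.and (eventually_mem_target_and_source hφ ht hQ))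
    filter_upwards [h1, c.open_source.eventually_mem hs] with y ⟨h2, h3, h4⟩ h5
    rw [coordinateExpression, coordinateExpression, sub_left_inj, c.left_inv h5, c.right_inv ht] at h2
    rw [c.left_inv h5] at h4
    exact (chartAt ℂ Q).injOn h4 hQ h2
  · intro h
    filter_upwards [(c.continuousAt_symm ht).eventually h] with t' h1
    rw [coordinateExpression, coordinateExpression, h1]

/-- The set where φ is locally constant is open. It is closed because at any other point the
coordinate expression has non-zero derivative on a punctured neighbourhood. By connectedness φ would
be constant, and by surjectivity X a point, while a chart has infinite target. -/
theorem not_eventually_eq [ConnectedSpace Y] {φ : Y → X} (hφ : ContMDiff 𝓘(ℂ) 𝓘(ℂ) ω φ)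
    (hs : Function.Surjective φ) (y : Y) : ¬ ∀ᶠ y' in 𝓝 y, φ y' = φ y := by
  set U : Set Y := {y | ∀ᶠ y' in 𝓝 y, φ y' = φ y} with hU
  have hopen : IsOpen U := isOpen_iff_eventually.mpr fun y hy => by
    have hy' : ∀ᶠ y' in 𝓝 y, φ y' = φ y := hy
    filter_upwards [hy', hy'.eventually_nhds] with z h1 h2
    change ∀ᶠ y' in 𝓝 z, φ y' = φ z
    rw [h1]
    exact h2
  have hclosed : IsClosed U := isClosed_of_closure_subset fun y hy => by
    set c := chartAt ℂ y with hcd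
    have hc : c ∈ IsManifold.maximalAtlas 𝓘(ℂ) ω Y := IsManifold.chart_mem_maximalAtlas y
    have hyc : y ∈ c.source := mem_chart_source ℂ y
    have ht : c y ∈ c.target := c.map_source hyc
    have hcy : c.symm (c y) = y := c.left_inv hyc
    have hQ : φ (c.symm (c y)) ∈ (chartAt ℂ (φ y)).source := by
      rw [hcy]; exact mem_chart_source ℂ _
    by_contra hcon
    have h1 := mt (eventually_coordinateExpression_eq_iff hφ.continuous ht hQ).mp
      (by rw [hcy]; exact hcon)
    have h2 := eventually_deriv_ne_zero_of_not_eventually_eq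
      (analyticAt_coordinateExpression hφ hc ht hQ) h1
    rw [eventually_nhdsWithin_iff] at h2
    have h3 := (c.continuousAt hyc).eventually
      (h2.and (eventually_mem_target_and_source hφ.continuous ht hQ))
    obtain ⟨z, hz, ⟨h4, h5, h6⟩, h7⟩ := ((mem_closure_iff_frequently.mp hy).and_eventually
      (h3.and (c.open_source.eventually_mem hyc))).exists
    have hcz : c.symm (c z) = z := c.left_inv h7
    have h8 := (eventually_coordinateExpression_eq_iff hφ.continuous h5 h6).mpr
      (by rw [hcz]; exact hz)
    refine h4 (fun h => hcon ?_) ?_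
    · rwa [← c.injOn h7 hyc h]
    · have h9 : coordinateExpression φ c (φ y) =ᶠ[𝓝 (c z)] fun _ => _ := h8
      rw [h9.deriv_eq, deriv_const]
  intro hy
  have huniv : U = Set.univ := IsClopen.eq_univ ⟨hclosed, hopen⟩ ⟨y, hy⟩
  have hloc : IsLocallyConstant φ := (IsLocallyConstant.iff_eventually_eq φ).mpr fun z => by
    have : z ∈ U := huniv ▸ Set.mem_univ z
    exact this
  have hX : ∀ x : X, x = φ y := fun x => by
    obtain ⟨z, rfl⟩ := hs x
    exact hloc.apply_eq_of_preconnectedSpace z y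
  have h1 : (chartAt ℂ (φ y)).target ⊆ {chartAt ℂ (φ y) (φ y)} := fun t ht => by
    rw [Set.mem_singleton_iff, ← (chartAt ℂ (φ y)).right_inv ht, hX ((chartAt ℂ (φ y)).symm t)]
  have h2 := (chartAt ℂ (φ y)).open_target.mem_nhds (mem_chart_target ℂ (φ y))
  exact infinite_of_mem_nhds _ h2 ((Set.finite_singleton _).subset h1)

variable {F : Type*} [NormedAddCommGroup F] [NormedSpace ℂ F]
  {E : X → Type*} [TopologicalSpace (Bundle.TotalSpace F E)] [∀ P, TopologicalSpace (E P)]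
  [∀ P, AddCommGroup (E P)] [∀ P, Module ℂ (E P)] [∀ P, IsTopologicalAddGroup (E P)]
  [∀ P, ContinuousSMul ℂ (E P)] [FiberBundle F E] [VectorBundle ℂ F E]
  [∀ P, FiniteDimensional ℂ (E P)]
  {θ : ∀ P : X, TangentSpace 𝓘(ℂ) P →L[ℂ] E P →L[ℂ] E P} {φ : Y → X} {r : ℕ}
  {α : Fin r → ∀ y : Y, TangentSpace 𝓘(ℂ) y →L[ℂ] ℂ}

theorem coordinateDeriv_eq_zero_iff {c : OpenPartialHomeomorph Y ℂ}
    (hc : c ∈ IsManifold.maximalAtlas 𝓘(ℂ) ω Y) {y : Y} (hy : y ∈ c.source)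
    {v : TangentSpace 𝓘(ℂ) y} : coordinateDeriv c y v = 0 ↔ (v : ℂ) = (0 : ℂ) := by
  constructor
  · intro h
    refine (mfderiv_symm_mfderiv hc hy v).symm.trans ?_
    rw [coordinateDeriv] at h
    rw [h]
    exact map_zero (mfderiv 𝓘(ℂ) 𝓘(ℂ) c.symm (c y))
  · intro h
    have h1 : v = 0 := h
    rw [h1, coordinateDeriv, map_zero]
    rfl

theorem deriv_coordinateExpression_ne_zero_iff (hφ : ContMDiff 𝓘(ℂ) 𝓘(ℂ) ω φ)
    {c : OpenPartialHomeomorph Y ℂ} (hc : c ∈ IsManifold.maximalAtlas 𝓘(ℂ) ω Y) {Q : X} {t : ℂ}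
    (ht : t ∈ c.target) (hQ : φ (c.symm t) ∈ (chartAt ℂ Q).source) :
    deriv (coordinateExpression φ c Q) t ≠ 0 ↔ mfderiv 𝓘(ℂ) 𝓘(ℂ) φ (c.symm t) ≠ 0 := by
  rw [← mfderiv_coordinateField hφ hc ht hQ, not_iff_not,
    coordinateDeriv_eq_zero_iff (IsManifold.chart_mem_maximalAtlas Q) hQ]
  constructor
  · intro h
    have hs := c.map_target ht
    refine ContinuousLinearMap.ext fun v => ?_
    have h1 := mfderiv_symm_mfderiv hc hs v
    rw [c.right_inv ht] at h1
    have h2 : ∀ w : ℂ, mfderiv 𝓘(ℂ) 𝓘(ℂ) φ (c.symm t) (mfderiv 𝓘(ℂ) 𝓘(ℂ) c.symm t w) = 0 := by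
      intro w
      set L : ℂ →L[ℂ] ℂ := (mfderiv 𝓘(ℂ) 𝓘(ℂ) φ (c.symm t)).comp (mfderiv 𝓘(ℂ) 𝓘(ℂ) c.symm t)
        with hL
      have h3 : L 1 = 0 := h
      have h4 : L w = 0 := by
        rw [← mul_one w, ← smul_eq_mul, map_smul, h3, smul_zero]
      exact h4
    exact (congrArg (mfderiv 𝓘(ℂ) 𝓘(ℂ) φ (c.symm t)) h1).symm.trans (h2 _)
  · intro h
    rw [h]
    rfl

theorem IsSpectralCover.isTurningPoint_iff (hφ : IsSpectralCover θ φ α)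
    {c : OpenPartialHomeomorph Y ℂ} (hc : c ∈ IsManifold.maximalAtlas 𝓘(ℂ) ω Y) {t : ℂ}
    (ht : t ∈ c.target) (hd : mfderiv 𝓘(ℂ) 𝓘(ℂ) φ (c.symm t) ≠ 0) :
    IsTurningPoint θ (φ (c.symm t)) ↔
      ∃ k l, k ≠ l ∧ formCoefficient c (α k) t = formCoefficient c (α l) t := by
  have hQ : φ (c.symm t) ∈ (chartAt ℂ (φ (c.symm t))).source := mem_chart_source ℂ _
  have hd' := (deriv_coordinateExpression_ne_zero_iff hφ.holomorphic hc ht hQ).mpr hd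
  have h1 := hφ.eigenPoly_eq hc ht hQ hd'
  have h2 : coordinateExpression φ c (φ (c.symm t)) t = 0 := by simp [coordinateExpression]
  rw [h2, add_zero] at h1
  simp only [IsTurningPoint, h1, Polynomial.rootMultiplicity_prod_X_sub_C]
  constructor
  · rintro ⟨a, ha⟩
    obtain ⟨k, hk, l, hl, hkl⟩ := Finset.one_lt_card.mp ha
    simp only [Finset.mem_filter, Finset.mem_univ, true_and] at hk hl
    exact ⟨k, l, hkl, (div_left_inj' hd').mp (hk.trans hl.symm)⟩
  · rintro ⟨k, l, hkl, h⟩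
    refine ⟨formCoefficient c (α k) t / deriv (coordinateExpression φ c (φ (c.symm t))) t,
      Finset.one_lt_card.mpr ⟨k, by simp, l, by simp [h], hkl⟩⟩

variable [FiniteDimensional ℂ F] [ContMDiffVectorBundle ω F E 𝓘(ℂ)]

/-- The planar model over a turning point. -/
theorem IsSpectralCover.exists_isPlanarModel [ConnectedSpace Y] (hφ : IsSpectralCover θ φ α)
    (hθ : IsGeneralHiggsField F θ) {P : Y} (hP : IsTurningPoint θ (φ P))
    {c : OpenPartialHomeomorph Y ℂ} (hc : IsCoordinateAt c P) :
    ∃ ζ : ℂ → ℂ, ∃ G a : Fin r → ℂ → ℂ, IsPlanarModel ζ G a ∧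
      (∀ k, ∀ᶠ t in 𝓝 0, HasDerivAt (G k) (formCoefficient c (α k) t) t) ∧
      (∀ k, a k 0 ∈ eigenformSet θ (φ P)) ∧
      ∀ᶠ t in 𝓝[≠] 0, ¬ IsTurningPoint θ (φ (c.symm t)) := by
  obtain ⟨hc, hPs, hP0⟩ := hc
  have ht : (0 : ℂ) ∈ c.target := hP0 ▸ c.map_source hPs
  have hc0 : c.symm 0 = P := by rw [← hP0, c.left_inv hPs]
  have hQ : φ (c.symm 0) ∈ (chartAt ℂ (φ P)).source := by rw [hc0]; exact mem_chart_source ℂ _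
  have hζ := analyticAt_coordinateExpression hφ.holomorphic hc ht hQ
  set ζ := coordinateExpression φ c (φ P) with hζd
  have hζ0 : ζ 0 = 0 := by rw [hζd, coordinateExpression, hc0, sub_self]
  have hζc : ¬ ∀ᶠ t in 𝓝 0, ζ t = 0 := by
    have h1 := mt (eventually_coordinateExpression_eq_iff hφ.holomorphic.continuous ht hQ).mp
      (by rw [hc0]; exact not_eventually_eq hφ.holomorphic hφ.surjective P)
    rwa [← hζd, hζ0] at h1
  obtain ⟨T, hT, hpT⟩ := exists_endomorphism_family hθ.holomorphic (φ P)
  have hev := eventually_mem_target_and_source hφ.holomorphic.continuous ht hQ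
  obtain ⟨G, a, hm, hG, hp⟩ := _root_.exists_isPlanarModel (f := fun k => formCoefficient c (α k)) hζ hζ0
    hζc (fun k => (differentiableOn_formCoefficient hc (hφ.holomorphic_form k)).analyticAt
      (c.open_target.mem_nhds ht)) hT hpT
    (by
      filter_upwards [hev] with t h1 h2
      exact hφ.eigenPoly_eq hc h1.1 h1.2 h2) (hθ.generic _ hP)
  refine ⟨ζ, G, a, hm, hG, fun k => ?_, ?_⟩
  · change (eigenPoly θ (φ P) _).IsRoot _
    rw [hp, Polynomial.IsRoot.def, Polynomial.eval_prod]
    exact Finset.prod_eq_zero (Finset.mem_univ k) (by simp)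
  · have h1 : ∀ k l, k ≠ l → ∀ᶠ t in 𝓝[≠] 0,
        formCoefficient c (α k) t ≠ formCoefficient c (α l) t := by
      intro k l hkl
      filter_upwards [hm.eventually_deriv_sub_ne_zero hkl,
        (hG k).filter_mono nhdsWithin_le_nhds, (hG l).filter_mono nhdsWithin_le_nhds] with t h1 h2 h3
      rw [(h2.fun_sub h3).deriv] at h1
      exact sub_ne_zero.mp h1
    have h2 : ∀ᶠ t in 𝓝[≠] 0, ∀ k l, k ≠ l →
        formCoefficient c (α k) t ≠ formCoefficient c (α l) t :=
      eventually_all.mpr fun k => eventually_all.mpr fun l => eventually_imp_distrib_left.mpr (h1 k l)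
    filter_upwards [h2, hm.eventually_deriv_ne_zero, hev.filter_mono nhdsWithin_le_nhds]
      with t h3 h4 h5
    rw [hφ.isTurningPoint_iff hc h5.1
      ((deriv_coordinateExpression_ne_zero_iff hφ.holomorphic hc h5.1 h5.2).mp h4)]
    push Not
    exact h3

/-- By compactness it suffices that these points do not accumulate. At a turning point the planar
model separates the eigenforms on a punctured disc; elsewhere φ is unramified and distinctness of
the eigenforms is an open condition. -/
theorem IsSpectralCover.finite_isTurningPoint [ConnectedSpace Y] [CompactSpace Y]
    (hφ : IsSpectralCover θ φ α) (hθ : IsGeneralHiggsField F θ)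
    {c : Y → OpenPartialHomeomorph Y ℂ}
    (hc : ∀ P, IsTurningPoint θ (φ P) → IsCoordinateAt (c P) P) :
    {P : Y | IsTurningPoint θ (φ P)}.Finite := by
  by_contra hinf
  obtain ⟨y, hy⟩ := Set.Infinite.exists_accPt_principal hinf
  rw [accPt_iff_frequently_nhdsNE] at hy
  refine hy ?_
  by_cases hyt : IsTurningPoint θ (φ y)
  · obtain ⟨ζ, G, a, -, -, -, h1⟩ := hφ.exists_isPlanarModel hθ hyt (hc y hyt)
    obtain ⟨-, hs, h0⟩ := hc y hyt
    rw [eventually_nhdsWithin_iff] at h1 ⊢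
    rw [← h0] at h1
    filter_upwards [((c y).continuousAt hs).eventually h1, (c y).open_source.eventually_mem hs]
      with z h2 h3 h4
    rw [(c y).left_inv h3] at h2
    refine h2 fun h5 => h4 ?_
    exact (c y).injOn h3 hs h5
  · refine Eventually.filter_mono nhdsWithin_le_nhds ?_
    set c := chartAt ℂ y with hcd
    have hcm : c ∈ IsManifold.maximalAtlas 𝓘(ℂ) ω Y := IsManifold.chart_mem_maximalAtlas y
    have hyc : y ∈ c.source := mem_chart_source ℂ y
    have ht : c y ∈ c.target := c.map_source hyc
    have hcy : c.symm (c y) = y := c.left_inv hyc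
    have hQ : φ (c.symm (c y)) ∈ (chartAt ℂ (φ y)).source := by
      rw [hcy]; exact mem_chart_source ℂ _
    have hd : mfderiv 𝓘(ℂ) 𝓘(ℂ) φ (c.symm (c y)) ≠ 0 := by
      rw [hcy]; exact hφ.unramified y hyt
    have h1 := (hφ.isTurningPoint_iff hcm ht hd).not.mp (by rwa [hcy])
    push Not at h1
    have h2 : ∀ᶠ t in 𝓝 (c y), ∀ k l, k ≠ l →
        formCoefficient c (α k) t ≠ formCoefficient c (α l) t := by
      refine eventually_all.mpr fun k => eventually_all.mpr fun l =>
        eventually_imp_distrib_left.mpr fun hkl => ?_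
      have h3 : ∀ k, ContinuousAt (formCoefficient c (α k)) (c y) := fun k =>
        ((differentiableOn_formCoefficient hcm (hφ.holomorphic_form k)).differentiableAt
          (c.open_target.mem_nhds ht)).continuousAt
      filter_upwards [((h3 k).sub (h3 l)).eventually_ne (sub_ne_zero.mpr (h1 k l hkl))] with t h
      exact sub_ne_zero.mp h
    have h4 := (analyticAt_coordinateExpression hφ.holomorphic hcm ht hQ).deriv.continuousAt
    have h5 := h4.eventually_ne
      ((deriv_coordinateExpression_ne_zero_iff hφ.holomorphic hcm ht hQ).mpr hd)
    have h6 := eventually_mem_target_and_source hφ.holomorphic.continuous ht hQ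
    filter_upwards [(c.continuousAt hyc).eventually (h2.and (h5.and h6)),
      c.open_source.eventually_mem hyc] with z ⟨h7, h8, h9, h10⟩ h11
    have h12 := (hφ.isTurningPoint_iff hcm h9
      ((deriv_coordinateExpression_ne_zero_iff hφ.holomorphic hcm h9 h10).mp h8)).not.mpr
      (by push Not; exact h7)
    rwa [c.left_inv h11] at h12

end SpectralCover

/-! ## The pruning data of a turning point -/

section LocalData

open Filter ComplexConjugate
open scoped RealInnerProductSpace

variable {ι : Type*}

/-- The curve `t` follows the vector field `-conj (f i - f j)`, up to a non-negative factor. -/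
def IsDescentFlow (f : ι → ℂ → ℂ) (i j : ι) (t : ℝ → ℂ) (s : ℝ) : Prop :=
  ∀ τ ∈ Set.Icc 0 s, ∃ l : ℝ, 0 ≤ l ∧
    HasDerivWithinAt t (-(l * conj (f i (t τ) - f j (t τ)))) (Set.Icc 0 s) τ

/-- Certificates and potentials in a neighbourhood `O` of a turning point, with respect to the
discs of radius `ε` and `ξ`. -/
structure LocalData (f : ι → ℂ → ℂ) (O : Set ℂ) (M : ℕ) (ε ξ : ℝ) (Cert : ι → ι → ℂ → Prop)
    (Ψ : ι → ι → ℂ → ℕ) : Prop where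
  flow : ∀ {i j t s}, 0 ≤ s → IsDescentFlow f i j t s → (∀ τ ∈ Set.Icc 0 s, t τ ∈ O) →
    Cert i j (t 0) → Cert i j (t s)
  split : ∀ {i j x} m, x ∈ O → Cert i j x → Cert i m x ∨ Cert m j x
  bot : ∀ {i j x}, x ∈ O → ‖x‖ ≤ ε → ¬ Cert i j x
  le_bound : ∀ i j x, Ψ i j x ≤ M
  step_left : ∀ {i j t s}, 0 ≤ s → IsDescentFlow f i j t s →
    (∀ τ ∈ Set.Icc 0 s, t τ ∈ O ∧ ξ < ‖t τ‖) → ∀ m, ¬ Cert i m (t s) →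
    Ψ m j (t s) < Ψ i j (t 0)
  step_right : ∀ {i j t s}, 0 ≤ s → IsDescentFlow f i j t s →
    (∀ τ ∈ Set.Icc 0 s, t τ ∈ O ∧ ξ < ‖t τ‖) → ∀ m, ¬ Cert m j (t s) →
    Ψ i m (t s) < Ψ i j (t 0)

theorem neg_conj_inj {z w : ℂ} : -conj z = -conj w ↔ z = w := by
  rw [neg_inj, (starRingEnd ℂ).injective.eq_iff]

/-- The map z ↦ −conj z is real-linear, so parallel drifts come from collinear eigenforms. Through
this the non-parallel condition prevents a shedding from leaving the drift on the same ray. -/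
theorem collinear_of_sameRay_neg_conj {x y z : ℂ} (hxy : x ≠ y)
    (h : SameRay ℝ (-conj x - -conj y) (-conj z - -conj y)) (hzy : z ≠ y) :
    Collinear ℝ {x, z, y} := by
  obtain ⟨r₁, r₂, h₁, h₂, he⟩ := h.exists_pos
    (sub_ne_zero.mpr fun h => hxy (neg_conj_inj.mp h))
    (sub_ne_zero.mpr fun h => hzy (neg_conj_inj.mp h))
  have he' : (r₁ : ℂ) * (x - y) = r₂ * (z - y) := by
    have := congrArg conj he
    simp only [Complex.real_smul, map_mul, map_sub, map_neg, Complex.conj_conj,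
      Complex.conj_ofReal] at this
    linear_combination -this
  rw [collinear_iff_of_mem (p₀ := y) (by simp)]
  refine ⟨z - y, ?_⟩
  have h₁' : (r₁ : ℂ) ≠ 0 := by exact_mod_cast h₁.ne'
  rintro p (rfl | rfl | rfl)
  · refine ⟨r₂ / r₁, ?_⟩
    simp only [vadd_eq_add, Complex.real_smul, Complex.ofReal_div]
    field_simp
    linear_combination he'
  · exact ⟨1, by simp⟩
  · exact ⟨0, by simp⟩

/-- Certificates and potentials are evaluated at ζ(t) and G(t). Only the thresholds e, e' follow ε;
the directions N, and with them the bound M = 8|N| + 1, depend on the eigenforms at the turning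
point alone. -/
theorem IsPlanarModel.exists_localData [Finite ι] {ζ : ℂ → ℂ} {G a f : ι → ℂ → ℂ}
    (h : IsPlanarModel ζ G a) (hG : ∀ k, ∀ᶠ t in 𝓝 0, HasDerivAt (G k) (f k t) t)
    (hcol : ∀ k l m, a k 0 ≠ a l 0 → a k 0 ≠ a m 0 → a l 0 ≠ a m 0 →
      ¬ Collinear ℝ {a k 0, a l 0, a m 0}) :
    ∃ (M : ℕ) (C₀ : ℝ), 1 ≤ C₀ ∧ ∃ O ∈ 𝓝 (0 : ℂ), (∀ t ∈ O, t ≠ 0 → ∀ k l, k ≠ l →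
      f k t ≠ f l t) ∧ ∀ ε C : ℝ, 0 < ε → C₀ ≤ C → ∃ Cert Ψ, LocalData f O M ε (C * ε) Cert Ψ := by
  classical
  have := Fintype.ofFinite ι
  set B : ι → ℂ := fun k => -conj (a k 0) with hB
  have hBA : ∀ {k l}, B k = B l ↔ a k 0 = a l 0 := neg_conj_inj
  set D : Finset ℂ := (Finset.univ.image fun x : ι × ι => B x.1 - B x.2).erase 0 with hDd
  have hD : ∀ k l, B k ≠ B l → B k - B l ∈ D := fun k l hkl =>
    Finset.mem_erase.mpr ⟨sub_ne_zero.mpr hkl, Finset.mem_image.mpr ⟨(k, l), by simp, rfl⟩⟩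
  obtain ⟨N, κ, hN⟩ := exists_isDirectionSet D (fun d hd => (Finset.mem_erase.mp hd).1)
    (τ := 1 / 20) (by norm_num)
  -- The entry 3 gives Λ > 2, and 2/κ gives κΛ > 1.
  set Λ : ℝ := max 3 (2 / κ)
  have hΛ : 2 < Λ := lt_of_lt_of_le (by norm_num) (le_max_left _ _)
  have hκ : 1 < κ * Λ := by
    have h1 : κ * (2 / κ) ≤ κ * Λ := mul_le_mul_of_nonneg_left (le_max_right _ _) hN.pos.le
    rw [mul_div_cancel₀ _ hN.pos.ne'] at h1
    linarith
  obtain ⟨L, hL1, hL⟩ : ∃ L : ℝ, 1 ≤ L ∧ ∀ n ∈ N, ‖n‖ ≤ L := by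
    obtain ⟨L, hL⟩ := (N.finite_toSet.image norm).bddAbove
    exact ⟨max 1 L, le_max_left _ _, fun n hn =>
      (hL ⟨n, hn, rfl⟩).trans (le_max_right _ _)⟩
  obtain ⟨C₀, hC₀, O, hO, hth⟩ := h.exists_thresholds (lt_of_lt_of_le one_pos hL1)
    (show 1 ≤ Λ by linarith)
  obtain ⟨c, hc⟩ := h.exists_isModelPoint N
  have hG' : ∀ᶠ t in 𝓝 0, ∀ k, HasDerivAt (G k) (f k t) t := eventually_all.mpr hG
  have hder : ∀ {t : ℂ}, (∀ k, HasDerivAt (G k) (f k t) t) → ∀ i j,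
      deriv (fun z => G i z - G j z) t = f i t - f j t := fun ht i j =>
    ((ht i).fun_sub (ht j)).deriv
  refine ⟨8 * N.card + 1, C₀, hC₀, _, inter_mem hO (hc.and hG'), fun t ht h0 k l hkl => ?_, ?_⟩
  · have h1 := ht.2.1.ne_zero h0 k l hkl
    rw [hder ht.2.2] at h1
    exact sub_ne_zero.mp h1
  intro ε C hε hC
  obtain ⟨e, e', he, he', hthr⟩ := hth ε C hε hC
  set O' : Set ℂ := O ∩ {x | IsModelPoint ζ G a N c x ∧ ∀ k, HasDerivAt (G k) (f k x) x} with hO'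
  have hcurve : ∀ {i j t s}, IsDescentFlow f i j t s → (∀ τ ∈ Set.Icc 0 s, t τ ∈ O') →
      IsDescentCurve G i j t s := fun {i j t s} ht hmem τ hτ => by
    obtain ⟨l, hl, hd⟩ := ht τ hτ
    refine ⟨l, hl, ?_⟩
    rwa [hder (hmem τ hτ).2.2]
  have hsp : HasSinglePair B := fun k l k' l' h1 h2 h3 h4 =>
    h.singlePair k l k' l' h1 (hBA.mp h2) h3 (hBA.mp h4)
  have hray : ∀ i m j, B i ≠ B m → B m ≠ B j → B i ≠ B j →
      ¬ SameRay ℝ (B i - B j) (B m - B j) := fun i m j h1 h2 h3 h4 =>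
    hcol i m j (mt hBA.mpr h1) (mt hBA.mpr h3) (mt hBA.mpr h2)
      (collinear_of_sameRay_neg_conj (mt hBA.mpr h3) h4 (mt hBA.mpr h2))
  have hfar : ∀ {x}, x ∈ O' → C * ε < ‖x‖ → IsFar B Λ e e' (ζ x) fun k => G k x := fun hx hx' =>
    ⟨((hthr _ hx.1).2.1 hx').1, fun k l hkl hkl' => ((hthr _ hx.1).2.1 hx').2 k l hkl (hBA.mp hkl')⟩
  have hstep : ∀ {i j : ι} {t : ℝ → ℂ} {s : ℝ}, 0 ≤ s → IsDescentFlow f i j t s →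
      (∀ τ ∈ Set.Icc 0 s, t τ ∈ O' ∧ C * ε < ‖t τ‖) →
      IsFar B Λ e e' (ζ (t s)) (fun k => G k (t s)) ∧
      (B i ≠ B j → ∀ n ∈ N, 0 < ⟪n, B i - B j⟫ → ⟪n, ζ (t 0)⟫ ≤ ⟪n, ζ (t s)⟫) ∧
      (B i = B j → (G i (t s) - G j (t s)).re ≤ (G i (t 0) - G j (t 0)).re) ∧
      (B i ≠ B j → escapeSet B N e i j (ζ (t 0)) = escapeSet B N e i j (ζ (t s)) →
        ∀ k l, k ≠ l → B k = B l → |(G k (t s) - G l (t s)).im| ≤ e' →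
          0 < (G k (t s) - G l (t s)).re → 0 < (G k (t 0) - G l (t 0)).re) := by
    intro i j t s hs ht hmem
    have hs0 : (0 : ℝ) ∈ Set.Icc 0 s := ⟨le_rfl, hs⟩
    have hss : s ∈ Set.Icc 0 s := ⟨hs, le_rfl⟩
    have hcv := hcurve ht fun τ hτ => (hmem τ hτ).1
    have hmod : ∀ τ ∈ Set.Icc 0 s, IsModelPoint ζ G a N c (t τ) := fun τ hτ => (hmem τ hτ).1.2.1
    have hf := fun τ hτ => hfar (hmem τ hτ).1 (hmem τ hτ).2
    refine ⟨hf s hss, fun hij n hn hpos => IsModelPoint.monotoneOn_inner hmod hcv hn hpos hs0 hss hs,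
      fun _ => IsModelPoint.antitoneOn_re hmod hcv hs0 hss hs, ?_⟩
    intro hij hesc k l hkl hkl' him hre
    refine IsModelPoint.re_pos_of_escapeSet_eq hN le_rfl hκ hΛ he (hD i j hij) hs hmod
      (fun τ hτ h0 => ?_) hcv (fun τ hτ => (hf τ hτ).1) hesc hkl (hBA.mp hkl')
      ((hf s hss).2 k l hkl hkl') him hre
    have h1 := (hmem τ hτ).2
    rw [h0, norm_zero] at h1
    nlinarith
  refine ⟨fun i j x => IsCertified B N Λ e e' i j (ζ x) fun k => G k x,
    fun i j x => sheddingPotential B N e i j (ζ x) fun k => G k x, ?_, ?_, ?_,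
    fun i j x => sheddingPotential_le, ?_, ?_⟩
  · intro i j t s hs ht hmem hcert
    have hs0 : (0 : ℝ) ∈ Set.Icc 0 s := ⟨le_rfl, hs⟩
    have hss : s ∈ Set.Icc 0 s := ⟨hs, le_rfl⟩
    have hcv := hcurve ht hmem
    have hmod : ∀ τ ∈ Set.Icc 0 s, IsModelPoint ζ G a N c (t τ) := fun τ hτ => (hmem τ hτ).2.1
    rcases hcert with ⟨hij, n, hn, h1, h2⟩ | ⟨hij, hne, h1⟩ | ⟨rfl, h1⟩
    · exact Or.inl ⟨hij, n, hn, h1, h2.trans_le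
        (IsModelPoint.monotoneOn_inner hmod hcv hn h1 hs0 hss hs)⟩
    · refine Or.inr (Or.inl ⟨hij, hne, ?_⟩)
      rw [IsModelPoint.im_eq hmod hcv s hss]
      exact h1.imp_right fun h2 => (IsModelPoint.antitoneOn_re hmod hcv hs0 hss hs).trans_lt h2
    · refine Or.inr (Or.inr ⟨rfl, ?_⟩)
      rwa [hcv.eq_of_self s hss]
  · intro i j x m hx hcert
    exact hcert.split hN (by norm_num) hD he he' hκ hΛ hsp
      (fun k l hkl hkl' => (hthr x hx.1).2.2 k l hkl (hBA.mp hkl')) m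
  · intro i j x hx hxε hcert
    obtain ⟨h1, h2⟩ := (hthr x hx.1).1 hxε
    rcases hcert with ⟨hij, n, hn, -, h3⟩ | ⟨hij, hne, h3⟩ | ⟨rfl, h3⟩
    · have h4 := (real_inner_le_norm n (ζ x)).trans
        (mul_le_mul_of_nonneg_right (hL n hn) (norm_nonneg _))
      linarith
    · have h4 := h2 i j hne (hBA.mp hij)
      have h5 := Complex.abs_im_le_norm (G i x - G j x)
      have h6 := (abs_le.mp (Complex.abs_re_le_norm (G i x - G j x))).1
      rcases h3 with h3 | h3 <;> linarith
    · have h4 := h3.1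
      have h5 := mul_le_mul_of_nonneg_right hL1 (norm_nonneg (ζ x))
      nlinarith
  · intro i j t s hs ht hmem m hcert
    obtain ⟨h1, h2, h3, h4⟩ := hstep hs ht hmem
    exact sheddingPotential_lt_of_left hN (by norm_num) hD he he' hκ hΛ hsp hray h1 h2 h3 h4 hcert
  · intro i j t s hs ht hmem m hcert
    obtain ⟨h1, h2, h3, h4⟩ := hstep hs ht hmem
    exact sheddingPotential_lt_of_right hN (by norm_num) hD he he' hκ hΛ hsp hray h1 h2 h3 h4 hcert

end LocalData

/-! ## Energy bounds and the proof of the main theorem -/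

section Cutoff

open Filter

variable {Y : Type*} [TopologicalSpace Y] [ChartedSpace ℂ Y] [IsManifold 𝓘(ℂ) ω Y]
  {Z : Type*} [TopologicalSpace Z] [ChartedSpace ℂ Z] {r : ℕ}
  {α : Fin r → ∀ y : Y, TangentSpace 𝓘(ℂ) y →L[ℂ] ℂ} {π : Z → Y} {p : Z} {g : Fin r → Z → ℂ}

theorem IsMIntegralCurveOn.exists_hasDerivWithinAt_re_nonpos (h : ConformalMetric Y)
    (hπ : MDifferentiable 𝓘(ℂ) 𝓘(ℂ) π) (hg : ∀ i, IsIntegralFrom π (α i) p (g i)) {μ : ℝ}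
    (hμ : 0 ≤ μ) {i j : Fin r} {γ : ℝ → Z} {s : Set ℝ}
    (hγ : IsMIntegralCurveOn (I := 𝓘(ℝ, ℂ)) γ (flowField h π g μ i j) s) {τ : ℝ} (hτ : τ ∈ s) :
    ∃ d ≤ 0, HasDerivWithinAt (fun σ => (g i (γ σ) - g j (γ σ)).re) d s τ := by
  obtain ⟨l, hl, -, h1⟩ := hγ.hasDerivWithinAt_flowField
    (IsManifold.chart_mem_maximalAtlas (π (γ τ))) h hπ hg hμ hτ (mem_chart_source ℂ _)
  exact ⟨_, neg_nonpos.mpr (by positivity), h1⟩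

theorem exists_pos_le_norm_sub {f : Fin r → ℂ → ℂ} {K : Set ℂ} (hK : IsCompact K)
    (hf : ∀ k, ContinuousOn (f k) K) (hne : ∀ t ∈ K, ∀ k l, k ≠ l → f k t ≠ f l t) :
    ∃ η > 0, ∀ t ∈ K, ∀ k l, k ≠ l → η ≤ ‖f k t - f l t‖ := by
  have h1 : ∀ k l, ∀ᶠ η in 𝓝[>] (0 : ℝ), ∀ t ∈ K, k ≠ l → η ≤ ‖f k t - f l t‖ := by
    intro k l
    by_cases hkl : k = l
    · exact Eventually.of_forall fun η t ht h => absurd hkl h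
    obtain ⟨η, hη, h2⟩ : ∃ η > 0, ∀ t ∈ K, η ≤ ‖f k t - f l t‖ := by
      rcases K.eq_empty_or_nonempty with rfl | hKn
      · exact ⟨1, one_pos, by simp⟩
      obtain ⟨t₀, ht₀, hmin⟩ := hK.exists_isMinOn hKn ((hf k).sub (hf l)).norm
      exact ⟨_, norm_pos_iff.mpr (sub_ne_zero.mpr (hne t₀ ht₀ k l hkl)), fun t ht => hmin ht⟩
    filter_upwards [Ioc_mem_nhdsGT hη] with η' hη' t ht _
    exact hη'.2.trans (h2 t ht)
  obtain ⟨η, h2, h3⟩ := ((eventually_all.mpr fun k => eventually_all.mpr (h1 k)).and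
    self_mem_nhdsWithin).exists
  exact ⟨η, h3, fun t ht k l => h2 k l t ht⟩

/-- A function on `Z` that is `0` on the smaller and `1` outside the larger disc, and that a flow
curve of `W i j` can decrease only if it decreases `Re g_{ij}`. -/
theorem exists_cutoff [T2Space Y] {c : OpenPartialHomeomorph Y ℂ}
    (hc : c ∈ IsManifold.maximalAtlas 𝓘(ℂ) ω Y) (h : ConformalMetric Y)
    (hα : ∀ i, ContMDiff 𝓘(ℂ) (𝓘(ℂ).prod 𝓘(ℂ, ℂ →L[ℂ] ℂ)) ω
      (fun y => Bundle.TotalSpace.mk' (ℂ →L[ℂ] ℂ) y (α i y)))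
    (hπ : MDifferentiable 𝓘(ℂ) 𝓘(ℂ) π) (hg : ∀ i, IsIntegralFrom π (α i) p (g i))
    {ρ₁ ρ₂ : ℝ} (hρ₁ : 0 < ρ₁) (hρ₂ : ρ₁ < ρ₂) (hball : Metric.closedBall 0 ρ₂ ⊆ c.target)
    (hne : ∀ t, ‖t‖ ≤ ρ₂ → t ≠ 0 → ∀ k l, k ≠ l →
      formCoefficient c (α k) t ≠ formCoefficient c (α l) t) :
    ∃ (H : Z → ℝ) (δ : ℝ), 0 < δ ∧ (∀ z, π z ∈ c.source → ‖c (π z)‖ ≤ ρ₁ → H z = 0) ∧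
      (∀ z, ¬ (π z ∈ c.source ∧ ‖c (π z)‖ ≤ ρ₂) → H z = 1) ∧
      ∀ μ, 0 < μ → ∀ (i j : Fin r) (γ : ℝ → Z) (s : ℝ),
        IsMIntegralCurveOn (I := 𝓘(ℝ, ℂ)) γ (flowField h π g μ i j) (Set.Icc 0 s) →
        ∀ t₁ t₂, 0 ≤ t₁ → t₁ ≤ t₂ → t₂ ≤ s →
          δ * (H (γ t₁) - H (γ t₂)) ≤
            ((g i (γ t₁)).re - (g j (γ t₁)).re) - ((g i (γ t₂)).re - (g j (γ t₂)).re) := by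
  classical
  set χ : ContDiffBump (0 : ℂ) := ⟨ρ₁, ρ₂, hρ₁, hρ₂⟩ with hχ
  have hχd : ∀ t, HasFDerivAt χ (fderiv ℝ χ t) t := fun t =>
    ((χ.contDiff (n := 1)).differentiable one_ne_zero t).hasFDerivAt
  obtain ⟨K, hK⟩ : ∃ K, ∀ t, ‖fderiv ℝ χ t‖ ≤ K := by
    have h1 : Continuous (fderiv ℝ χ) := (χ.contDiff (n := 1)).continuous_fderiv one_ne_zero
    exact (χ.hasCompactSupport.fderiv (𝕜 := ℝ)).exists_bound_of_continuous h1
  have hK0 : 0 ≤ K := (norm_nonneg _).trans (hK 0)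
  set f := fun k => formCoefficient c (α k) with hf
  obtain ⟨η, hη, hηf⟩ := exists_pos_le_norm_sub (f := f)
    (K := Metric.closedBall 0 ρ₂ ∩ {t | ρ₁ ≤ ‖t‖})
    ((isCompact_closedBall 0 ρ₂).inter_right (isClosed_le continuous_const continuous_norm))
    (fun k => (differentiableOn_formCoefficient hc (hα k)).continuousOn.mono
      (Set.inter_subset_left.trans hball))
    (fun t ht => hne t (mem_closedBall_zero_iff.mp ht.1) fun h0 => by
      have h1 : ρ₁ ≤ ‖t‖ := ht.2
      rw [h0, norm_zero] at h1
      linarith)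
  have hzero : ∀ t, ¬ (ρ₁ ≤ ‖t‖ ∧ ‖t‖ ≤ ρ₂) → fderiv ℝ χ t = 0 := by
    intro t ht
    rw [not_and_or, not_le, not_le] at ht
    rcases ht with ht | ht
    · have h1 : (χ : ℂ → ℝ) =ᶠ[𝓝 t] fun _ => 1 := by
        filter_upwards [Metric.isOpen_ball.mem_nhds (mem_ball_zero_iff.mpr ht)] with x hx
        exact χ.one_of_mem_closedBall (Metric.ball_subset_closedBall hx)
      rw [h1.fderiv_eq, fderiv_fun_const]
      rfl
    · have h1 : (χ : ℂ → ℝ) =ᶠ[𝓝 t] fun _ => 0 := by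
        filter_upwards [(isOpen_lt continuous_const continuous_norm).mem_nhds ht] with x hx
        exact χ.zero_of_le_dist (by rw [dist_zero_right]; exact le_of_lt hx)
      rw [h1.fderiv_eq, fderiv_fun_const]
      rfl
  -- The coordinate is meaningless off its source; closedness of the disc makes the cut-off constant
  -- near every point there.
  have hclosed : IsClosed {y | y ∈ c.source ∧ ‖c y‖ ≤ ρ₂} := by
    have h1 : {y | y ∈ c.source ∧ ‖c y‖ ≤ ρ₂} = c.symm '' Metric.closedBall 0 ρ₂ := by
      ext y
      constructor
      · rintro ⟨h2, h3⟩
        exact ⟨c y, mem_closedBall_zero_iff.mpr h3, c.left_inv h2⟩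
      · rintro ⟨t, ht, rfl⟩
        refine ⟨c.map_target (hball ht), ?_⟩
        rw [c.right_inv (hball ht)]
        exact mem_closedBall_zero_iff.mp ht
    rw [h1]
    exact ((isCompact_closedBall 0 ρ₂).image_of_continuousOn
      (c.continuousOn_symm.mono hball)).isClosed
  set H : Z → ℝ := fun z => if π z ∈ c.source then 1 - χ (c (π z)) else 1 with hH
  have hH1 : ∀ z, ¬ (π z ∈ c.source ∧ ‖c (π z)‖ ≤ ρ₂) → H z = 1 := by
    intro z hz
    by_cases hs : π z ∈ c.source
    · have h1 : ρ₂ ≤ ‖c (π z)‖ := by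
        by_contra! h2
        exact hz ⟨hs, h2.le⟩
      rw [hH]
      simp only [hs, if_true]
      rw [χ.zero_of_le_dist (by rw [dist_zero_right]; exact h1), sub_zero]
    · simp only [hH, hs, if_false]
  -- K bounds the differential of the bump function and η bounds |f_i − f_j| below on the collar;
  -- the summand 1 avoids division by zero.
  refine ⟨H, η / (K + 1), by positivity, fun z hz hz' => ?_, hH1, ?_⟩
  · simp only [hH, hz, if_true]
    rw [χ.one_of_mem_closedBall (mem_closedBall_zero_iff.mpr hz'), sub_self]
  intro μ hμ i j γ s hγ
  set δ := η / (K + 1) with hδ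
  have hδ0 : 0 ≤ δ := by positivity
  have hmono : MonotoneOn (fun τ => δ * H (γ τ) - (g i (γ τ) - g j (γ τ)).re) (Set.Icc 0 s) := by
    refine monotoneOn_of_hasDerivWithinAt fun τ hτ => ?_
    have hcont : ContinuousWithinAt (fun σ => π (γ σ)) (Set.Icc 0 s) τ :=
      (hπ (γ τ)).continuousAt.comp_continuousWithinAt (hγ τ hτ).1
    by_cases hs : π (γ τ) ∈ c.source
    · obtain ⟨l, hl, h1, h2⟩ := hγ.hasDerivWithinAt_flowField hc h hπ hg hμ.le hτ hs
      have h3 := (hχd (c (π (γ τ)))).comp_hasDerivWithinAt τ h1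
      have h4 : (fun σ => H (γ σ)) =ᶠ[𝓝[Set.Icc 0 s] τ] fun σ => 1 - χ (c (π (γ σ))) := by
        filter_upwards [hcont.eventually (c.open_source.mem_nhds hs)] with σ hσ
        exact if_pos hσ
      have h5 := ((h3.const_sub 1).congr_of_eventuallyEq h4
        (by simp only [hH, hs, if_true]; rfl)).const_mul δ
      refine ⟨_, ?_, h5.sub h2⟩
      set t := c (π (γ τ))
      set F := formCoefficient c (α i) t - formCoefficient c (α j) t with hF
      set v : ℂ := -(l * (starRingEnd ℂ) F) with hv
      have hvn : ‖v‖ = l * ‖F‖ := by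
        rw [hv, norm_neg, norm_mul, Complex.norm_conj, Complex.norm_real, Real.norm_of_nonneg hl]
      -- The cut-off varies at rate at most K l‖F‖ and the energy at rate l‖F‖², with ‖F‖ ≥ η
      -- wherever the bump function varies; l cancels.
      have h6 : δ * (fderiv ℝ χ t v) ≤ l * ‖F‖ ^ 2 := by
        by_cases han : (ρ₁ ≤ ‖t‖ ∧ ‖t‖ ≤ ρ₂) ∧ i ≠ j
        · have h7 : η ≤ ‖F‖ := hηf t ⟨mem_closedBall_zero_iff.mpr han.1.2, han.1.1⟩ i j han.2
          have h8 : fderiv ℝ χ t v ≤ K * (l * ‖F‖) := by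
            rw [← hvn]
            exact (le_abs_self _).trans ((fderiv ℝ χ t).le_of_opNorm_le (hK t) v)
          have h9 : δ * K ≤ η := by
            rw [hδ, div_mul_eq_mul_div, div_le_iff₀ (by positivity)]
            nlinarith
          calc δ * (fderiv ℝ χ t v) ≤ δ * (K * (l * ‖F‖)) := mul_le_mul_of_nonneg_left h8 hδ0
            _ = (δ * K) * (l * ‖F‖) := by ring
            _ ≤ ‖F‖ * (l * ‖F‖) := mul_le_mul_of_nonneg_right (h9.trans h7) (by positivity)
            _ = l * ‖F‖ ^ 2 := by ring
        · have h7 : fderiv ℝ χ t v = 0 := by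
            by_cases hij : i = j
            · have : v = 0 := by rw [hv, hF, hij, sub_self, map_zero, mul_zero, neg_zero]
              rw [this, map_zero]
            · rw [hzero t fun h => han ⟨h, hij⟩]
              rfl
          rw [h7, mul_zero]
          positivity
      change 0 ≤ δ * -(fderiv ℝ χ t v) - -(l * ‖F‖ ^ 2)
      linarith
    · obtain ⟨d, hd, h1⟩ := hγ.exists_hasDerivWithinAt_re_nonpos h hπ hg hμ.le hτ
      have hnot : π (γ τ) ∈ {y | y ∈ c.source ∧ ‖c y‖ ≤ ρ₂}ᶜ := fun h => hs h.1
      have h4 : (fun σ => H (γ σ)) =ᶠ[𝓝[Set.Icc 0 s] τ] fun σ => 1 := by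
        filter_upwards [hcont.eventually (hclosed.isOpen_compl.mem_nhds hnot)] with σ hσ
        exact hH1 _ hσ
      have h5 := ((hasDerivWithinAt_const τ (Set.Icc 0 s) (1 : ℝ)).congr_of_eventuallyEq h4
        (hH1 _ fun h => hs h.1)).const_mul δ
      exact ⟨_, by linarith, h5.sub h1⟩
  intro t₁ t₂ h1 h2 h3
  have := hmono ⟨h1, h2.trans h3⟩ ⟨h1.trans h2, h3⟩ h2
  simp only [Complex.sub_re] at this
  linarith

end Cutoff

/-! ### From single branches to furnished trees -/

section Branches

open EdgeTree

variable {ι Z σ : Type*}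

/-- The pruning bound for a furnished tree. -/
theorem FurnishedTree.exists_prune {Fl : ι → ι → (ℝ → Z) → ℝ → Prop} {g : ι → Z → ℂ} {A B : Set Z}
    {V U : σ → Set Z} {H : σ → Z → ℝ} {Cert : σ → ι → ι → Z → Prop}
    {Ψ : σ → ι → ι → Z → ℕ} {M : ℕ} {δ δ' : ℝ}
    (h : CountingData Fl (fun i z => (g i z).re) A B V U H Cert Ψ M δ δ') {κ : ℝ}
    (hκ : 2 * M + 1 ≤ κ * δ) (hκ' : M + 1 ≤ κ * δ') (hκ0 : 0 ≤ κ) (T : FurnishedTree ι Z)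
    (Φ : Fin T.k → List Bool → ℝ → Z) (hT : ∀ l, (T.branch l).FlowsBy Fl (Φ l) (T.top l))
    (htop : ∀ v ∈ T.tops, ∀ P, v.2.2 ∉ V P) (hbot : ∀ v ∈ T.bottoms Φ, v.2.2 ∈ A) {q : Z} {F₀ : ℝ}
    (hF : (T.gValue g q T.tops).re - F₀ ≤ (T.gValue g q (T.bottoms Φ)).re) :
    ∃ b : ∀ l : Fin T.k, EdgeTree ι (T.index l.castSucc) (T.index l.succ),
      (∀ l, (T.branch l).Prunes (b l)) ∧ (∀ v ∈ (T.withBranches b).bottoms Φ, v.2.2 ∈ B) ∧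
      (((T.withBranches b).bottoms Φ).length : ℝ) ≤ 2 ^ (M + 1) * κ * F₀ := by
  have hA : ∀ l, ∀ v ∈ (T.branch l).bottoms (Φ l), v.2.2 ∈ A := fun l v hv =>
    hbot v (List.mem_flatten.mpr ⟨_, List.mem_ofFn.mpr ⟨l, rfl⟩, hv⟩)
  -- The tops lie outside every `V P`, so no branch is cheap and the linear bound applies to each.
  have hE : ∀ l, δ ≤ (T.branch l).energy (fun i z => (g i z).re) (Φ l) (T.top l) := by
    intro l
    by_contra! hlt
    obtain ⟨P, hP⟩ := h.mem_of_energy_lt (hT l) (hA l) hlt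
    exact htop _ (List.mem_ofFn.mpr ⟨l, rfl⟩) P hP
  choose b hb1 hb2 _ hb4 using fun l => h.exists_prune hκ hκ' (hT l) (hA l)
  refine ⟨b, hb1, ?_, ?_⟩
  · intro v hv
    obtain ⟨L, hL, hvL⟩ := List.mem_flatten.mp hv
    obtain ⟨l, rfl⟩ := List.mem_ofFn.mp hL
    exact hb2 l v hvL
  · have hre : ∀ L : List (ι × ι × Z), (T.gValue g q L).re =
        (L.map fun v => (g v.1 v.2.2).re - (g v.2.1 v.2.2).re).sum +
          (g (T.index (Fin.last T.k)) q).re := by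
      intro L
      rw [FurnishedTree.gValue, Complex.add_re]
      congr 1
      induction L with
      | nil => simp
      | cons v L ih => simp [ih]
    -- The terms at q cancel, so the energies add up to Re g(top) − Re g(bot).
    have hsum : ∑ l, (T.branch l).energy (fun i z => (g i z).re) (Φ l) (T.top l) ≤ F₀ := by
      rw [hre, hre, FurnishedTree.tops, FurnishedTree.bottoms, List.map_ofFn, List.sum_ofFn,
        List.map_flatten, List.sum_flatten, List.map_map, List.map_ofFn, List.sum_ofFn] at hF
      simp only [EdgeTree.energy, Finset.sum_sub_distrib, Function.comp] at hF ⊢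
      linarith
    have hlen : (((T.withBranches b).bottoms Φ).length : ℝ) =
        ∑ l, (((b l).bottoms (Φ l)).length : ℝ) := by
      change ((List.ofFn fun l => (b l).bottoms (Φ l)).flatten.length : ℝ) = _
      rw [List.length_flatten, List.map_ofFn, List.sum_ofFn]
      push_cast
      rfl
    rw [hlen]
    calc ∑ l, (((b l).bottoms (Φ l)).length : ℝ)
        ≤ ∑ l, 2 ^ (M + 1) * κ * (T.branch l).energy (fun i z => (g i z).re) (Φ l) (T.top l) := by
          refine Finset.sum_le_sum fun l _ => ((hb4 l (hE l)).1).trans ?_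
          rw [mul_assoc]
          gcongr
          linarith [(Nat.cast_nonneg M : (0 : ℝ) ≤ M)]
      _ = 2 ^ (M + 1) * κ *
          ∑ l, (T.branch l).energy (fun i z => (g i z).re) (Φ l) (T.top l) := by
          rw [Finset.mul_sum]
      _ ≤ 2 ^ (M + 1) * κ * F₀ := by gcongr

end Branches

/-! ### Uniform constants over all turning points -/

section Assembly

open Filter EdgeTree

variable {X : Type*} [TopologicalSpace X] [ChartedSpace ℂ X] [IsManifold 𝓘(ℂ) ω X]
  {F : Type*} [NormedAddCommGroup F] [NormedSpace ℂ F] [FiniteDimensional ℂ F]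
  {E : X → Type*} [TopologicalSpace (Bundle.TotalSpace F E)] [∀ P, TopologicalSpace (E P)]
  [∀ P, AddCommGroup (E P)] [∀ P, Module ℂ (E P)] [∀ P, IsTopologicalAddGroup (E P)]
  [∀ P, ContinuousSMul ℂ (E P)] [FiberBundle F E] [VectorBundle ℂ F E]
  [ContMDiffVectorBundle ω F E 𝓘(ℂ)] [∀ P, FiniteDimensional ℂ (E P)]
  {θ : ∀ P : X, TangentSpace 𝓘(ℂ) P →L[ℂ] E P →L[ℂ] E P}
  {Y : Type*} [TopologicalSpace Y] [ChartedSpace ℂ Y] [IsManifold 𝓘(ℂ) ω Y]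
  {φ : Y → X} {r : ℕ} {α : Fin r → ∀ y : Y, TangentSpace 𝓘(ℂ) y →L[ℂ] ℂ}
  {Z : Type*} [TopologicalSpace Z] [ChartedSpace ℂ Z]
  {π : Z → Y} {p : Z} {g : Fin r → Z → ℂ}

theorem IsSpectralCover.exists_localData [ConnectedSpace Y] (hφ : IsSpectralCover θ φ α)
    (hθ : IsGeneralHiggsField F θ) {P : Y} (hP : IsTurningPoint θ (φ P))
    {c : OpenPartialHomeomorph Y ℂ} (hc : IsCoordinateAt c P) :
    ∃ (M : ℕ) (C₀ : ℝ), 1 ≤ C₀ ∧ ∃ O ∈ 𝓝 (0 : ℂ), (∀ t ∈ O, t ≠ 0 → ∀ k l, k ≠ l →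
      formCoefficient c (α k) t ≠ formCoefficient c (α l) t) ∧
      ∀ ε C : ℝ, 0 < ε → C₀ ≤ C →
        ∃ Cert Ψ, LocalData (fun k => formCoefficient c (α k)) O M ε (C * ε) Cert Ψ := by
  obtain ⟨ζ, G, a, hm, hG, ha, -⟩ := hφ.exists_isPlanarModel hθ hP hc
  exact hm.exists_localData hG fun k l m =>
    (hθ.nonParallel _ hP).1 _ (ha k) _ (ha l) _ (ha m)

theorem exists_forall_le_of_finite {σ : Type*} [Finite σ] (f : σ → ℝ) : ∃ C, ∀ P, f P ≤ C :=
  let ⟨C, hC⟩ := (Set.finite_range f).bddAbove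
  ⟨C, fun P => hC ⟨P, rfl⟩⟩

theorem exists_pos_forall_le_of_finite {σ : Type*} [Finite σ] {f : σ → ℝ} (hf : ∀ P, 0 < f P) :
    ∃ ρ > 0, ∀ P, ρ ≤ f P := by
  obtain ⟨ρ, h1, h2⟩ := ((eventually_all.mpr fun P => Ioc_mem_nhdsGT (hf P)).and
    (self_mem_nhdsWithin (a := (0 : ℝ)) (s := Set.Ioi 0))).exists
  exact ⟨ρ, h2, fun P => (h1 P).2⟩

/-- There are finitely many turning points on Y, so the radii and constants of the local models have
common bounds. With w' = (u + w)/2, the collar from u to w' gives the cost δ of leaving `V` (radius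
w'), and the collar from w' to w the cost δ' of entering `V` from outside `U` (radius w). Neither
cost involves ε or μ. -/
theorem exists_countingData [T2Space Y] [CompactSpace Y] [ConnectedSpace Y]
    (hφ : IsSpectralCover θ φ α) (hθ : IsGeneralHiggsField F θ)
    (hπ : ContMDiff 𝓘(ℂ) 𝓘(ℂ) ω π) (hg : ∀ i, IsIntegralFrom π (α i) p (g i))
    (h : ConformalMetric Y) {c : Y → OpenPartialHomeomorph Y ℂ}
    (hc : ∀ P, IsTurningPoint θ (φ P) → IsCoordinateAt (c P) P) :
    ∃ w₀ : ℝ, 0 < w₀ ∧ ∃ C : ℝ, 1 ≤ C ∧ ∃ M : ℕ,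
      ∀ u w : ℝ, 0 < u → u < w → w ≤ w₀ → ∃ δ δ' : ℝ, 0 < δ ∧ 0 < δ' ∧
        ∀ ε ξ : ℝ, 0 < ε → ξ = C * ε → ξ < u → ∀ μ : ℝ, 0 < μ →
          ∃ (V U : {P : Y | IsTurningPoint θ (φ P)} → Set Z) (H : _ → Z → ℝ)
            (Cert : _ → Fin r → Fin r → Z → Prop) (Ψ : _ → Fin r → Fin r → Z → ℕ),
            CountingData (fun i j γ s => IsMIntegralCurveOn (I := 𝓘(ℝ, ℂ)) γ
              (flowField h π g μ i j) (Set.Icc 0 s)) (fun i z => (g i z).re)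
              (discs π {P | IsTurningPoint θ (φ P)} c ε)
              (discs π {P | IsTurningPoint θ (φ P)} c ξ) V U H Cert Ψ M δ δ' ∧
            ∀ P, V P ⊆ discs π {P | IsTurningPoint θ (φ P)} c w := by
  set S : Set Y := {P : Y | IsTurningPoint θ (φ P)} with hS
  have hfin : S.Finite := hφ.finite_isTurningPoint hθ hc
  have : Finite S := hfin.to_subtype
  have hπd : MDifferentiable 𝓘(ℂ) 𝓘(ℂ) π := hπ.mdifferentiable (by simp)
  choose M C₀ hC₀ O hO hne hloc using fun P : S => hφ.exists_localData hθ P.2 (hc P P.2)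
  -- Disjoint neighbourhoods keep the discs of different turning points apart.
  obtain ⟨W, hW, hWd⟩ := hfin.t2_separation
  have hnhds : ∀ P : S, ∃ ρ > 0, Metric.closedBall 0 ρ ⊆
      (c P).target ∩ O P ∩ (c P).symm ⁻¹' W P := by
    intro P
    obtain ⟨-, hPs, hP0⟩ := hc P P.2
    have h0 : (0 : ℂ) ∈ (c P).target := hP0 ▸ (c P).map_source hPs
    have h1 : (c P).symm 0 = P := by rw [← hP0, (c P).left_inv hPs]
    refine Metric.nhds_basis_closedBall.mem_iff.mp (inter_mem (inter_mem
      ((c P).open_target.mem_nhds h0) (hO P)) (((c P).continuousAt_symm h0).preimage_mem_nhds ?_))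
    rw [h1]
    exact (hW P).2.mem_nhds (hW P).1
  choose ρ hρ hρsub using hnhds
  obtain ⟨w₀, hw₀, hw₀ρ⟩ := exists_pos_forall_le_of_finite hρ
  obtain ⟨C, hC⟩ := exists_forall_le_of_finite C₀
  obtain ⟨M', hM'⟩ : ∃ M', ∀ P, M P ≤ M' :=
    let ⟨C, hC⟩ := (Set.finite_range M).bddAbove
    ⟨C, fun P => hC ⟨P, rfl⟩⟩
  refine ⟨w₀, hw₀, max 1 C, le_max_left _ _, M', ?_⟩
  intro u w hu huw hw
  have hball : ∀ P : S, ∀ t : ℂ, ‖t‖ ≤ w → t ∈ (c P).target ∧ t ∈ O P ∧ (c P).symm t ∈ W P := by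
    intro P t ht
    have h1 := hρsub P (mem_closedBall_zero_iff.mpr (ht.trans (hw.trans (hw₀ρ P))))
    exact ⟨h1.1.1, h1.1.2, h1.2⟩
  set w' := (u + w) / 2 with hw'
  have huw' : u < w' := by rw [hw']; linarith
  have hww' : w' < w := by rw [hw']; linarith
  have hcut : ∀ ρ₁ ρ₂, 0 < ρ₁ → ρ₁ < ρ₂ → ρ₂ ≤ w → ∀ P : S, _ := fun ρ₁ ρ₂ h1 h2 h3 P =>
    exists_cutoff (hc P P.2).1 h hφ.holomorphic_form hπd hg h1 h2
      (fun t ht => (hball P t ((mem_closedBall_zero_iff.mp ht).trans h3)).1)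
      (fun t ht => hne P t (hball P t (ht.trans h3)).2.1)
  choose H δP hδP hH0 hH1 hHf using hcut u w' hu huw' hww'.le
  choose H' δP' hδP' hH0' hH1' hHf' using hcut w' w (hu.trans huw') hww' le_rfl
  obtain ⟨δ, hδ, hδle⟩ := exists_pos_forall_le_of_finite hδP
  obtain ⟨δ', hδ', hδle'⟩ := exists_pos_forall_le_of_finite hδP'
  refine ⟨δ, δ', hδ, hδ', ?_⟩
  intro ε ξ hε hξ hξu μ hμ
  have hCC : ∀ P, C₀ P ≤ max 1 C := fun P => (hC P).trans (le_max_right _ _)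
  choose Cert Ψ hdata using fun P : S => hloc P ε (max 1 C) hε (hCC P)
  have hεξ : ε ≤ ξ := by
    rw [hξ]
    nlinarith [le_max_left 1 C]
  set D : S → ℝ → Set Z := fun P ρ => {z | π z ∈ (c P).source ∧ ‖c P (π z)‖ ≤ ρ} with hD
  have hDmono : ∀ {P : S} {ρ₁ ρ₂ : ℝ}, ρ₁ ≤ ρ₂ → D P ρ₁ ⊆ D P ρ₂ := fun h z hz =>
    ⟨hz.1, hz.2.trans h⟩
  have hmono : ∀ {i j : Fin r} {γ : ℝ → Z} {s : ℝ}, IsMIntegralCurveOn (I := 𝓘(ℝ, ℂ)) γ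
      (flowField h π g μ i j) (Set.Icc 0 s) → ∀ t₁ t₂, 0 ≤ t₁ → t₁ ≤ t₂ → t₂ ≤ s →
      (g i (γ t₂)).re - (g j (γ t₂)).re ≤ (g i (γ t₁)).re - (g j (γ t₁)).re := by
    intro i j γ s hγ t₁ t₂ h1 h2 h3
    have hm : MonotoneOn (fun τ => -(g i (γ τ) - g j (γ τ)).re) (Set.Icc 0 s) :=
      monotoneOn_of_hasDerivWithinAt fun τ hτ => by
        obtain ⟨d, hd, h4⟩ := hγ.exists_hasDerivWithinAt_re_nonpos h hπd hg hμ.le hτ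
        exact ⟨-d, by linarith, h4.neg⟩
    have := hm ⟨h1, h2.trans h3⟩ ⟨h1.trans h2, h3⟩ h2
    simp only [Complex.sub_re] at this
    linarith
  have hflow : ∀ {i j : Fin r} {γ : ℝ → Z} {s : ℝ}, IsMIntegralCurveOn (I := 𝓘(ℝ, ℂ)) γ
      (flowField h π g μ i j) (Set.Icc 0 s) → ∀ P : S,
      (∀ τ ∈ Set.Icc 0 s, γ τ ∈ D P w) →
      IsDescentFlow (fun k => formCoefficient (c P) (α k)) i j (fun τ => c P (π (γ τ))) s := by
    intro i j γ s hγ P hmem τ hτ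
    obtain ⟨l, hl, h1, -⟩ := hγ.hasDerivWithinAt_flowField (hc P P.2).1 h hπd hg hμ.le hτ
      (hmem τ hτ).1
    exact ⟨l, hl, h1⟩
  have hstep : ∀ {i j : Fin r} {γ : ℝ → Z} {s : ℝ}, IsMIntegralCurveOn (I := 𝓘(ℝ, ℂ)) γ
      (flowField h π g μ i j) (Set.Icc 0 s) → ∀ P : S,
      (∀ t, 0 ≤ t → t ≤ s → γ t ∈ D P w ∧ γ t ∉ discs π S c ξ) →
      IsDescentFlow (fun k => formCoefficient (c P) (α k)) i j (fun τ => c P (π (γ τ))) s ∧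
      ∀ τ ∈ Set.Icc 0 s, c P (π (γ τ)) ∈ O P ∧ max 1 C * ε < ‖c P (π (γ τ))‖ := by
    intro i j γ s hγ P hmem
    refine ⟨hflow hγ P fun τ hτ => (hmem τ hτ.1 hτ.2).1, fun τ hτ => ?_⟩
    obtain ⟨h1, h2⟩ := hmem τ hτ.1 hτ.2
    refine ⟨(hball P _ h1.2).2.1, ?_⟩
    by_contra! h3
    exact h2 ⟨P, P.2, h1.1, by rwa [hξ]⟩
  -- Replacing the individual cost by the common smaller one is harmless also when the cut-off
  -- increases, because energy losses are non-negative.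
  have hscale : ∀ {δ₀ δ₁ x y : ℝ}, 0 ≤ δ₀ → δ₀ ≤ δ₁ → 0 ≤ y → δ₁ * x ≤ y → δ₀ * x ≤ y := by
    intro δ₀ δ₁ x y h0 h1 h2 h3
    rcases le_or_gt 0 x with h4 | h4
    · exact (mul_le_mul_of_nonneg_right h1 h4).trans h3
    · nlinarith
  have hdisj : ∀ (P Q : S) z, z ∈ D P w → z ∈ D Q w → P = Q := by
    intro P Q z hP hQ
    by_contra hne'
    have h1 : ∀ R : S, z ∈ D R w → π z ∈ W R := fun R hR => by
      have := (hball R _ hR.2).2.2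
      rwa [(c R).left_inv hR.1] at this
    exact Set.disjoint_left.mp (hWd P.2 Q.2 fun h => hne' (Subtype.ext h)) (h1 P hP) (h1 Q hQ)
  refine ⟨fun P => D P w', fun P => D P w, H, fun P i j z => Cert P i j (c P (π z)),
    fun P i j z => Ψ P i j (c P (π z)), ?_, fun P z hz => ⟨P, P.2, hDmono hww'.le hz⟩⟩
  refine
    { mono := hmono
      subset := fun z ⟨P, hP, h1, h2⟩ => ⟨P, hP, h1, h2.trans hεξ⟩
      sub := fun P => hDmono hww'.le
      disj := hdisj
      pos := hδ
      cutoff := ?_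
      cutoff_one := fun P z hz => hH1 P z hz
      cutoff_zero := ?_
      enter := ?_
      cert_flow := ?_
      cert_split := ?_
      cert_bot := ?_
      le_bound := fun P i j z => ((hdata P).le_bound i j _).trans (hM' P)
      step_left := ?_
      step_right := ?_ }
  · intro i j γ s hγ P t₁ t₂ h1 h2 h3
    exact hscale hδ.le (hδle P) (by linarith [hmono hγ t₁ t₂ h1 h2 h3])
      (hHf P μ hμ i j γ s hγ t₁ t₂ h1 h2 h3)
  · rintro z ⟨P, hP, h1, h2⟩
    exact ⟨⟨P, hP⟩, hH0 ⟨P, hP⟩ z h1 (h2.trans (hεξ.trans hξu.le))⟩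
  · intro i j γ s hγ P t h1 h2 h3 h4
    have h5 := hHf' P μ hμ i j γ s hγ t s h1 h2 le_rfl
    rw [hH1' P _ h3, hH0' P _ h4.1 h4.2, sub_zero, mul_one] at h5
    have h6 := hmono hγ 0 t le_rfl h1 h2
    linarith [hδle' P]
  · intro i j γ s hs hγ P hmem hcert
    exact (hdata P).flow hs (hflow hγ P fun τ hτ => hDmono hww'.le (hmem τ hτ.1 hτ.2))
      (fun τ hτ => (hball P _ ((hmem τ hτ.1 hτ.2).2.trans hww'.le)).2.1) hcert
  · intro P i j z m hz hcert
    exact (hdata P).split m (hball P _ (hz.2.trans hww'.le)).2.1 hcert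
  · rintro P i j z hz ⟨Q, hQ, h1, h2⟩
    have h3 : ⟨Q, hQ⟩ = P := hdisj ⟨Q, hQ⟩ P z
      ⟨h1, h2.trans (hεξ.trans (hξu.le.trans huw.le))⟩ (hDmono hww'.le hz)
    subst h3
    exact (hdata ⟨Q, hQ⟩).bot (hball ⟨Q, hQ⟩ _ (hz.2.trans hww'.le)).2.1 h2
  · intro i j γ s hs hγ P m hmem hcert
    obtain ⟨h1, h2⟩ := hstep hγ P hmem
    exact (hdata P).step_left hs h1 h2 m hcert
  · intro i j γ s hs hγ P m hmem hcert
    obtain ⟨h1, h2⟩ := hstep hγ P hmem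
    exact (hdata P).step_right hs h1 h2 m hcert

end Assembly

theorem theorem11p1
    -- a compact Riemann surface with a general Higgs bundle
    {X : Type*} [TopologicalSpace X] [T2Space X] [CompactSpace X] [ConnectedSpace X]
    [ChartedSpace ℂ X] [IsManifold 𝓘(ℂ) ω X]
    {F : Type*} [NormedAddCommGroup F] [NormedSpace ℂ F] [FiniteDimensional ℂ F]
    {E : X → Type*} [TopologicalSpace (Bundle.TotalSpace F E)] [∀ P, TopologicalSpace (E P)]
    [∀ P, AddCommGroup (E P)] [∀ P, Module ℂ (E P)] [∀ P, IsTopologicalAddGroup (E P)]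
    [∀ P, ContinuousSMul ℂ (E P)] [FiberBundle F E] [VectorBundle ℂ F E]
    [ContMDiffVectorBundle ω F E 𝓘(ℂ)] [∀ P, FiniteDimensional ℂ (E P)]
    (θ : ∀ P : X, TangentSpace 𝓘(ℂ) P →L[ℂ] E P →L[ℂ] E P) (hθ : IsGeneralHiggsField F θ)
    -- a ramified covering with the eigen-one-forms
    {Y : Type*} [TopologicalSpace Y] [T2Space Y] [CompactSpace Y] [ConnectedSpace Y]
    [ChartedSpace ℂ Y] [IsManifold 𝓘(ℂ) ω Y]
    (φ : Y → X) {r : ℕ} (α : Fin r → ∀ y : Y, TangentSpace 𝓘(ℂ) y →L[ℂ] ℂ)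
    (hφ : IsSpectralCover θ φ α)
    -- its universal covering, and the integrals of the eigen-one-forms there
    {Z : Type*} [TopologicalSpace Z] [T2Space Z] [SimplyConnectedSpace Z]
    [ChartedSpace ℂ Z] [IsManifold 𝓘(ℂ) ω Z]
    (π : Z → Y) (hcov : IsCoveringMap π) (hsurj : Function.Surjective π)
    (hπ : ContMDiff 𝓘(ℂ) 𝓘(ℂ) ω π)
    (p q : Z) (g : Fin r → Z → ℂ) (hg : ∀ i, IsIntegralFrom π (α i) p (g i))
    -- a metric, and local coordinates at the singular points
    (h : ConformalMetric Y) (c : Y → OpenPartialHomeomorph Y ℂ)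
    (hc : ∀ P, IsTurningPoint θ (φ P) → IsCoordinateAt (c P) P) :
    ∃ w₀ : ℝ, 0 < w₀ ∧ ∃ C : ℝ, 1 ≤ C ∧
      ∀ u w : ℝ, 0 < u → u < w → w ≤ w₀ → ∀ F₀ : ℝ, ∃ K : ℕ,
        ∀ ε ξ : ℝ, 0 < ε → ξ = C * ε → ξ < u → ∀ μ : ℝ, 0 < μ →
          ∀ (T : FurnishedTree (Fin r) Z) (Φ : Fin T.k → List Bool → ℝ → Z),
            T.IsFlowing (flowField h π g μ) Φ →
            (∀ v ∈ T.tops, v.2.2 ∉ discs π {P | IsTurningPoint θ (φ P)} c w) →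
            (∀ v ∈ T.bottoms Φ, v.2.2 ∈ discs π {P | IsTurningPoint θ (φ P)} c ε) →
            (T.gValue g q T.tops).re - F₀ ≤ (T.gValue g q (T.bottoms Φ)).re →
            ∃ b : ∀ l : Fin T.k, EdgeTree (Fin r) (T.index l.castSucc) (T.index l.succ),
              (∀ l, (T.branch l).Prunes (b l)) ∧
              (∀ v ∈ (T.withBranches b).bottoms Φ,
                v.2.2 ∈ discs π {P | IsTurningPoint θ (φ P)} c ξ) ∧
              ((T.withBranches b).bottoms Φ).length ≤ K := by
  obtain ⟨w₀, hw₀, C, hC, M, hdata⟩ := exists_countingData hφ hθ hπ hg h hc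
  refine ⟨w₀, hw₀, C, hC, fun u w hu huw hw F₀ => ?_⟩
  obtain ⟨δ, δ', hδ, hδ', hdata⟩ := hdata u w hu huw hw
  -- One κ meets both requirements of the counting argument, 2M + 1 ≤ κδ and M + 1 ≤ κδ'.
  set κ : ℝ := (2 * M + 1) / min δ δ' with hκ
  have hmin : 0 < min δ δ' := lt_min hδ hδ'
  have hκ0 : 0 ≤ κ := by positivity
  have hκmin : κ * min δ δ' = 2 * M + 1 := div_mul_cancel₀ _ hmin.ne'
  have hκδ : 2 * M + 1 ≤ κ * δ :=
    hκmin.symm.le.trans (mul_le_mul_of_nonneg_left (min_le_left _ _) hκ0)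
  have hκδ' : 2 * M + 1 ≤ κ * δ' :=
    hκmin.symm.le.trans (mul_le_mul_of_nonneg_left (min_le_right _ _) hκ0)
  refine ⟨⌈2 ^ (M + 1) * κ * F₀⌉₊, fun ε ξ hε hξ hξu μ hμ T Φ hT htop hbot hF => ?_⟩
  obtain ⟨V, U, H, Cert, Ψ, hcount, hV⟩ := hdata ε ξ hε hξ hξu μ hμ
  obtain ⟨b, hb1, hb2, hb3⟩ := T.exists_prune hcount hκδ
    (by linarith [(Nat.cast_nonneg M : (0 : ℝ) ≤ M)]) hκ0 Φ (fun l => (hT l).flowsBy)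
    (fun v hv P hP => htop v hv (hV P hP)) hbot hF
  exact ⟨b, hb1, hb2, by exact_mod_cast hb3.trans (Nat.le_ceil _)⟩
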